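/- In the \textsc{Directed Waypoint Routing Problem} (DWRP) the input is a directed graph $G=(V,E)$ (without parallel arcs), a set $W\subseteq V$ of waypoints, arc weights $w\colon E\to\mathbb{N}$, arc capacities $c\colon E\to\mathbb{N}$, and a budget $b\in\mathbb{N}$. The question is whether $G$ has a closed directed walk $C$ of total weight at most $b$ that visits every vertex of $W$ and traverses each arc $e$ at most $c(e)$ times. As usual, it is assumed that $|W|\ge 2$ and that $G$ is strongly connected. Let $n=|V|$, and let $k$ be the feedback edge number of the underlying undirected graph of $G$ (in which two opposite arcs give one edge), that is, the minimum number of edges whose removal leaves a forest. \textbf{Theorem.} DWRP can be solved in $k^{O(k)}+n^{O(1)}$ time: there are an algorithm (a program of a random access machine on which each memory access, comparison with zero, addition and subtraction of natural numbers takes one step) and a constant $a$ such that the algorithm, given $(G,W,w,c,b)$ but not $k$, halts on each such input after at most $k^{a k}+n^{a}$ steps with the correct answer. -/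

import Mathlib

namespace DWRP

/-! ### The problem -/

/-- An instance of the Directed Waypoint Routing Problem on the vertex set `Fin n`.
The values of `weight` and `cap` matter only on the arcs of `G`. -/
structure Instance where
  /-- number of vertices -/
  n : ℕ
  /-- the directed graph (no parallel arcs) -/
  G : Digraph (Fin n)
  /-- the waypoints -/
  W : Finset (Fin n)
  /-- arc weights -/
  weight : Fin n → Fin n → ℕ
  /-- arc capacities -/
  cap : Fin n → Fin n → ℕ
  /-- the budget -/
  budget : ℕ

/-- The arcs traversed by the vertex sequence `v₀, v₁, …, v_ℓ`, in order and with repetitions. -/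
def arcs {V : Type*} (l : List V) : List (V × V) := l.zip l.tail

/-- `l = [v₀, v₁, …, v_ℓ]` (with `ℓ ≥ 0`) is a closed directed walk of `G`: consecutive vertices
are joined by arcs, and `v₀ = v_ℓ`. -/
def IsClosedWalk {V : Type*} (G : Digraph V) (l : List V) : Prop :=
  l ≠ [] ∧ (∀ e ∈ arcs l, G.Adj e.1 e.2) ∧ l.head? = l.getLast?

/-- `l` is a solution: a closed directed walk of total weight at most the budget that visits every
waypoint and traverses each arc at most as often as its capacity allows. -/
def Instance.IsSolution (I : Instance) (l : List (Fin I.n)) : Prop :=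
  IsClosedWalk I.G l ∧
  ((arcs l).map fun e => I.weight e.1 e.2).sum ≤ I.budget ∧
  (∀ v ∈ I.W, v ∈ l) ∧
  ∀ u v, I.G.Adj u v → (arcs l).count (u, v) ≤ I.cap u v

/-- `I` is a yes-instance. -/
def Instance.IsYes (I : Instance) : Prop := ∃ l, I.IsSolution l

/-- Every vertex is reachable from every vertex by a directed walk. -/
def StronglyConnected {V : Type*} (G : Digraph V) : Prop :=
  ∀ u v, Relation.ReflTransGen G.Adj u v

/-- The feedback edge number of an undirected graph: the minimum number of edges whose removal
leaves a forest. -/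
noncomputable def feedbackEdgeNumber {V : Type*} (H : SimpleGraph V) : ℕ :=
  sInf {m | ∃ F : Finset (Sym2 V), (F : Set (Sym2 V)) ⊆ H.edgeSet ∧ F.card = m ∧
    (H.deleteEdges (F : Set (Sym2 V))).IsAcyclic}

/-- The parameter: the feedback edge number of the underlying undirected graph, in which two
opposite arcs give one edge. -/
noncomputable def Instance.fen (I : Instance) : ℕ :=
  feedbackEdgeNumber I.G.toSimpleGraphInclusive

/-! ### The machine model

Unit-cost random access machines, presented as programs with integer registers, integer arrays,
and structured control flow. A program is a finite text, so it names only finitely many registers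
and arrays; array cells are addressed by computed indices. The only arithmetic operations are
addition and (truncated) subtraction, so no multiplication comes at unit cost. -/

/-- Arithmetic expressions. -/
inductive Expr where
  /-- a constant -/
  | lit (c : ℕ)
  /-- the content of register `x` -/
  | reg (x : ℕ)
  /-- the content of the cell of array `a` at the computed index -/
  | get (a : ℕ) (index : Expr)
  /-- sum -/
  | add (e₁ e₂ : Expr)
  /-- truncated difference -/
  | sub (e₁ e₂ : Expr)

/-- Programs. -/
inductive Prog where
  /-- do nothing -/
  | skip
  /-- write the value of `e` into register `x` -/
  | setReg (x : ℕ) (e : Expr)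
  /-- write the value of `e` into the cell of array `a` at the computed index -/
  | setArr (a : ℕ) (index e : Expr)
  /-- run `p`, then `q` -/
  | seq (p q : Prog)
  /-- run `p` if the value of `e` is nonzero, otherwise `q` -/
  | ite (e : Expr) (p q : Prog)
  /-- run `p` as long as the value of `e` is nonzero -/
  | loop (e : Expr) (p : Prog)

/-- The memory: registers and arrays. -/
structure Store where
  /-- registers -/
  reg : ℕ → ℕ
  /-- `arr a i` is cell `i` of array `a` -/
  arr : ℕ → ℕ → ℕ

/-- Write `v` into register `x`. -/
def Store.setReg (s : Store) (x v : ℕ) : Store :=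
  ⟨Function.update s.reg x v, s.arr⟩

/-- Write `v` into cell `i` of array `a`. -/
def Store.setArr (s : Store) (a i v : ℕ) : Store :=
  ⟨s.reg, Function.update s.arr a (Function.update (s.arr a) i v)⟩

/-- The value of an expression. -/
def Expr.eval (s : Store) : Expr → ℕ
  | lit c => c
  | reg x => s.reg x
  | get a i => s.arr a (i.eval s)
  | add e₁ e₂ => e₁.eval s + e₂.eval s
  | sub e₁ e₂ => e₁.eval s - e₂.eval s

/-- The cost of evaluating an expression: one step for each constant, memory access and
arithmetic operation. -/
def Expr.cost : Expr → ℕ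
  | lit _ => 1
  | reg _ => 1
  | get _ i => i.cost + 1
  | add e₁ e₂ => e₁.cost + e₂.cost + 1
  | sub e₁ e₂ => e₁.cost + e₂.cost + 1

/-- `Run p s t s'`: program `p`, started with memory `s`, halts after `t` steps with memory `s'`.
At most one rule applies to given `p` and `s`, so the execution is deterministic; a program that
does not halt has no run. -/
inductive Run : Prog → Store → ℕ → Store → Prop
  | skip (s : Store) : Run .skip s 1 s
  | setReg (x : ℕ) (e : Expr) (s : Store) :
      Run (.setReg x e) s (e.cost + 1) (s.setReg x (e.eval s))
  | setArr (a : ℕ) (i e : Expr) (s : Store) :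
      Run (.setArr a i e) s (i.cost + e.cost + 1)
        (s.setArr a (i.eval s) (e.eval s))
  | seq {p q : Prog} {s s' s'' : Store} {t₁ t₂ : ℕ} (hp : Run p s t₁ s') (hq : Run q s' t₂ s'') :
      Run (.seq p q) s (t₁ + t₂) s''
  | iteTrue {e : Expr} {p q : Prog} {s s' : Store} {t : ℕ} (he : e.eval s ≠ 0)
      (hp : Run p s t s') : Run (.ite e p q) s (e.cost + 1 + t) s'
  | iteFalse {e : Expr} {p q : Prog} {s s' : Store} {t : ℕ} (he : e.eval s = 0)
      (hq : Run q s t s') : Run (.ite e p q) s (e.cost + 1 + t) s'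
  | loopDone {e : Expr} {p : Prog} {s : Store} (he : e.eval s = 0) :
      Run (.loop e p) s (e.cost + 1) s
  | loopStep {e : Expr} {p : Prog} {s s' s'' : Store} {t₁ t₂ : ℕ} (he : e.eval s ≠ 0)
      (hp : Run p s t₁ s') (hw : Run (.loop e p) s' t₂ s'') :
      Run (.loop e p) s (e.cost + 1 + t₁ + t₂) s''

/-! ### The input -/

/-- A vector laid out as an array. -/
def vectorArray {n : ℕ} (f : Fin n → ℕ) (i : ℕ) : ℕ :=
  if h : i < n then f ⟨i, h⟩ else 0

/-- An `n × n` matrix laid out row by row as an array: entry `(u, v)` is in cell `n * u + v`. -/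
def matrixArray {n : ℕ} (f : Fin n → Fin n → ℕ) (i : ℕ) : ℕ :=
  if h : i < n * n then f (⟨i, h⟩ : Fin (n * n)).divNat (⟨i, h⟩ : Fin (n * n)).modNat else 0

open Classical in
/-- The memory at the start. Register `0` holds the number of vertices, register `1` the budget;
array `0` holds the indicator vector of the waypoints, array `1` the adjacency matrix, and arrays
`2` and `3` the weights and the capacities of the arcs. All other cells hold `0`. -/
noncomputable def Instance.input (I : Instance) : Store where
  reg
    | 0 => I.n
    | 1 => I.budget
    | _ => 0
  arr
    | 0 => vectorArray fun v => if v ∈ I.W then 1 else 0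
    | 1 => matrixArray fun u v => if I.G.Adj u v then 1 else 0
    | 2 => matrixArray fun u v => if I.G.Adj u v then I.weight u v else 0
    | 3 => matrixArray fun u v => if I.G.Adj u v then I.cap u v else 0
    | _ => fun _ => 0

/-- Program `p` decides instance `I` within `T` steps: started on `I`, it halts after at most `T`
steps, and register `0` then holds `1` if `I` is a yes-instance and `0` if it is not. -/
def DecidesWithin (p : Prog) (I : Instance) (T : ℕ) : Prop :=
  ∃ t s, Run p I.input t s ∧ t ≤ T ∧ (I.IsYes → s.reg 0 = 1) ∧ (¬ I.IsYes → s.reg 0 = 0)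

end DWRP

/-!
A closed walk that solves an instance is, up to the order of its arcs, a balanced choice of arc
multiplicities whose support is connected and meets all waypoints: the multiplicities of a closed
walk are balanced, and conversely Euler's theorem (`exists_euler_trail`) turns such multiplicities
into a closed walk. On a pair of opposite arcs only the net flow matters, with one exception: net
flow zero may stand for an unused pair or for using both arcs once, to connect the two ends.
So the instance becomes a flow problem on a network (`DWRP.Net`) whose edges and vertices carry
price lists. Connectivity to a root waypoint is certified by ranks, which at each visited vertex
but the root decrease along some used edge. The instance is a yes-instance if and only if its
network has a solution whose price is at most the budget (`IsNetOf.feas`, `IsNetOf.isYes`).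

Price lists are general enough to absorb vertices. A vertex of degree one other than the root is
visited or not, whichever is cheaper, and its contribution becomes a part of the price of its
neighbour (`Net.feas_prune`). At a vertex of degree two the flow passes straight through, so the
two edges merge into one, and the minimum over the ways to serve the vertex goes into the price
list of the new edge (`Net.feas_merge`). Both steps preserve solvability, connectedness and the
cyclomatic number (`Net.Inv`), which at the beginning is at most the feedback edge number `k`. When
no step applies, all degrees but that of the root are at least three, and counting degrees
leaves at most `2 k + 1` vertices and `3 k` edges (`Net.Inv.card_le`).

A network with `V` vertices and `E` edges that has a solution has one with ranks at most `V`, by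
compressing the ranks, and flow values at most `E` in absolute value: a directed cycle of edges that
carry at least two units could be reduced by one unit without increasing the price, and without
such a cycle a cut that contains a given edge bounds its flow (`Net.Feas.exists_small`). So a
solution is a vector of `V + E` digits below `V + 2 E + 2`
(`Net.feas_iff_exists_digits`), and there are `k ^ O(k)` such vectors.

The algorithm builds the network, eliminates vertices, and runs through the vectors of digits like
an odometer, checking each of them in time polynomial in `n`. The bound `k ^ O(k) * n ^ O(1)` that
results is of the form `k ^ O(k) + n ^ O(1)`, since a product is at most the sum of the squares of
its factors (`time_le`). The correctness of the programs and their step counts are proved together,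
in a small program logic (`Ok`) with a frame rule (`Frame`): a program changes nothing that it has
no assignment to.
-/

namespace DWRP

/-! ### Closed walks and balanced arc multiplicities -/

section Euler

variable {V : Type*} [DecidableEq V]

/-- The list `l` of arcs is a directed walk from `x` to `y`. -/
def IsTrail : V → List (V × V) → V → Prop
  | x, [], y => x = y
  | x, e :: l, y => e.1 = x ∧ IsTrail e.2 l y

omit [DecidableEq V] in
theorem isTrail_append {x z : V} {l m : List (V × V)} :
    IsTrail x (l ++ m) z ↔ ∃ y, IsTrail x l y ∧ IsTrail y m z := by
  induction l generalizing x with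
  | nil => simp [IsTrail]
  | cons e l ih => simp [IsTrail, ih, and_assoc]

omit [DecidableEq V] in
theorem isTrail_arcs {x : V} {l : List V} :
    IsTrail x (arcs (x :: l)) ((x :: l).getLast (by simp)) := by
  induction l generalizing x with
  | nil => simp [arcs, IsTrail]
  | cons y l ih =>
    refine ⟨rfl, ?_⟩
    rw [List.getLast_cons (List.cons_ne_nil _ _)]
    exact ih

omit [DecidableEq V] in
theorem IsTrail.arcs_eq {x y : V} {l : List (V × V)} (h : IsTrail x l y) :
    arcs (x :: l.map Prod.snd) = l ∧ (x :: l.map Prod.snd).getLast (by simp) = y := by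
  induction l generalizing x with
  | nil => simpa [arcs, IsTrail] using h
  | cons e l ih =>
    obtain ⟨rfl, h2⟩ := h
    have := ih h2
    refine ⟨?_, by simpa using this.2⟩
    simp only [arcs, List.map_cons, List.tail_cons, List.zip_cons_cons] at this ⊢
    rw [this.1]

/-- A walk leaves each vertex as often as it enters it, up to the two ends. -/
theorem IsTrail.balance {x y : V} {l : List (V × V)} (h : IsTrail x l y) (v : V) :
    (l.countP fun e => e.1 = v) + (if y = v then 1 else 0) =
      (l.countP fun e => e.2 = v) + (if x = v then 1 else 0) := by
  induction l generalizing x with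
  | nil => cases h; simp
  | cons e l ih =>
    obtain ⟨rfl, h2⟩ := h
    have := ih h2
    simp only [List.countP_cons, decide_eq_true_eq]
    omega

variable [Fintype V]

theorem countP_fst (l : List (V × V)) (v : V) :
    (l.countP fun e => e.1 = v) = ∑ w, l.count (v, w) := by
  induction l with
  | nil => simp
  | cons e l ih =>
    simp only [List.countP_cons, ih, decide_eq_true_eq, List.count_cons, Finset.sum_add_distrib]
    congr 1
    obtain ⟨a, b⟩ := e
    by_cases h : a = v <;> simp [h]

theorem countP_snd (l : List (V × V)) (v : V) :
    (l.countP fun e => e.2 = v) = ∑ w, l.count (w, v) := by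
  induction l with
  | nil => simp
  | cons e l ih =>
    simp only [List.countP_cons, ih, decide_eq_true_eq, List.count_cons, Finset.sum_add_distrib]
    congr 1
    obtain ⟨a, b⟩ := e
    by_cases h : b = v <;> simp [h]

theorem length_le_of_count_le {l : List (V × V)} {f : V → V → ℕ}
    (h : ∀ u v, l.count (u, v) ≤ f u v) : l.length ≤ ∑ u, ∑ v, f u v := by
  have : l.length = ∑ e : V × V, l.count e := by
    induction l with
    | nil => simp
    | cons e l ih =>
      have := ih fun u v => (List.count_le_count_cons ..).trans (h u v)
      simp [List.count_cons, Finset.sum_add_distrib, this]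
  rw [this, Fintype.sum_prod_type]
  exact Finset.sum_le_sum fun u _ => Finset.sum_le_sum fun v _ => h u v

/-- In a balanced directed multigraph a vertex with an outgoing arc lies on a nonempty closed
walk: a longest walk that starts at the vertex can only end there. -/
theorem exists_closed_trail {f : V → V → ℕ} (hf : ∀ v, ∑ w, f v w = ∑ w, f w v) {p q : V}
    (hpq : 0 < f p q) :
    ∃ l, l ≠ [] ∧ IsTrail p l p ∧ ∀ u v, l.count (u, v) ≤ f u v := by
  let P : ℕ → Prop := fun n => ∃ l y, l.length = n ∧ IsTrail p l y ∧ ∀ u v, l.count (u, v) ≤ f u v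
  have hP1 : P 1 := ⟨[(p, q)], q, rfl, ⟨rfl, rfl⟩, fun u v => by
    by_cases h : (p, q) = (u, v)
    · cases h; simpa using Nat.succ_le_of_lt hpq
    · simp [h]⟩
  have hbd : ∀ n, P n → n ≤ ∑ u, ∑ v, f u v := by
    rintro n ⟨l, y, rfl, -, h⟩
    exact length_le_of_count_le h
  classical
  obtain ⟨l, y, hl, ht, hc⟩ := Nat.findGreatest_spec (P := P) (hbd 1 hP1) hP1
  have hlen : 1 ≤ l.length := hl ▸ Nat.le_findGreatest (hbd 1 hP1) hP1
  have hyp : y = p := by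
    by_contra hne
    have hb := ht.balance y
    rw [countP_fst, countP_snd] at hb
    simp only [if_true, if_neg (Ne.symm hne)] at hb
    have hlt : ∑ w, l.count (y, w) < ∑ w, f y w := by
      rw [hf y]
      have : ∑ w, l.count (w, y) ≤ ∑ w, f w y := Finset.sum_le_sum fun w _ => hc w y
      omega
    obtain ⟨w, -, hw⟩ := Finset.exists_lt_of_sum_lt hlt
    have hP : P (l.length + 1) := by
      refine ⟨l ++ [(y, w)], w, by simp, isTrail_append.2 ⟨y, ht, rfl, rfl⟩, fun u v => ?_⟩
      rw [List.count_append]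
      by_cases h : (y, w) = (u, v)
      · cases h; simpa using hw
      · simpa [h] using hc u v
    have := Nat.le_findGreatest (hbd _ hP) hP
    omega
  subst hyp
  exact ⟨l, by rintro rfl; simp at hlen, ht, hc⟩

/-- Euler's theorem, in the form needed: if the arc multiplicities `f` are balanced and every
vertex of `S` reaches `r` along arcs (of either direction) of `f` and vertices of `S`, as witnessed
by the ranks `d`, then a closed walk within `f` visits all of `S`. -/
theorem exists_euler_trail {f : V → V → ℕ} (hf : ∀ v, ∑ w, f v w = ∑ w, f w v) (r : V)
    (S : Set V) (d : V → ℕ)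
    (hd : ∀ v ∈ S, v ≠ r → ∃ p ∈ S, d p < d v ∧ (0 < f p v ∨ 0 < f v p)) :
    ∃ l, IsTrail r l r ∧ (∀ u v, l.count (u, v) ≤ f u v) ∧
      ∀ v ∈ S, v ∈ r :: l.map Prod.snd := by
  let P : ℕ → Prop := fun n => ∃ l, l.length = n ∧ IsTrail r l r ∧ ∀ u v, l.count (u, v) ≤ f u v
  have hP0 : P 0 := ⟨[], rfl, rfl, by simp⟩
  have hbd : ∀ n, P n → n ≤ ∑ u, ∑ v, f u v := by
    rintro n ⟨l, rfl, -, h⟩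
    exact length_le_of_count_le h
  classical
  obtain ⟨l, hl, ht, hc⟩ := Nat.findGreatest_spec (P := P) (Nat.zero_le _) hP0
  refine ⟨l, ht, hc, ?_⟩
  by_contra hex
  push Not at hex
  obtain ⟨v₀, hv₀, hn₀⟩ := hex
  -- an unvisited vertex of smallest rank
  let B : Set V := {v | v ∈ S ∧ v ∉ r :: l.map Prod.snd}
  obtain ⟨v, ⟨hvS, hvl⟩, hmin⟩ := (measure d).wf.has_min B ⟨v₀, hv₀, hn₀⟩
  have hvr : v ≠ r := fun h => hvl (by simp [h])
  obtain ⟨p, hpS, hdp, hfp⟩ := hd v hvS hvr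
  have hpl : p ∈ r :: l.map Prod.snd := by
    by_contra h
    exact hmin p ⟨hpS, h⟩ hdp
  -- neither arc between `p` and `v` is used by the walk
  have hb := fun w => ht.balance w
  have hin : (l.countP fun e => e.2 = v) = 0 := by
    rw [List.countP_eq_zero]
    rintro ⟨a, b⟩ he hb'
    simp only [decide_eq_true_eq] at hb'
    exact hvl (by simp only [List.mem_cons, List.mem_map]; exact Or.inr ⟨_, he, hb'⟩)
  have hout : (l.countP fun e => e.1 = v) = 0 := by
    have := hb v
    omega
  have hres : ∀ w, ∑ x, (f w x - l.count (w, x)) = ∑ x, (f x w - l.count (x, w)) := by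
    intro w
    have h1 := hf w
    have h2 := hb w
    rw [countP_fst, countP_snd] at h2
    have h3 : ∑ x, (f w x - l.count (w, x)) + ∑ x, l.count (w, x) = ∑ x, f w x := by
      rw [← Finset.sum_add_distrib]
      exact Finset.sum_congr rfl fun x _ => Nat.sub_add_cancel (hc w x)
    have h4 : ∑ x, (f x w - l.count (x, w)) + ∑ x, l.count (x, w) = ∑ x, f x w := by
      rw [← Finset.sum_add_distrib]
      exact Finset.sum_congr rfl fun x _ => Nat.sub_add_cancel (hc x w)
    omega
  have hpout : 0 < ∑ x, (f p x - l.count (p, x)) := by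
    rcases hfp with h | h
    · refine lt_of_lt_of_le ?_ (Finset.single_le_sum (fun _ _ => Nat.zero_le _) (Finset.mem_univ v))
      have : l.count (p, v) = 0 := by
        rw [countP_snd] at hin
        exact (Finset.sum_eq_zero_iff.1 hin) p (Finset.mem_univ _)
      omega
    · rw [hres p]
      refine lt_of_lt_of_le ?_ (Finset.single_le_sum (fun _ _ => Nat.zero_le _) (Finset.mem_univ v))
      have : l.count (v, p) = 0 := by
        rw [countP_fst] at hout
        exact (Finset.sum_eq_zero_iff.1 hout) p (Finset.mem_univ _)
      omega
  obtain ⟨q, -, hq⟩ := Finset.exists_lt_of_sum_lt (s := Finset.univ) (f := fun _ => 0)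
    (by simpa using hpout)
  obtain ⟨m, hm, hmt, hmc⟩ := exists_closed_trail hres hq
  -- insert the closed walk `m` at an occurrence of `p`
  obtain ⟨l₁, l₂, rfl, ht₁, ht₂⟩ : ∃ l₁ l₂, l = l₁ ++ l₂ ∧ IsTrail r l₁ p ∧ IsTrail p l₂ r := by
    rcases List.mem_cons.1 hpl with rfl | h
    · exact ⟨[], l, rfl, rfl, ht⟩
    · obtain ⟨e, he, rfl⟩ := List.mem_map.1 h
      obtain ⟨s, t, rfl⟩ := List.append_of_mem he
      obtain ⟨y, h1, h2, h3⟩ := isTrail_append.1 ht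
      exact ⟨s ++ [e], t, by simp, isTrail_append.2 ⟨y, h1, h2, rfl⟩, h3⟩
  have hP : P ((l₁ ++ l₂).length + m.length) := by
    refine ⟨l₁ ++ (m ++ l₂), by simp; omega,
      isTrail_append.2 ⟨p, ht₁, isTrail_append.2 ⟨p, hmt, ht₂⟩⟩, fun u v => ?_⟩
    have := hmc u v
    have := hc u v
    simp only [List.count_append] at *
    omega
  have hle : (l₁ ++ l₂).length + m.length ≤ (l₁ ++ l₂).length :=
    (Nat.le_findGreatest (P := P) (hbd _ hP) hP).trans hl.ge
  have := List.length_pos_of_ne_nil hm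
  omega

end Euler

/-! ### Networks and the elimination of vertices of degree one and two -/

/-- An edge of a network, together with its orientation and its price list. A *busy* edge connects
its ends and carries a net flow `g` from `a` to `b` (from `b` to `a` if `g < 0`), where
`-cb ≤ g ≤ cf`; the price of `g ≠ 0` is `ga` plus `wf` or `wb` per unit, and the price of `g = 0`
is `w0`. An *idle* edge does not connect its ends; its price `n_{ij}` depends on whether its ends
`a` and `b` are visited. -/
@[ext]
structure Edge where
  /-- tail -/
  a : ℕ
  /-- head -/
  b : ℕ
  /-- price per unit of flow from `a` to `b` -/
  wf : ℕ
  /-- price per unit of flow from `b` to `a` -/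
  wb : ℕ
  /-- maximum flow from `a` to `b` -/
  cf : ℕ
  /-- maximum flow from `b` to `a` -/
  cb : ℕ
  /-- price of connecting the ends with net flow zero -/
  w0 : ℕ
  /-- fixed price of a nonzero flow -/
  ga : ℕ
  /-- idle price, both ends unvisited -/
  n00 : ℕ
  /-- idle price, only `b` visited -/
  n01 : ℕ
  /-- idle price, only `a` visited -/
  n10 : ℕ
  /-- idle price, both ends visited -/
  n11 : ℕ

namespace Edge

/-- The price of the edge when it is busy with net flow `g`. -/
def busy (x : Edge) (g : ℤ) : ℕ :=
  if g = 0 then x.w0 else x.wf * g.toNat + x.wb * (-g).toNat + x.ga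

/-- The price of the edge when it is idle and its ends have the ranks `p` and `q`, where rank `0`
means unvisited. -/
def idle (x : Edge) (p q : ℕ) : ℕ :=
  if p = 0 then (if q = 0 then x.n00 else x.n01) else (if q = 0 then x.n10 else x.n11)

/-- What net flow `g` on the edge contributes to the net inflow of the vertex `v`. -/
def inflow (x : Edge) (g : ℤ) (v : ℕ) : ℤ :=
  (if x.b = v then g else 0) - (if x.a = v then g else 0)

/-- The edge with the opposite orientation. -/
def flip (x : Edge) : Edge where
  a := x.b
  b := x.a
  wf := x.wb
  wb := x.wf
  cf := x.cb
  cb := x.cf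
  w0 := x.w0
  ga := x.ga
  n00 := x.n00
  n01 := x.n10
  n10 := x.n01
  n11 := x.n11

/-- The edge that replaces `x` followed by `y` when their common vertex, with prices `k₀` and `k₁`
for being unvisited and visited, is eliminated. If the new edge is idle, then the middle vertex is
unvisited, or attached to one of the two ends. -/
def comp (x y : Edge) (k₀ k₁ : ℕ) : Edge where
  a := x.a
  b := y.b
  wf := x.wf + y.wf
  wb := x.wb + y.wb
  cf := min x.cf y.cf
  cb := min x.cb y.cb
  w0 := x.w0 + y.w0 + k₁
  ga := x.ga + y.ga + k₁
  n00 := x.n00 + y.n00 + k₀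
  n01 := min (x.n00 + y.n01 + k₀) (x.n01 + y.w0 + k₁)
  n10 := min (x.n10 + y.n00 + k₀) (x.w0 + y.n10 + k₁)
  n11 := min (min (x.n10 + y.n01 + k₀) (x.w0 + y.n11 + k₁)) (x.n11 + y.w0 + k₁)

theorem busy_flip (x : Edge) (g : ℤ) : x.flip.busy (-g) = x.busy g := by
  simp only [busy, flip, neg_eq_zero, neg_neg]
  split_ifs <;> ring

theorem idle_flip (x : Edge) (p q : ℕ) : x.flip.idle p q = x.idle q p := by
  simp only [idle, flip]
  split_ifs <;> rfl

theorem inflow_flip (x : Edge) (g : ℤ) (v : ℕ) : x.flip.inflow (-g) v = x.inflow g v := by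
  by_cases h₁ : x.a = v <;> by_cases h₂ : x.b = v <;> simp [inflow, flip, h₁, h₂]

theorem inflow_zero (x : Edge) (v : ℕ) : x.inflow 0 v = 0 := by simp [inflow]

end Edge

/-- A network: a multigraph whose edges and vertices carry price lists. -/
@[ext]
structure Net where
  /-- vertices -/
  V : Finset ℕ
  /-- names of the edges -/
  E : Finset ℕ
  /-- the edge of a given name -/
  edge : ℕ → Edge
  /-- prices of leaving a vertex unvisited -/
  c0 : ℕ → ℕ
  /-- prices of visiting a vertex -/
  c1 : ℕ → ℕ

namespace Net

/-- The price of the vertex `v` when its rank is `d v`. -/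
def vcost (N : Net) (d : ℕ → ℕ) (v : ℕ) : ℕ := if d v = 0 then N.c0 v else N.c1 v

/-- The price of the edge `e`. -/
def ecost (N : Net) (d : ℕ → ℕ) (u : ℕ → Bool) (g : ℕ → ℤ) (e : ℕ) : ℕ :=
  if u e = true then (N.edge e).busy (g e) else (N.edge e).idle (d (N.edge e).a) (d (N.edge e).b)

/-- A solution of price at most `B`: ranks `d` (zero for unvisited vertices), a set `u` of busy
edges and a circulation `g` on them. That the busy edges connect the visited vertices to the root
`r` is expressed by the ranks: they decrease along some busy edge at each visited vertex but `r`. -/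
structure IsSol (N : Net) (r B : ℕ) (d : ℕ → ℕ) (u : ℕ → Bool) (g : ℕ → ℤ) : Prop where
  root : d r ≠ 0
  ends : ∀ e ∈ N.E, u e = true → d (N.edge e).a ≠ 0 ∧ d (N.edge e).b ≠ 0 ∧
    g e ≤ (N.edge e).cf ∧ -g e ≤ (N.edge e).cb
  off : ∀ e ∈ N.E, u e = false → g e = 0
  bal : ∀ v ∈ N.V, ∑ e ∈ N.E, (N.edge e).inflow (g e) v = 0
  par : ∀ v ∈ N.V, v ≠ r → d v ≠ 0 → ∃ e ∈ N.E, u e = true ∧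
    (((N.edge e).a = v ∧ d (N.edge e).b < d v) ∨ ((N.edge e).b = v ∧ d (N.edge e).a < d v))
  cost : ∑ v ∈ N.V, N.vcost d v + ∑ e ∈ N.E, N.ecost d u g e ≤ B

/-- The network has a solution of price at most `B`. -/
def Feas (N : Net) (r B : ℕ) : Prop := ∃ d u g, N.IsSol r B d u g

/-- Reverse the orientation of the edge `e`. -/
def flip (N : Net) (e : ℕ) : Net :=
  { N with edge := Function.update N.edge e (N.edge e).flip }

theorem flip_flip (N : Net) (e : ℕ) : (N.flip e).flip e = N := by
  ext1 <;> simp [flip, Edge.flip]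

theorem Feas.flip {N : Net} {r B : ℕ} (h : N.Feas r B) (e : ℕ) : (N.flip e).Feas r B := by
  obtain ⟨d, u, g, h⟩ := h
  have key : ∀ e', ((N.flip e).edge e' = N.edge e' ∧ Function.update g e (-g e) e' = g e') ∨
      ((N.flip e).edge e' = (N.edge e').flip ∧ Function.update g e (-g e) e' = -g e') := by
    intro e'
    by_cases he : e' = e
    · subst he; right; simp [Net.flip]
    · left; simp [Net.flip, he]
  refine ⟨d, u, Function.update g e (-g e), h.root, ?_, ?_, ?_, ?_, ?_⟩
  · intro e' he' hu
    have := h.ends e' he' hu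
    rcases key e' with ⟨h1, h2⟩ | ⟨h1, h2⟩ <;> rw [h1, h2]
    · exact this
    · exact ⟨this.2.1, this.1, this.2.2.2, by simpa [Edge.flip] using this.2.2.1⟩
  · intro e' he' hu
    have := h.off e' he' hu
    rcases key e' with ⟨h1, h2⟩ | ⟨h1, h2⟩ <;> rw [h2] <;> simp [this]
  · intro v hv
    rw [← h.bal v hv]
    refine Finset.sum_congr rfl fun e' _ => ?_
    rcases key e' with ⟨h1, h2⟩ | ⟨h1, h2⟩ <;> rw [h1, h2]
    exact Edge.inflow_flip ..
  · intro v hv hvr hd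
    obtain ⟨e', he', hu, hp⟩ := h.par v hv hvr hd
    refine ⟨e', he', hu, ?_⟩
    rcases key e' with ⟨h1, h2⟩ | ⟨h1, h2⟩ <;> rw [h1]
    · exact hp
    · exact hp.symm
  · refine le_of_eq_of_le ?_ h.cost
    congr 1
    refine Finset.sum_congr rfl fun e' _ => ?_
    rcases key e' with ⟨h1, h2⟩ | ⟨h1, h2⟩ <;> simp only [ecost, h1, h2]
    simp only [Edge.busy_flip, Edge.idle_flip]
    rfl

theorem feas_flip {N : Net} {r B : ℕ} (e : ℕ) : (N.flip e).Feas r B ↔ N.Feas r B :=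
  ⟨fun h => by simpa [flip_flip] using h.flip e, fun h => h.flip e⟩

/-- Eliminate the head of `e`, to be used when `e` is the only edge there. -/
def prune (N : Net) (e : ℕ) : Net where
  V := N.V.erase (N.edge e).b
  E := N.E.erase e
  edge := N.edge
  c0 := Function.update N.c0 (N.edge e).a
    (N.c0 (N.edge e).a + ((N.edge e).n00 + N.c0 (N.edge e).b))
  c1 := Function.update N.c1 (N.edge e).a
    (N.c1 (N.edge e).a + min ((N.edge e).n10 + N.c0 (N.edge e).b)
      ((N.edge e).w0 + N.c1 (N.edge e).b))

/-- Eliminating a vertex of degree one preserves solvability. A single edge carries no flow by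
balance, so it serves only to connect the vertex, and it is busy just if the vertex is visited. -/
theorem feas_prune {N : Net} {r B e : ℕ} (he : e ∈ N.E) (hav : (N.edge e).a ∈ N.V)
    (hbv : (N.edge e).b ∈ N.V) (hab : (N.edge e).a ≠ (N.edge e).b) (hr : (N.edge e).b ≠ r)
    (ho : ∀ e' ∈ N.E, e' ≠ e → (N.edge e').a ≠ (N.edge e).b ∧ (N.edge e').b ≠ (N.edge e).b) :
    (N.prune e).Feas r B ↔ N.Feas r B := by
  set a := (N.edge e).a with ha
  set b := (N.edge e).b with hb
  have haV : a ∈ N.V.erase b := Finset.mem_erase.2 ⟨hab, hav⟩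
  have hvc : ∀ d : ℕ → ℕ, ∑ v ∈ N.V.erase b, (N.prune e).vcost d v =
      ∑ v ∈ N.V.erase b, N.vcost d v + (if d a = 0 then (N.edge e).n00 + N.c0 b
        else min ((N.edge e).n10 + N.c0 b) ((N.edge e).w0 + N.c1 b)) := by
    intro d
    rw [← Finset.add_sum_erase _ _ haV, ← Finset.add_sum_erase _ _ haV]
    have : ∑ v ∈ (N.V.erase b).erase a, (N.prune e).vcost d v =
        ∑ v ∈ (N.V.erase b).erase a, N.vcost d v := by
      refine Finset.sum_congr rfl fun v hv => ?_
      have hva := (Finset.mem_erase.1 hv).1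
      simp [vcost, prune, ← ha, hva]
    rw [this]
    simp only [vcost, prune, ← ha, ← hb, Function.update_self]
    split_ifs <;> ring
  constructor
  · rintro ⟨d, u, g, h⟩
    have hcost := h.cost
    have hvc' := hvc d
    -- the eliminated vertex is visited if its neighbour is and this is cheaper
    set t : Bool := decide (d a ≠ 0 ∧ (N.edge e).w0 + N.c1 b < (N.edge e).n10 + N.c0 b) with ht
    set d' := Function.update d b (if t = true then d a + 1 else 0) with hd'
    set u' := Function.update u e t with hu'
    set g' := Function.update g e 0 with hg'
    have hda : ∀ v, v ≠ b → d' v = d v := fun v hv => by simp [hd', hv]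
    have hue : ∀ e', e' ≠ e → u' e' = u e' := fun v hv => by simp [hu', hv]
    have hge : ∀ e', e' ≠ e → g' e' = g e' := fun v hv => by simp [hg', hv]
    refine ⟨d', u', g', ?_, ?_, ?_, ?_, ?_, ?_⟩
    · rw [hda r (Ne.symm hr)]; exact h.root
    · intro e' he' hu
      by_cases hee : e' = e
      · subst hee
        have htt : t = true := by simpa [hu'] using hu
        have h0 : d a ≠ 0 := by simp [ht] at htt; exact htt.1
        rw [← ha, ← hb, hda a hab]
        simp [hd', htt, h0, hg']
      · have := h.ends e' (Finset.mem_erase.2 ⟨hee, he'⟩) (by rwa [hue e' hee] at hu)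
        obtain ⟨h1, h2⟩ := ho e' he' hee
        rw [hda _ h1, hda _ h2, hge e' hee]
        exact this
    · intro e' he' hu
      by_cases hee : e' = e
      · subst hee; simp [hg']
      · rw [hge e' hee]
        exact h.off e' (Finset.mem_erase.2 ⟨hee, he'⟩) (by rwa [hue e' hee] at hu)
    · intro v hv
      rw [← Finset.add_sum_erase _ _ he]
      have h1 : ∑ x ∈ N.E.erase e, (N.edge x).inflow (g' x) v =
          ∑ x ∈ N.E.erase e, (N.edge x).inflow (g x) v :=
        Finset.sum_congr rfl fun x hx => by rw [hge x (Finset.mem_erase.1 hx).1]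
      rw [h1]
      by_cases hvb : v = b
      · subst hvb
        rw [Finset.sum_eq_zero]
        · simp [hg', Edge.inflow_zero]
        · intro x hx
          obtain ⟨h1, h2⟩ := Finset.mem_erase.1 hx
          simp [Edge.inflow, ho x h2 h1]
      · have := h.bal v (Finset.mem_erase.2 ⟨hvb, hv⟩)
        simp only [prune] at this
        rw [this]
        simp [hg', Edge.inflow_zero]
    · intro v hv hvr hdv
      by_cases hvb : v = b
      · subst hvb
        have htt : t = true := by
          by_contra hcon
          simp [hd', hcon] at hdv
        refine ⟨e, he, by simp [hu', htt], Or.inr ⟨hb.symm, ?_⟩⟩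
        rw [← ha, hda a hab]
        simp [hd', htt]
      · rw [hda v hvb] at hdv
        obtain ⟨e', he', hu, hp⟩ := h.par v (Finset.mem_erase.2 ⟨hvb, hv⟩) hvr hdv
        obtain ⟨h1, h2⟩ := Finset.mem_erase.1 he'
        obtain ⟨h3, h4⟩ := ho e' h2 h1
        refine ⟨e', h2, by rwa [hue e' h1], ?_⟩
        rw [hda v hvb, hda _ h3, hda _ h4]
        exact hp
    · rw [← Finset.add_sum_erase _ _ he, ← Finset.add_sum_erase _ _ hbv]
      have h1 : ∑ v ∈ N.V.erase b, N.vcost d' v = ∑ v ∈ N.V.erase b, N.vcost d v :=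
        Finset.sum_congr rfl fun v hv => by
          simp only [vcost, hda v (Finset.mem_erase.1 hv).1]
      have h2 : ∑ x ∈ N.E.erase e, N.ecost d' u' g' x =
          ∑ x ∈ N.E.erase e, (N.prune e).ecost d u g x :=
        Finset.sum_congr rfl fun x hx => by
          obtain ⟨h1, h2⟩ := Finset.mem_erase.1 hx
          obtain ⟨h3, h4⟩ := ho x h2 h1
          simp only [ecost, hue x h1, hge x h1, hda _ h3, hda _ h4]
          rfl
      have h3 : N.vcost d' b + N.ecost d' u' g' e = (if d a = 0 then (N.edge e).n00 + N.c0 b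
        else min ((N.edge e).n10 + N.c0 b) ((N.edge e).w0 + N.c1 b)) := by
        have e1 : d' b = if t = true then d a + 1 else 0 := by simp [hd']
        have e2 : u' e = t := by simp [hu']
        have e3 : g' e = 0 := by simp [hg']
        simp only [vcost, ecost, ← ha, ← hb, hda a hab, e1, e2, e3, Edge.busy, Edge.idle]
        by_cases h0 : d a = 0
        · simp [ht, h0, add_comm]
        · by_cases hlt : (N.edge e).w0 + N.c1 b < (N.edge e).n10 + N.c0 b
          · have htt : t = true := by simp [ht, h0, hlt]
            simp only [htt, h0]
            simp
            omega
          · have htt : t = false := by simp [ht, hlt]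
            simp only [htt, h0]
            simp
            omega
      rw [h1, h2]
      have : (N.prune e).V = N.V.erase b := rfl
      rw [this, hvc'] at hcost
      have : (N.prune e).E = N.E.erase e := rfl
      rw [this] at hcost
      omega
  · rintro ⟨d, u, g, h⟩
    -- balance at the vertex
    have hg0 : g e = 0 := by
      have := h.bal b hbv
      rw [← Finset.add_sum_erase _ _ he, Finset.sum_eq_zero] at this
      · simpa [Edge.inflow, ← ha, ← hb, hab] using this
      · intro x hx
        obtain ⟨h1, h2⟩ := Finset.mem_erase.1 hx
        simp [Edge.inflow, ho x h2 h1]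
    -- the rank of the eliminated vertex decreases along its only edge, so no other vertex needs
    -- this edge for its own rank
    have hpb : d b ≠ 0 → u e = true ∧ d a < d b := by
      intro h0
      obtain ⟨e', he', hu, hp⟩ := h.par b hbv hr h0
      by_cases hee : e' = e
      · subst hee
        refine ⟨hu, ?_⟩
        rcases hp with hp | hp
        · exact absurd hp.1 hab
        · exact hp.2
      · obtain ⟨h3, h4⟩ := ho e' he' hee
        rcases hp with hp | hp
        · exact absurd hp.1 h3
        · exact absurd hp.1 h4
    refine ⟨d, u, g, h.root, fun e' he' => h.ends e' (Finset.mem_erase.1 he').2,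
      fun e' he' => h.off e' (Finset.mem_erase.1 he').2, ?_, ?_, ?_⟩
    · intro v hv
      have := h.bal v (Finset.mem_erase.1 hv).2
      rw [← Finset.add_sum_erase _ _ he, hg0, Edge.inflow_zero, zero_add] at this
      exact this
    · intro v hv hvr hdv
      obtain ⟨hvb, hv⟩ := Finset.mem_erase.1 hv
      obtain ⟨e', he', hu, hp⟩ := h.par v hv hvr hdv
      refine ⟨e', Finset.mem_erase.2 ⟨?_, he'⟩, hu, hp⟩
      rintro rfl
      rcases hp with ⟨hp, hlt⟩ | ⟨hp, -⟩
      · rw [← ha] at hp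
        subst hp
        rw [← hb] at hlt
        rcases Nat.eq_zero_or_pos (d b) with h0 | h0
        · exact (h.ends _ he' hu).2.1 h0
        · have := (hpb h0.ne').2
          omega
      · exact hvb hp.symm
    · have hcost := h.cost
      rw [← Finset.add_sum_erase _ _ he, ← Finset.add_sum_erase _ _ hbv] at hcost
      have hvc' := hvc d
      have h3 : (if d a = 0 then (N.edge e).n00 + N.c0 b
          else min ((N.edge e).n10 + N.c0 b) ((N.edge e).w0 + N.c1 b)) ≤
          N.vcost d b + N.ecost d u g e := by
        simp only [vcost, ecost, ← ha, ← hb, hg0, Edge.busy, Edge.idle]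
        have hend := h.ends e he
        rw [← ha, ← hb] at hend
        by_cases h0 : d a = 0
        · have hu : u e = false := by
            by_contra hcon
            exact (hend (by simpa using hcon)).1 h0
          have hb0 : d b = 0 := by
            by_contra hcon
            have := (hpb hcon).1
            simp [hu] at this
          simp [h0, hb0, hu]; omega
        · by_cases hb0 : d b = 0
          · have hu : u e = false := by
              by_contra hcon
              exact (hend (by simpa using hcon)).2.1 hb0
            simp only [h0, hb0, hu]; simp; omega
          · simp only [h0, hb0, (hpb hb0).1]; simp; omega
      have e1 : (N.prune e).V = N.V.erase b := rfl
      have e2 : (N.prune e).E = N.E.erase e := rfl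
      rw [e1, e2, hvc']
      have e3 : ∑ x ∈ N.E.erase e, (N.prune e).ecost d u g x =
        ∑ x ∈ N.E.erase e, N.ecost d u g x := rfl
      rw [e3]
      omega

/-- Eliminate the common vertex of `e₁` and `e₂`, to be used when the head of `e₁` is the tail of
`e₂` and these are the only edges there. -/
def merge (N : Net) (e₁ e₂ : ℕ) : Net where
  V := N.V.erase (N.edge e₁).b
  E := N.E.erase e₂
  edge := Function.update N.edge e₁
    ((N.edge e₁).comp (N.edge e₂) (N.c0 (N.edge e₁).b) (N.c1 (N.edge e₁).b))
  c0 := N.c0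
  c1 := N.c1

/-- Merging the two edges at a vertex of degree two preserves solvability. By balance both carry
the same flow, and the price list of the new edge contains the best way to serve the vertex. -/
theorem feas_merge {N : Net} {r B e₁ e₂ : ℕ} (he₁ : e₁ ∈ N.E) (he₂ : e₂ ∈ N.E) (hne : e₁ ≠ e₂)
    (hv : (N.edge e₁).b ∈ N.V) (heq : (N.edge e₂).a = (N.edge e₁).b)
    (ha : (N.edge e₁).a ≠ (N.edge e₁).b) (hb : (N.edge e₂).b ≠ (N.edge e₁).b)
    (hr : (N.edge e₁).b ≠ r)
    (ho : ∀ e ∈ N.E, e ≠ e₁ → e ≠ e₂ →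
      (N.edge e).a ≠ (N.edge e₁).b ∧ (N.edge e).b ≠ (N.edge e₁).b) :
    (N.merge e₁ e₂).Feas r B ↔ N.Feas r B := by
  set m := (N.edge e₁).b with hm
  set x := N.edge e₁ with hx
  set y := N.edge e₂ with hy
  set R := (N.E.erase e₂).erase e₁ with hR
  have hE : (N.merge e₁ e₂).E = N.E.erase e₂ := rfl
  have hV : (N.merge e₁ e₂).V = N.V.erase m := rfl
  have he₁' : e₁ ∈ N.E.erase e₂ := Finset.mem_erase.2 ⟨hne, he₁⟩
  have hnew : (N.merge e₁ e₂).edge e₁ = x.comp y (N.c0 m) (N.c1 m) := by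
    simp [merge, ← hm, ← hx, ← hy]
  have hold : ∀ e, e ≠ e₁ → (N.merge e₁ e₂).edge e = N.edge e := fun e he => by simp [merge, he]
  have hRmem : ∀ e, e ∈ R ↔ e ≠ e₁ ∧ e ≠ e₂ ∧ e ∈ N.E := by simp [hR]
  have hsum : ∀ {M : Type} [AddCommMonoid M] (f : ℕ → M),
      ∑ e ∈ N.E, f e = f e₂ + (f e₁ + ∑ e ∈ R, f e) := fun f => by
    rw [← Finset.add_sum_erase _ _ he₂, ← Finset.add_sum_erase _ _ he₁']
  have hsum' : ∀ {M : Type} [AddCommMonoid M] (f : ℕ → M),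
      ∑ e ∈ N.E.erase e₂, f e = f e₁ + ∑ e ∈ R, f e := fun f => by
    rw [← Finset.add_sum_erase _ _ he₁']
  -- the flow through the middle vertex
  have hbalm : ∀ g : ℕ → ℤ, ∑ e ∈ N.E, (N.edge e).inflow (g e) m = g e₁ - g e₂ := by
    intro g
    rw [hsum, Finset.sum_eq_zero (s := R)]
    · simp [Edge.inflow, ← hx, ← hy, ← hm, heq, ha, hb]; ring
    · intro e he
      obtain ⟨h1, h2, h3⟩ := (hRmem e).1 he
      simp [Edge.inflow, ho e h3 h1 h2]
  have hbalv : ∀ (g : ℤ) (v : ℕ), v ≠ m →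
      (x.comp y (N.c0 m) (N.c1 m)).inflow g v = y.inflow g v + x.inflow g v := by
    intro g v hv
    simp [Edge.inflow, Edge.comp, heq, ← hm, hv.symm]; ring
  constructor
  · rintro ⟨d, u, g, h⟩
    have hcost := h.cost
    have hends := h.ends e₁ he₁'
    rw [hnew] at hends
    -- The middle vertex gets the rank `k`, and `u₁`, `u₂` tell which edges are busy; this choice
    -- attains the price of the merged edge. The other ranks are doubled, so that an odd number
    -- is free next to the smaller one of the ranks of the ends.
    obtain ⟨k, u₁, u₂, hk0, hk1, hk2, hk3, hku, hoff, hpr⟩ : ∃ (k : ℕ) (u₁ u₂ : Bool),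
        (u₁ = true → d x.a ≠ 0 ∧ k ≠ 0) ∧ (u₂ = true → d y.b ≠ 0 ∧ k ≠ 0) ∧
        (k ≠ 0 → (u₁ = true ∧ 2 * d x.a < k) ∨ (u₂ = true ∧ 2 * d y.b < k)) ∧
        (u e₁ = true → (u₁ = true ∧ u₂ = true) ∧ (d y.b < d x.a → k < 2 * d x.a) ∧
          (d x.a < d y.b → k < 2 * d y.b)) ∧
        (u₁ = true → u₂ = true → u e₁ = true) ∧
        (u e₁ = false → g e₁ = 0) ∧
        (if k = 0 then N.c0 m else N.c1 m) +
          ((if u₂ = true then y.busy (g e₁) else y.idle k (d y.b)) +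
          (if u₁ = true then x.busy (g e₁) else x.idle (d x.a) k)) =
          (if u e₁ = true then (x.comp y (N.c0 m) (N.c1 m)).busy (g e₁)
            else (x.comp y (N.c0 m) (N.c1 m)).idle (d x.a) (d y.b)) := by
      by_cases hu : u e₁ = true
      · obtain ⟨h1, h2, -⟩ := hends hu
        simp only [Edge.comp] at h1 h2
        refine ⟨2 * min (d x.a) (d y.b) + 1, true, true, ?_, ?_, ?_, ?_, ?_, ?_, ?_⟩
        · simp [h1]
        · simp [h2]
        · intro _; simp; omega
        · intro _; refine ⟨by simp, by omega, by omega⟩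
        · intros; exact hu
        · intro h; simp [hu] at h
        · simp only [hu, if_true, Edge.busy, Edge.comp]
          simp only [Nat.add_eq_zero_iff, one_ne_zero, and_false, if_false]
          split_ifs <;> ring
      · have hg := h.off e₁ he₁' (by simpa using hu)
        have hu' : u e₁ = false := by simpa using hu
        have hcase : (N.c0 m + (y.idle 0 (d y.b) + x.idle (d x.a) 0) =
              (x.comp y (N.c0 m) (N.c1 m)).idle (d x.a) (d y.b)) ∨
            (d x.a ≠ 0 ∧ N.c1 m + (y.idle 1 (d y.b) + x.w0) =
              (x.comp y (N.c0 m) (N.c1 m)).idle (d x.a) (d y.b)) ∨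
            (d y.b ≠ 0 ∧ N.c1 m + (y.w0 + x.idle (d x.a) 1) =
              (x.comp y (N.c0 m) (N.c1 m)).idle (d x.a) (d y.b)) := by
          by_cases h1 : d x.a = 0 <;> by_cases h2 : d y.b = 0 <;>
            simp only [Edge.idle, Edge.comp, h1, h2, if_true, if_false, one_ne_zero, ne_eq,
              not_true_eq_false, not_false_eq_true, false_and, true_and, or_false, false_or] <;>
            omega
        rcases hcase with hp | ⟨h0, hp⟩ | ⟨h0, hp⟩
        · exact ⟨0, false, false, by simp, by simp, by simp, by simp [hu], by simp, by simp [hg],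
            by simpa [hu] using hp⟩
        · exact ⟨2 * d x.a + 1, true, false, by simp [h0], by simp, by simp, by simp [hu], by simp,
            by simp [hg], by simpa [hu, hg, Edge.busy, Edge.idle] using hp⟩
        · exact ⟨2 * d y.b + 1, false, true, by simp, by simp [h0], by simp, by simp [hu], by simp,
            by simp [hg], by simpa [hu, hg, Edge.busy, Edge.idle] using hp⟩
    set d' := Function.update (fun v => 2 * d v) m k with hd'
    set u' := Function.update (Function.update u e₁ u₁) e₂ u₂ with hu'
    set g' := Function.update g e₂ (g e₁) with hg'
    have hdo : ∀ v, v ≠ m → d' v = 2 * d v := fun v hv => by simp [hd', hv]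
    have hdm : d' m = k := by simp [hd']
    have huo : ∀ e, e ≠ e₁ → e ≠ e₂ → u' e = u e := fun e h1 h2 => by simp [hu', h1, h2]
    have hu1 : u' e₁ = u₁ := by simp [hu', hne]
    have hu2 : u' e₂ = u₂ := by simp [hu']
    have hgo : ∀ e, e ≠ e₂ → g' e = g e := fun e h1 => by simp [hg', h1]
    have hg2 : g' e₂ = g e₁ := by simp [hg']
    have hz : ∀ v, 2 * d v = 0 ↔ d v = 0 := fun v => by omega
    have hzm : u₁ = true → u₂ = true →
        g e₁ ≤ x.cf ∧ g e₁ ≤ y.cf ∧ -g e₁ ≤ x.cb ∧ -g e₁ ≤ y.cb := by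
      intro h1 h2
      have := (hends (hku h1 h2)).2.2
      simp only [Edge.comp] at this
      omega
    have hz0 : ¬ (u₁ = true ∧ u₂ = true) → g e₁ = 0 := fun hn => by
      by_cases hu : u e₁ = true
      · exact absurd (hk3 hu).1 hn
      · exact hoff (by simpa using hu)
    refine ⟨d', u', g', ?_, ?_, ?_, ?_, ?_, ?_⟩
    · rw [hdo r (Ne.symm hr)]
      have := h.root
      omega
    · intro e he hu
      by_cases h1 : e = e₁
      · subst h1
        rw [hu1] at hu
        rw [← hx, ← hm, hdm, hdo _ ha, hgo _ hne]
        refine ⟨by rw [ne_eq, hz]; exact (hk0 hu).1, (hk0 hu).2, ?_⟩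
        by_cases hu' : u₂ = true
        · have := hzm hu hu'; omega
        · have := hz0 (fun h => hu' h.2); omega
      · by_cases h2 : e = e₂
        · subst h2
          rw [hu2] at hu
          rw [← hy, heq, hdm, hdo _ hb, hg2]
          refine ⟨(hk1 hu).2, by rw [ne_eq, hz]; exact (hk1 hu).1, ?_⟩
          by_cases hu' : u₁ = true
          · have := hzm hu' hu; omega
          · have := hz0 (fun h => hu' h.1); omega
        · obtain ⟨h3, h4⟩ := ho e he h1 h2
          rw [huo e h1 h2] at hu
          have := h.ends e (Finset.mem_erase.2 ⟨h2, he⟩) hu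
          rw [hold e h1] at this
          rw [hdo _ h3, hdo _ h4, hgo e h2, ne_eq, ne_eq, hz, hz]
          exact this
    · intro e he hu
      by_cases h1 : e = e₁
      · subst h1
        rw [hu1] at hu
        rw [hgo _ hne]
        exact hz0 (by simp [hu])
      · by_cases h2 : e = e₂
        · subst h2
          rw [hu2] at hu
          rw [hg2]
          exact hz0 (by simp [hu])
        · rw [huo e h1 h2] at hu
          rw [hgo e h2]
          exact h.off e (Finset.mem_erase.2 ⟨h2, he⟩) hu
    · intro v hvV
      by_cases hvm : v = m
      · subst hvm
        rw [hbalm, hg2, hgo _ hne, sub_self]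
      · have := h.bal v (Finset.mem_erase.2 ⟨hvm, hvV⟩)
        rw [hE, hsum', hnew, hbalv _ _ hvm] at this
        rw [hsum, hg2, hgo _ hne, ← add_assoc, ← this]
        congr 1
        refine Finset.sum_congr rfl fun e he => ?_
        obtain ⟨h1, h2, -⟩ := (hRmem e).1 he
        rw [hold e h1, hgo e h2]
    · intro v hvV hvr hdv
      by_cases hvm : v = m
      · subst hvm
        rw [hdm] at hdv
        rcases hk2 hdv with ⟨h1, h2⟩ | ⟨h1, h2⟩
        · exact ⟨e₁, he₁, by rw [hu1, h1], Or.inr ⟨rfl, by rw [hdm, ← hx, hdo _ ha]; exact h2⟩⟩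
        · exact ⟨e₂, he₂, by rw [hu2, h1], Or.inl ⟨heq, by rw [hdm, ← hy, hdo _ hb]; exact h2⟩⟩
      · rw [hdo v hvm, ne_eq, hz] at hdv
        obtain ⟨e, he, hu, hp⟩ := h.par v (Finset.mem_erase.2 ⟨hvm, hvV⟩) hvr hdv
        obtain ⟨h2, he⟩ := Finset.mem_erase.1 he
        by_cases h1 : e = e₁
        · subst h1
          rw [hnew] at hp
          obtain ⟨⟨h5, h6⟩, h7, h8⟩ := hk3 hu
          rcases hp with ⟨hp, hlt⟩ | ⟨hp, hlt⟩
          · have hp : x.a = v := hp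
            have hlt : d y.b < d v := hlt
            refine ⟨e, he₁, by rw [hu1, h5], Or.inl ⟨hp, ?_⟩⟩
            rw [← hx, ← hm, hdm, hdo v hvm]
            subst hp
            exact h7 hlt
          · have hp : y.b = v := hp
            have hlt : d x.a < d v := hlt
            refine ⟨e₂, he₂, by rw [hu2, h6], Or.inr ⟨hp, ?_⟩⟩
            rw [← hy, heq, hdm, hdo v hvm]
            subst hp
            exact h8 hlt
        · obtain ⟨h3, h4⟩ := ho e he h1 h2
          rw [hold e h1] at hp
          refine ⟨e, he, by rw [huo e h1 h2, hu], ?_⟩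
          rw [hdo v hvm, hdo _ h3, hdo _ h4]
          omega
    · rw [hsum, ← Finset.add_sum_erase _ _ hv]
      rw [hE, hV, hsum'] at hcost
      have s1 : ∑ v ∈ N.V.erase m, N.vcost d' v = ∑ v ∈ N.V.erase m, (N.merge e₁ e₂).vcost d v :=
        Finset.sum_congr rfl fun v hv => by
          simp only [vcost, hdo v (Finset.mem_erase.1 hv).1, hz]
          rfl
      have s2 : ∑ e ∈ R, N.ecost d' u' g' e = ∑ e ∈ R, (N.merge e₁ e₂).ecost d u g e :=
        Finset.sum_congr rfl fun e he => by
          obtain ⟨h1, h2, h3⟩ := (hRmem e).1 he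
          obtain ⟨h4, h5⟩ := ho e h3 h1 h2
          simp only [ecost, huo e h1 h2, hgo e h2, hdo _ h4, hdo _ h5, hold e h1, Edge.idle, hz]
      have s3 : N.vcost d' m + (N.ecost d' u' g' e₂ + N.ecost d' u' g' e₁) =
          (N.merge e₁ e₂).ecost d u g e₁ := by
        have i1 : ∀ q, x.idle (2 * d x.a) q = x.idle (d x.a) q := by simp [Edge.idle]
        have i2 : ∀ q, y.idle q (2 * d y.b) = y.idle q (d y.b) := by simp [Edge.idle]
        simp only [vcost, ecost, hu1, hu2, hg2, hgo _ hne, ← hx, ← hy, ← hm, heq, hdm, hdo _ ha,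
          hdo _ hb, i1, i2, hnew]
        exact hpr
      rw [s1, s2]
      omega
  · rintro ⟨d, u, g, h⟩
    have hcost := h.cost
    have hgg : g e₂ = g e₁ := by
      have := h.bal m hv
      rw [hbalm] at this
      omega
    have hend1 := h.ends e₁ he₁
    have hend2 := h.ends e₂ he₂
    have hoff1 := h.off e₁ he₁
    have hoff2 := h.off e₂ he₂
    rw [← hx, ← hm] at hend1
    rw [← hy, heq, hgg] at hend2
    rw [hgg] at hoff2
    have hpm : d m ≠ 0 → (u e₁ = true ∧ d x.a < d m) ∨ (u e₂ = true ∧ d y.b < d m) := by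
      intro h0
      obtain ⟨e, he, hu, hp⟩ := h.par m hv hr h0
      by_cases h1 : e = e₁
      · subst h1
        rcases hp with hp | hp
        · exact absurd hp.1 ha
        · exact Or.inl ⟨hu, hp.2⟩
      · by_cases h2 : e = e₂
        · subst h2
          rcases hp with hp | hp
          · exact Or.inr ⟨hu, hp.2⟩
          · exact absurd hp.1 hb
        · obtain ⟨h3, h4⟩ := ho e he h1 h2
          rcases hp with hp | hp
          · exact absurd hp.1 h3
          · exact absurd hp.1 h4
    set u' := Function.update u e₁ (u e₁ && u e₂) with hu'
    have hu1 : u' e₁ = (u e₁ && u e₂) := by simp [hu']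
    have huo : ∀ e, e ≠ e₁ → u' e = u e := fun e h1 => by simp [hu', h1]
    refine ⟨d, u', g, h.root, ?_, ?_, ?_, ?_, ?_⟩
    · intro e he hu
      obtain ⟨h2, he⟩ := Finset.mem_erase.1 he
      by_cases h1 : e = e₁
      · subst h1
        rw [hu1, Bool.and_eq_true] at hu
        have := hend1 hu.1
        have := hend2 hu.2
        rw [hnew]
        simp only [Edge.comp]
        omega
      · rw [hold e h1]
        exact h.ends e he (by rwa [huo e h1] at hu)
    · intro e he hu
      obtain ⟨h2, he⟩ := Finset.mem_erase.1 he
      by_cases h1 : e = e₁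
      · subst h1
        rw [hu1] at hu
        by_cases hcon : u e = true
        · exact hoff2 (by simpa [hcon] using hu)
        · exact hoff1 (by simpa using hcon)
      · exact h.off e he (by rwa [huo e h1] at hu)
    · intro v hvV
      obtain ⟨hvm, hvV⟩ := Finset.mem_erase.1 hvV
      have := h.bal v hvV
      rw [hsum, hgg, ← add_assoc, ← hbalv _ _ hvm] at this
      rw [hE, hsum', hnew, ← this]
      congr 1
      refine Finset.sum_congr rfl fun e he => ?_
      rw [hold e ((hRmem e).1 he).1]
    · intro v hvV hvr hdv
      obtain ⟨hvm, hvV⟩ := Finset.mem_erase.1 hvV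
      obtain ⟨e, he, hu, hp⟩ := h.par v hvV hvr hdv
      by_cases h1 : e = e₁
      · subst h1
        rcases hp with ⟨hp, hlt⟩ | ⟨hp, hlt⟩
        · rw [← hm] at hlt
          have hm0 := (hend1 hu).2.1
          rw [← hx] at hp
          rcases hpm hm0 with h3 | h3
          · rw [hp] at h3; omega
          · refine ⟨e, he₁', by rw [hu1, hu, h3.1]; rfl, Or.inl ?_⟩
            rw [hnew]
            exact ⟨hp, h3.2.trans hlt⟩
        · exact absurd hp.symm hvm
      · by_cases h2 : e = e₂
        · subst h2
          rcases hp with ⟨hp, hlt⟩ | ⟨hp, hlt⟩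
          · exact absurd (hp.symm.trans heq) hvm
          · rw [← hy, heq] at hlt
            have hm0 := (hend2 hu).1
            rw [← hy] at hp
            rcases hpm hm0 with h3 | h3
            · refine ⟨e₁, he₁', by rw [hu1, hu, h3.1]; rfl, Or.inr ?_⟩
              rw [hnew]
              exact ⟨hp, h3.2.trans hlt⟩
            · rw [hp] at h3; omega
        · refine ⟨e, Finset.mem_erase.2 ⟨h2, he⟩, by rw [huo e h1, hu], ?_⟩
          rw [hold e h1]
          exact hp
    · rw [hsum, ← Finset.add_sum_erase _ _ hv] at hcost
      rw [hE, hV, hsum']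
      have s1 : ∑ v ∈ N.V.erase m, (N.merge e₁ e₂).vcost d v = ∑ v ∈ N.V.erase m, N.vcost d v :=
        rfl
      have s2 : ∑ e ∈ R, (N.merge e₁ e₂).ecost d u' g e = ∑ e ∈ R, N.ecost d u g e :=
        Finset.sum_congr rfl fun e he => by
          obtain ⟨h1, h2, h3⟩ := (hRmem e).1 he
          simp only [ecost, huo e h1, hold e h1]
      have s3 : (N.merge e₁ e₂).ecost d u' g e₁ ≤
          N.vcost d m + (N.ecost d u g e₂ + N.ecost d u g e₁) := by
        simp only [vcost, ecost, hu1, hnew, ← hx, ← hy, ← hm, heq, hgg]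
        have c1 : (x.comp y (N.c0 m) (N.c1 m)).a = x.a := rfl
        have c2 : (x.comp y (N.c0 m) (N.c1 m)).b = y.b := rfl
        rw [c1, c2]
        by_cases b1 : u e₁ = true <;> by_cases b2 : u e₂ = true
        · have := (hend1 b1).2.1
          simp only [b1, b2, Bool.and_self, if_true, this, if_false, Edge.busy, Edge.comp]
          split_ifs <;> apply le_of_eq <;> ring
        · obtain ⟨h1, h2, -⟩ := hend1 b1
          have hg0 := hoff2 (by simpa using b2)
          simp only [b1, b2, Bool.and_false, h1, h2, hg0, if_false, Edge.busy, Edge.comp, Edge.idle,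
            if_true, Bool.false_eq_true]
          split_ifs <;> omega
        · obtain ⟨h1, h2, -⟩ := hend2 b2
          have hg0 := hoff1 (by simpa using b1)
          simp only [b1, b2, Bool.false_and, h1, h2, hg0, if_false, Edge.busy, Edge.comp, Edge.idle,
            if_true, Bool.false_eq_true]
          split_ifs <;> omega
        · have h0 : d m = 0 := by
            by_contra hcon
            rcases hpm hcon with h | h
            exacts [b1 h.1, b2 h.1]
          simp only [b1, b2, Bool.and_self, h0, if_true, if_false, Edge.comp, Edge.idle,
            Bool.false_eq_true]
          split_ifs <;> omega
      rw [s1, s2]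
      omega

end Net

/-! ### Solutions with small flow values -/

/-- A map of a nonempty finite set into itself permutes some nonempty subset. -/
theorem exists_invariant_subset (Y : Finset ℕ) (hY : Y.Nonempty) (f : ℕ → ℕ)
    (hf : ∀ y ∈ Y, f y ∈ Y) : ∃ O ⊆ Y, O.Nonempty ∧ O.image f = O ∧ Set.InjOn f O := by
  obtain ⟨O, hO, hmin⟩ := Finset.exists_min_image
    (Y.powerset.filter fun O => O.Nonempty ∧ ∀ y ∈ O, f y ∈ O) Finset.card
    ⟨Y, by simp [hY]; exact hf⟩
  simp only [Finset.mem_filter, Finset.mem_powerset] at hO hmin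
  obtain ⟨hOY, hne, hcl⟩ := hO
  have hsub : O.image f ⊆ O := Finset.image_subset_iff.2 hcl
  have hle := hmin (O.image f) ⟨hsub.trans hOY, hne.image f, fun y hy =>
    Finset.mem_image_of_mem f (hsub hy)⟩
  have heq := Finset.eq_of_subset_of_card_le hsub hle
  exact ⟨O, hOY, hne, heq, Finset.card_image_iff.1 (by rw [heq])⟩

namespace Edge

/-- The end of the edge at which the net flow `g` enters the edge. -/
def src (x : Edge) (g : ℤ) : ℕ := if 0 < g then x.a else x.b

/-- The end of the edge at which the net flow `g` leaves the edge. -/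
def dst (x : Edge) (g : ℤ) : ℕ := if 0 < g then x.b else x.a

theorem inflow_eq (x : Edge) (g : ℤ) (v : ℕ) :
    x.inflow g v = |g| * ((if x.dst g = v then 1 else 0) - (if x.src g = v then 1 else 0)) := by
  unfold inflow src dst
  by_cases h : 0 < g
  · rw [abs_of_pos h]
    by_cases h₁ : x.a = v <;> by_cases h₂ : x.b = v <;> simp [h, h₁, h₂]
  · rw [abs_of_nonpos (by omega)]
    by_cases h₁ : x.a = v <;> by_cases h₂ : x.b = v <;> simp [h, h₁, h₂]

theorem inflow_sub_sign (x : Edge) {g : ℤ} (hg : g ≠ 0) (v : ℕ) :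
    x.inflow (g - g.sign) v = x.inflow g v -
      ((if x.dst g = v then 1 else 0) - (if x.src g = v then 1 else 0)) := by
  unfold inflow src dst
  rcases lt_or_gt_of_ne hg with h | h
  · have h' : ¬ 0 < g := by omega
    rw [Int.sign_eq_neg_one_of_neg h]
    by_cases h₁ : x.a = v <;> by_cases h₂ : x.b = v <;> simp [h', h₁, h₂]; ring
  · rw [Int.sign_eq_one_of_pos h]
    by_cases h₁ : x.a = v <;> by_cases h₂ : x.b = v <;> simp [h, h₁, h₂]; ring

theorem busy_sub_sign_le (x : Edge) {g : ℤ} (hg : 2 ≤ |g|) : x.busy (g - g.sign) ≤ x.busy g := by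
  unfold busy
  rcases lt_trichotomy g 0 with h | h | h
  · rw [abs_of_neg h] at hg
    rw [Int.sign_eq_neg_one_of_neg h, if_neg (by omega), if_neg (by omega)]
    gcongr <;> omega
  · simp [h] at hg
  · rw [abs_of_pos h] at hg
    rw [Int.sign_eq_one_of_pos h, if_neg (by omega), if_neg (by omega)]
    gcongr <;> omega

end Edge

namespace Net

variable {N : Net} {r B : ℕ} {d : ℕ → ℕ} {u : ℕ → Bool} {g : ℕ → ℤ}

/-- A directed cycle of edges that carry at least two units each can be reduced by one unit:
the cycle passes through the vertices of `O` and leaves `y ∈ O` along the edge `out y`. -/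
theorem IsSol.reduce (h : N.IsSol r B d u g) (O : Finset ℕ) (hO : O.Nonempty) (out : ℕ → ℕ)
    (hout : ∀ y ∈ O, out y ∈ N.E ∧ 2 ≤ |g (out y)| ∧ (N.edge (out y)).src (g (out y)) = y)
    (himg : O.image (fun y => (N.edge (out y)).dst (g (out y))) = O)
    (hinj : Set.InjOn (fun y => (N.edge (out y)).dst (g (out y))) O) :
    ∃ g', N.IsSol r B d u g' ∧ ∑ e ∈ N.E, (g' e).natAbs < ∑ e ∈ N.E, (g e).natAbs := by
  classical
  set F := O.image out with hF
  have hFE : F ⊆ N.E := Finset.image_subset_iff.2 fun y hy => (hout y hy).1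
  have hF2 : ∀ e ∈ F, 2 ≤ |g e| := by
    intro e he
    obtain ⟨y, hy, rfl⟩ := Finset.mem_image.1 he
    exact (hout y hy).2.1
  have hoinj : Set.InjOn out O := by
    intro y hy z hz hyz
    rw [← (hout y hy).2.2, ← (hout z hz).2.2, hyz]
  set g' : ℕ → ℤ := fun e => if e ∈ F then g e - (g e).sign else g e with hg'
  have hcases : ∀ e, e ∈ N.E → (g' e = g e) ∨ (g' e = g e - (g e).sign ∧ 2 ≤ |g e|) := by
    intro e _
    by_cases he : e ∈ F
    · right; exact ⟨by simp [hg', he], hF2 e he⟩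
    · left; simp [hg', he]
  have hsgn : ∀ z : ℤ, 2 ≤ |z| → (z.sign = 1 ∧ 2 ≤ z) ∨ (z.sign = -1 ∧ z ≤ -2) := by
    intro z hz
    rcases lt_trichotomy z 0 with h | h | h
    · rw [abs_of_neg h] at hz; exact Or.inr ⟨Int.sign_eq_neg_one_of_neg h, by omega⟩
    · simp [h] at hz
    · rw [abs_of_pos h] at hz; exact Or.inl ⟨Int.sign_eq_one_of_pos h, hz⟩
  refine ⟨g', ⟨h.root, ?_, ?_, ?_, h.par, ?_⟩, ?_⟩
  · intro e he hu
    have := h.ends e he hu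
    rcases hcases e he with h1 | ⟨h1, h2⟩
    · rwa [h1]
    · rw [h1]
      rcases hsgn _ h2 with h3 | h3 <;> rw [h3.1] <;> omega
  · intro e he hu
    have := h.off e he hu
    rcases hcases e he with h1 | ⟨h1, h2⟩
    · rwa [h1]
    · simp [this] at h2
  · intro v hv
    have h1 : ∀ e ∈ N.E, (N.edge e).inflow (g' e) v = (N.edge e).inflow (g e) v -
        (if e ∈ F then (if (N.edge e).dst (g e) = v then (1 : ℤ) else 0) -
          (if (N.edge e).src (g e) = v then 1 else 0) else 0) := by
      intro e _
      by_cases he : e ∈ F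
      · have := hF2 e he
        simp only [hg', he, if_true]
        exact Edge.inflow_sub_sign _ (by rintro h; simp [h] at this) v
      · simp [hg', he]
    rw [Finset.sum_congr rfl h1, Finset.sum_sub_distrib, h.bal v hv, ← Finset.sum_filter,
      Finset.filter_mem_eq_inter, Finset.inter_eq_right.2 hFE, hF, Finset.sum_image hoinj,
      Finset.sum_sub_distrib]
    have h2 : ∑ y ∈ O, (if (N.edge (out y)).dst (g (out y)) = v then (1 : ℤ) else 0) =
        ∑ y ∈ O, if y = v then 1 else 0 := by
      conv_rhs => rw [← himg]
      rw [Finset.sum_image hinj]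
    have h3 : ∑ y ∈ O, (if (N.edge (out y)).src (g (out y)) = v then (1 : ℤ) else 0) =
        ∑ y ∈ O, if y = v then 1 else 0 :=
      Finset.sum_congr rfl fun y hy => by rw [(hout y hy).2.2]
    rw [h2, h3]
    simp
  · refine le_trans (Nat.add_le_add_left (Finset.sum_le_sum fun e he => ?_) _) h.cost
    unfold ecost
    rcases hcases e he with h1 | ⟨h1, h2⟩ <;> rw [h1]
    by_cases hu : u e = true
    · simp only [hu, if_true]
      exact Edge.busy_sub_sign_le _ h2
    · simp [hu]
  · obtain ⟨y, hy⟩ := hO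
    refine Finset.sum_lt_sum (fun e he => ?_) ⟨out y, (hout y hy).1, ?_⟩
    · rcases hcases e he with h1 | ⟨h1, h2⟩ <;> rw [h1]
      rcases hsgn _ h2 with h3 | h3 <;> rw [h3.1] <;> omega
    · have h2 := (hout y hy).2.1
      have : out y ∈ F := Finset.mem_image_of_mem _ hy
      simp only [hg', this, if_true]
      rcases hsgn _ h2 with h3 | h3 <;> rw [h3.1] <;> omega

/-- In a solution of minimum total flow the flow values are at most the number of edges. The edges
that carry at least two units contain no directed cycle, so for each of them some set `X` of
vertices is entered by it and left only by edges that carry one unit. -/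
theorem IsSol.abs_le (h : N.IsSol r B d u g)
    (hN : ∀ e ∈ N.E, (N.edge e).a ∈ N.V ∧ (N.edge e).b ∈ N.V)
    (hmin : ∀ g', N.IsSol r B d u g' → ∑ e ∈ N.E, (g e).natAbs ≤ ∑ e ∈ N.E, (g' e).natAbs)
    {e₀ : ℕ} (he₀ : e₀ ∈ N.E) : |g e₀| ≤ N.E.card := by
  classical
  by_contra hcon
  push Not at hcon
  have hcard : 1 ≤ N.E.card := Finset.card_pos.2 ⟨e₀, he₀⟩
  have h2 : 2 ≤ |g e₀| := by omega
  let step : ℕ → ℕ → Prop := fun p q => ∃ e ∈ N.E, 2 ≤ |g e| ∧ (N.edge e).src (g e) = p ∧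
    (N.edge e).dst (g e) = q
  have hsV : ∀ e ∈ N.E, (N.edge e).src (g e) ∈ N.V := fun e he => by
    unfold Edge.src; split_ifs; exacts [(hN e he).1, (hN e he).2]
  have hdV : ∀ e ∈ N.E, (N.edge e).dst (g e) ∈ N.V := fun e he => by
    unfold Edge.dst; split_ifs; exacts [(hN e he).2, (hN e he).1]
  set p := (N.edge e₀).src (g e₀) with hp
  set q := (N.edge e₀).dst (g e₀) with hq
  set X := N.V.filter fun v => Relation.ReflTransGen step q v with hX
  by_cases hpX : Relation.ReflTransGen step q p
  · -- a cycle through `e₀`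
    -- Each vertex of `Y` has an outgoing edge into `Y` that carries at least two units, so the
    -- map that follows these edges has a cycle.
    set Y := N.V.filter fun v => Relation.ReflTransGen step v p with hY
    have hpY : ∀ v ∈ Y, ∃ e ∈ N.E, 2 ≤ |g e| ∧ (N.edge e).src (g e) = v ∧
        (N.edge e).dst (g e) ∈ Y := by
      intro v hv
      obtain ⟨hvV, hvp⟩ := Finset.mem_filter.1 hv
      rcases Relation.ReflTransGen.cases_head hvp with rfl | ⟨w, ⟨e, he, h1, h2, rfl⟩, hw⟩
      · exact ⟨e₀, he₀, h2, rfl, Finset.mem_filter.2 ⟨hdV _ he₀, hpX⟩⟩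
      · exact ⟨e, he, h1, h2, Finset.mem_filter.2 ⟨hdV _ he, hw⟩⟩
    choose! out ho1 ho2 ho3 ho4 using hpY
    obtain ⟨O, hOY, hne, himg, hinj⟩ := exists_invariant_subset Y
      ⟨p, Finset.mem_filter.2 ⟨hsV _ he₀, .refl⟩⟩ (fun y => (N.edge (out y)).dst (g (out y))) ho4
    obtain ⟨g', hg', hlt⟩ := h.reduce O hne out
      (fun y hy => ⟨ho1 y (hOY hy), ho2 y (hOY hy), ho3 y (hOY hy)⟩) himg hinj
    exact absurd (hmin g' hg') (by omega)
  -- `X` is entered by `e₀` and balanced, but each other edge takes at most one unit out of it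
  · have hsum : ∑ e ∈ N.E, ∑ v ∈ X, (N.edge e).inflow (g e) v = 0 := by
      rw [Finset.sum_comm]
      exact Finset.sum_eq_zero fun v hv => h.bal v (Finset.mem_filter.1 hv).1
    have hterm : ∀ e, ∑ v ∈ X, (N.edge e).inflow (g e) v =
        |g e| * ((if (N.edge e).dst (g e) ∈ X then 1 else 0) -
          (if (N.edge e).src (g e) ∈ X then 1 else 0)) := by
      intro e
      simp_rw [Edge.inflow_eq, ← Finset.mul_sum, Finset.sum_sub_distrib, Finset.sum_ite_eq]
    have hge : ∀ e ∈ N.E, -1 ≤ ∑ v ∈ X, (N.edge e).inflow (g e) v := by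
      intro e he
      rw [hterm]
      by_cases hs : (N.edge e).src (g e) ∈ X
      · by_cases hd : (N.edge e).dst (g e) ∈ X
        · simp [hs, hd]
        · have : |g e| < 2 := by
            by_contra hc
            push Not at hc
            refine hd (Finset.mem_filter.2 ⟨hdV e he, ?_⟩)
            exact (Finset.mem_filter.1 hs).2.tail ⟨e, he, hc, rfl, rfl⟩
          simp only [hs, hd, if_true, if_false]
          omega
      · have := abs_nonneg (g e)
        simp only [hs, if_false, sub_zero]
        split_ifs <;> omega
    have hqX : q ∈ X := Finset.mem_filter.2 ⟨hdV _ he₀, .refl⟩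
    have hpX' : p ∉ X := fun hh => hpX (Finset.mem_filter.1 hh).2
    have hbig : ∑ v ∈ X, (N.edge e₀).inflow (g e₀) v = |g e₀| := by
      rw [hterm, ← hp, ← hq]
      simp [hqX, hpX']
    rw [← Finset.add_sum_erase _ _ he₀, hbig] at hsum
    have : ∑ e ∈ N.E.erase e₀, (-1 : ℤ) ≤
        ∑ e ∈ N.E.erase e₀, ∑ v ∈ X, (N.edge e).inflow (g e) v :=
      Finset.sum_le_sum fun e he => hge e (Finset.mem_erase.1 he).2
    rw [Finset.sum_const, Finset.card_erase_of_mem he₀] at this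
    simp only [nsmul_eq_mul, mul_neg, mul_one] at this
    omega

/-- A feasible network has a solution with ranks at most the number of vertices and flow values at
most the number of edges. -/
theorem Feas.exists_small (h : N.Feas r B) (hr : r ∈ N.V)
    (hN : ∀ e ∈ N.E, (N.edge e).a ∈ N.V ∧ (N.edge e).b ∈ N.V) :
    ∃ d u g, N.IsSol r B d u g ∧ (∀ v, d v ≤ N.V.card) ∧ ∀ e ∈ N.E, |g e| ≤ N.E.card := by
  obtain ⟨d, u, g₀, h₀⟩ := h
  obtain ⟨g, h, hmin⟩ := (measure fun g : ℕ → ℤ => ∑ e ∈ N.E, (g e).natAbs).wf.has_min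
    {g | N.IsSol r B d u g} ⟨g₀, h₀⟩
  have hmin' : ∀ g', N.IsSol r B d u g' → ∑ e ∈ N.E, (g e).natAbs ≤ ∑ e ∈ N.E, (g' e).natAbs :=
    fun g' hg' => not_lt.1 (hmin g' hg')
  -- replace each rank by its position among the ranks that occur
  let d' : ℕ → ℕ := fun v =>
    if d v = 0 ∨ v ∉ N.V then 0 else (N.V.filter fun w => d w ≠ 0 ∧ d w < d v).card + 1
  have hz : ∀ v ∈ N.V, (d' v = 0 ↔ d v = 0) := by
    intro v hv
    by_cases h0 : d v = 0 <;> simp [d', h0, hv]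
  have hlt : ∀ v ∈ N.V, ∀ w ∈ N.V, d v ≠ 0 → d v < d w → d' v < d' w := by
    intro v hv w hw h0 hvw
    have h0' : d w ≠ 0 := by omega
    simp only [d', h0, h0', hv, hw, not_true_eq_false, or_self, if_false]
    refine Nat.add_lt_add_right (Finset.card_lt_card ⟨fun x hx => ?_, fun hsub => ?_⟩) 1
    · simp only [Finset.mem_filter] at hx ⊢
      exact ⟨hx.1, hx.2.1, by omega⟩
    · have := hsub (Finset.mem_filter.2 ⟨hv, h0, hvw⟩)
      simp at this
  refine ⟨d', u, g, ⟨?_, ?_, h.off, h.bal, ?_, ?_⟩, ?_, fun e he => h.abs_le hN hmin' he⟩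
  · rw [ne_eq, hz r hr]; exact h.root
  · intro e he hu
    rw [ne_eq, ne_eq, hz _ (hN e he).1, hz _ (hN e he).2]
    exact h.ends e he hu
  · intro v hv hvr hdv
    rw [ne_eq, hz v hv] at hdv
    obtain ⟨e, he, hu, hp⟩ := h.par v hv hvr hdv
    have he' := h.ends e he hu
    refine ⟨e, he, hu, hp.imp ?_ ?_⟩
    · rintro ⟨h1, h2⟩
      exact ⟨h1, hlt _ (hN e he).2 _ hv he'.2.1 h2⟩
    · rintro ⟨h1, h2⟩
      exact ⟨h1, hlt _ (hN e he).1 _ hv he'.1 h2⟩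
  · refine le_of_eq_of_le ?_ h.cost
    congr 1
    · exact Finset.sum_congr rfl fun v hv => by simp only [vcost, hz v hv]
    · exact Finset.sum_congr rfl fun e he => by
        simp only [ecost, Edge.idle, hz _ (hN e he).1, hz _ (hN e he).2]
  · intro v
    by_cases hv : d v = 0 ∨ v ∉ N.V
    · simp [d', hv]
    · simp only [d', hv, if_false]
      push Not at hv
      refine Finset.card_lt_card ⟨Finset.filter_subset _ _, fun hsub => ?_⟩
      have := hsub hv.2
      simp at this

end Net

namespace Net

/-! ### The size of a network without vertices of degree one and two -/

/-- What elimination preserves: the network is connected, in the sense that each cut that separates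
some vertex from the root `r` is crossed by an edge, and its cyclomatic number is at most `k`. -/
structure Inv (N : Net) (r k : ℕ) : Prop where
  root : r ∈ N.V
  ends : ∀ e ∈ N.E, (N.edge e).a ∈ N.V ∧ (N.edge e).b ∈ N.V
  conn : ∀ X ⊆ N.V, r ∈ X → X ≠ N.V → ∃ e ∈ N.E,
    ((N.edge e).a ∈ X ∧ (N.edge e).b ∉ X) ∨ ((N.edge e).b ∈ X ∧ (N.edge e).a ∉ X)
  card : N.E.card + 1 ≤ N.V.card + k

variable {N : Net} {r k : ℕ}

theorem Inv.flip (h : N.Inv r k) (e : ℕ) : (N.flip e).Inv r k := by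
  have key : ∀ e', (N.flip e).edge e' = N.edge e' ∨ (N.flip e).edge e' = (N.edge e').flip := by
    intro e'
    by_cases he : e' = e
    · subst he; right; simp [Net.flip]
    · left; simp [Net.flip, he]
  refine ⟨h.root, fun e' he' => ?_, fun X hX hr hne => ?_, h.card⟩
  · rcases key e' with h1 | h1 <;> rw [h1]
    · exact h.ends e' he'
    · exact (h.ends e' he').symm
  · obtain ⟨e', he', hp⟩ := h.conn X hX hr hne
    refine ⟨e', he', ?_⟩
    rcases key e' with h1 | h1 <;> rw [h1]
    · exact hp
    · exact hp.symm

theorem Inv.prune (h : N.Inv r k) {e : ℕ} (he : e ∈ N.E) (hab : (N.edge e).a ≠ (N.edge e).b)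
    (hr : (N.edge e).b ≠ r)
    (ho : ∀ e' ∈ N.E, e' ≠ e → (N.edge e').a ≠ (N.edge e).b ∧ (N.edge e').b ≠ (N.edge e).b) :
    (N.prune e).Inv r k := by
  have hbV := (h.ends e he).2
  have hE : (N.prune e).E = N.E.erase e := rfl
  have hV : (N.prune e).V = N.V.erase (N.edge e).b := rfl
  refine ⟨Finset.mem_erase.2 ⟨hr.symm, h.root⟩, fun e' he' => ?_, fun X hX hrX hne => ?_, ?_⟩
  · obtain ⟨h1, h2⟩ := Finset.mem_erase.1 he'
    obtain ⟨h3, h4⟩ := ho e' h2 h1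
    exact ⟨Finset.mem_erase.2 ⟨h3, (h.ends e' h2).1⟩, Finset.mem_erase.2 ⟨h4, (h.ends e' h2).2⟩⟩
  · rw [hV] at hX hne
    have hbX : (N.edge e).b ∉ X := fun hb => (Finset.mem_erase.1 (hX hb)).1 rfl
    -- put the eliminated vertex on the side of its neighbour
    by_cases haX : (N.edge e).a ∈ X
    · obtain ⟨e', he', hp⟩ := h.conn (insert (N.edge e).b X)
        (Finset.insert_subset hbV (hX.trans (Finset.erase_subset _ _)))
        (Finset.mem_insert_of_mem hrX) (fun heq => hne (by rw [← heq, Finset.erase_insert hbX]))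
      have hee : e' ≠ e := by rintro rfl; simp [haX] at hp
      obtain ⟨h3, h4⟩ := ho e' he' hee
      exact ⟨e', Finset.mem_erase.2 ⟨hee, he'⟩, by simpa [Net.prune, h3, h4] using hp⟩
    · obtain ⟨e', he', hp⟩ := h.conn X (hX.trans (Finset.erase_subset _ _)) hrX
        (fun heq => hbX (heq ▸ hbV))
      have hee : e' ≠ e := by rintro rfl; simp [haX, hbX] at hp
      exact ⟨e', Finset.mem_erase.2 ⟨hee, he'⟩, hp⟩
  · have := h.card
    have h1 := Finset.card_pos.2 ⟨e, he⟩
    have h2 := Finset.card_pos.2 ⟨_, hbV⟩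
    rw [hE, hV, Finset.card_erase_of_mem he, Finset.card_erase_of_mem hbV]
    omega

theorem Inv.merge (h : N.Inv r k) {e₁ e₂ : ℕ} (he₁ : e₁ ∈ N.E) (he₂ : e₂ ∈ N.E) (hne : e₁ ≠ e₂)
    (heq : (N.edge e₂).a = (N.edge e₁).b)
    (ha : (N.edge e₁).a ≠ (N.edge e₁).b) (hb : (N.edge e₂).b ≠ (N.edge e₁).b)
    (hr : (N.edge e₁).b ≠ r)
    (ho : ∀ e ∈ N.E, e ≠ e₁ → e ≠ e₂ →
      (N.edge e).a ≠ (N.edge e₁).b ∧ (N.edge e).b ≠ (N.edge e₁).b) :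
    (N.merge e₁ e₂).Inv r k := by
  set m := (N.edge e₁).b with hm
  have hmV : m ∈ N.V := (h.ends e₁ he₁).2
  have hE : (N.merge e₁ e₂).E = N.E.erase e₂ := rfl
  have hV : (N.merge e₁ e₂).V = N.V.erase m := rfl
  have he₁' : e₁ ∈ N.E.erase e₂ := Finset.mem_erase.2 ⟨hne, he₁⟩
  have hnew : ((N.merge e₁ e₂).edge e₁).a = (N.edge e₁).a ∧
      ((N.merge e₁ e₂).edge e₁).b = (N.edge e₂).b := by simp [Net.merge, Edge.comp]
  have hold : ∀ e, e ≠ e₁ → (N.merge e₁ e₂).edge e = N.edge e := fun e he => by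
    simp [Net.merge, he]
  refine ⟨Finset.mem_erase.2 ⟨hr.symm, h.root⟩, fun e he => ?_, fun X hX hrX hneX => ?_, ?_⟩
  · obtain ⟨h2, he⟩ := Finset.mem_erase.1 he
    by_cases h1 : e = e₁
    · subst h1
      rw [hnew.1, hnew.2]
      exact ⟨Finset.mem_erase.2 ⟨ha, (h.ends e he₁).1⟩, Finset.mem_erase.2 ⟨hb, (h.ends e₂ he₂).2⟩⟩
    · obtain ⟨h3, h4⟩ := ho e he h1 h2
      rw [hold e h1]
      exact ⟨Finset.mem_erase.2 ⟨h3, (h.ends e he).1⟩, Finset.mem_erase.2 ⟨h4, (h.ends e he).2⟩⟩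
  · rw [hV] at hX hneX
    have hmX : m ∉ X := fun hb => (Finset.mem_erase.1 (hX hb)).1 rfl
    -- put the middle vertex on the side of the tail of `e₁`
    by_cases haX : (N.edge e₁).a ∈ X
    · obtain ⟨e, he, hp⟩ := h.conn (insert m X)
        (Finset.insert_subset hmV (hX.trans (Finset.erase_subset _ _)))
        (Finset.mem_insert_of_mem hrX) (fun heq => hneX (by rw [← heq, Finset.erase_insert hmX]))
      by_cases h1 : e = e₁
      · subst h1; simp [← hm, haX] at hp
      · by_cases h2 : e = e₂
        · subst h2
          refine ⟨e₁, he₁', Or.inl ?_⟩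
          rw [hnew.1, hnew.2]
          simp only [heq, Finset.mem_insert_self, not_true_eq_false, and_false, or_false,
            true_and, Finset.mem_insert, not_or] at hp
          exact ⟨haX, hp.2⟩
        · obtain ⟨h3, h4⟩ := ho e he h1 h2
          refine ⟨e, Finset.mem_erase.2 ⟨h2, he⟩, ?_⟩
          rw [hold e h1]
          simpa [h3, h4] using hp
    · obtain ⟨e, he, hp⟩ := h.conn X (hX.trans (Finset.erase_subset _ _)) hrX
        (fun heq => hmX (heq ▸ hmV))
      by_cases h1 : e = e₁
      · subst h1; simp [← hm, haX, hmX] at hp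
      · by_cases h2 : e = e₂
        · subst h2
          refine ⟨e₁, he₁', Or.inr ?_⟩
          rw [hnew.1, hnew.2]
          simp only [heq, hmX, false_and, false_or, not_false_eq_true, and_true] at hp
          exact ⟨hp, haX⟩
        · refine ⟨e, Finset.mem_erase.2 ⟨h2, he⟩, ?_⟩
          rw [hold e h1]
          exact hp
  · have := h.card
    have h1 := Finset.card_pos.2 ⟨e₂, he₂⟩
    have h2 := Finset.card_pos.2 ⟨_, hmV⟩
    rw [hE, hV, Finset.card_erase_of_mem he₂, Finset.card_erase_of_mem hmV]
    omega

/-- The edges with name below `i` at the vertex `v`, newest first; loops occur twice. -/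
def inc (N : Net) (v : ℕ) : ℕ → List ℕ
  | 0 => []
  | i + 1 =>
    let l := if i ∈ N.E ∧ (N.edge i).a = v then i :: N.inc v i else N.inc v i
    if i ∈ N.E ∧ (N.edge i).b = v then i :: l else l

theorem count_inc (N : Net) (v e : ℕ) : ∀ i, (N.inc v i).count e = if e ∈ N.E ∧ e < i then
    (if (N.edge e).a = v then 1 else 0) + (if (N.edge e).b = v then 1 else 0) else 0
  | 0 => by simp [inc]
  | i + 1 => by
    have ih := count_inc N v e i
    simp only [inc]
    rcases lt_trichotomy e i with h | h | h
    · have h1 : i ≠ e := by omega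
      have h2 : e < i + 1 := by omega
      simp only [h, h2, and_true] at ih ⊢
      rw [← ih]
      split_ifs <;> simp [h1]
    · subst h
      simp only [lt_irrefl, and_false, if_false] at ih
      by_cases h0 : e ∈ N.E <;> by_cases h1 : (N.edge e).a = v <;>
        by_cases h2 : (N.edge e).b = v <;>
        simp [h0, h1, h2, ih]
    · have h1 : i ≠ e := by omega
      have h2 : ¬ e < i + 1 := by omega
      have h3 : ¬ e < i := by omega
      simp only [h2, h3, and_false, if_false] at ih ⊢
      rw [← ih]
      split_ifs <;> simp [h1]

theorem mem_inc {v i e : ℕ} : e ∈ N.inc v i ↔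
    e ∈ N.E ∧ e < i ∧ ((N.edge e).a = v ∨ (N.edge e).b = v) := by
  rw [← List.count_pos_iff, count_inc]
  by_cases h : e ∈ N.E ∧ e < i
  · simp only [h, and_self, if_true]
    split_ifs <;> simp_all
  · simp only [h, if_false]
    constructor
    · simp
    · exact fun h' => absurd ⟨h'.1, h'.2.1⟩ h

theorem length_inc (N : Net) (v i : ℕ) (hE : ∀ e ∈ N.E, e < i) : (N.inc v i).length =
    ∑ e ∈ N.E, ((if (N.edge e).a = v then 1 else 0) + (if (N.edge e).b = v then 1 else 0)) := by
  rw [← Multiset.coe_card, ← Multiset.toFinset_sum_count_eq]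
  rw [Finset.sum_subset (s₂ := N.E)]
  · refine Finset.sum_congr rfl fun e he => ?_
    rw [Multiset.coe_count, count_inc, if_pos ⟨he, hE e he⟩]
  · intro e he
    rw [Multiset.mem_toFinset, Multiset.mem_coe, mem_inc] at he
    exact he.1
  · intro e _ he
    rw [Multiset.mem_toFinset] at he
    exact Multiset.count_eq_zero_of_notMem he

/-- Handshake count: if no vertex but the root can be eliminated, then the network has
at most `2 k + 1` vertices and `3 k` edges. -/
theorem Inv.card_le (h : N.Inv r k) {i : ℕ} (hE : ∀ e ∈ N.E, e < i)
    (hdeg : ∀ v ∈ N.V, v ≠ r → (N.inc v i).length ≠ 1 ∧ ∀ e₁ e₂, N.inc v i = [e₁, e₂] → e₁ = e₂) :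
    N.V.card ≤ 2 * k + 1 ∧ N.E.card ≤ 3 * k := by
  have hd : ∀ v ∈ N.V.erase r, 3 ≤ (N.inc v i).length := by
    intro v hv
    obtain ⟨hvr, hvV⟩ := Finset.mem_erase.1 hv
    obtain ⟨e, he, hp⟩ := h.conn (N.V.erase v) (Finset.erase_subset _ _)
      (Finset.mem_erase.2 ⟨hvr.symm, h.root⟩) (fun heq => by
        rw [← heq] at hvV; simp at hvV)
    have hc : (N.inc v i).count e = 1 := by
      rw [count_inc, if_pos ⟨he, hE e he⟩]
      simp only [Finset.mem_erase, (h.ends e he).1, (h.ends e he).2, and_true, ne_eq, not_not] at hp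
      rcases hp with ⟨h1, h2⟩ | ⟨h1, h2⟩ <;> simp [h1, h2]
    obtain ⟨h1, h2⟩ := hdeg v hvV hvr
    match hl : N.inc v i with
    | [] => simp [hl] at hc
    | [x] => simp [hl] at h1
    | [x, y] =>
      have := h2 x y hl
      subst this
      rw [hl] at hc
      by_cases hx : x = e <;> simp [hx] at hc
    | _ :: _ :: _ :: _ => simp
  have hsum : ∑ v ∈ N.V, (N.inc v i).length = 2 * N.E.card := by
    simp_rw [length_inc N _ i hE]
    rw [Finset.sum_comm, Finset.sum_congr rfl (g := fun _ => 2)]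
    · simp [mul_comm]
    · intro e he
      rw [Finset.sum_add_distrib, Finset.sum_ite_eq, Finset.sum_ite_eq]
      simp [h.ends e he]
  rw [← Finset.add_sum_erase _ _ h.root] at hsum
  have h3 := Finset.card_nsmul_le_sum _ _ 3 hd
  rw [Finset.card_erase_of_mem h.root, smul_eq_mul] at h3
  have := h.card
  have := Finset.card_pos.2 ⟨r, h.root⟩
  omega

end Net

/-! ### Solutions as vectors of digits -/

namespace Net

variable {N : Net} {r B M D : ℕ} {t : ℕ → ℕ}

/-- The flow on the edges that is encoded by the digits `t`: digit zero stands for an idle edge,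
any other digit for a busy edge whose flow is the digit minus `M + 1`. -/
def digitFlow (M : ℕ) (t : ℕ → ℕ) (e : ℕ) : ℤ := if t e = 0 then 0 else t e - (M + 1)

/-- The digits `t` encode a solution of price at most `B`: those of the vertices are the ranks,
those of the edges tell the busy edges and the flow. -/
def Encodes (N : Net) (r B M : ℕ) (t : ℕ → ℕ) : Prop :=
  N.IsSol r B t (fun e => decide (t e ≠ 0)) (digitFlow M t)

/-- The flow on the edge `e` that enters `v` according to the digits `t`. -/
def inTerm (N : Net) (M : ℕ) (t : ℕ → ℕ) (v e : ℕ) : ℕ :=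
  if t e = 0 then 0 else (if (N.edge e).a = v then M + 1 - t e else 0) +
    if (N.edge e).b = v then t e - (M + 1) else 0

/-- The flow on the edge `e` that leaves `v` according to the digits `t`. -/
def outTerm (N : Net) (M : ℕ) (t : ℕ → ℕ) (v e : ℕ) : ℕ :=
  if t e = 0 then 0 else (if (N.edge e).a = v then t e - (M + 1) else 0) +
    if (N.edge e).b = v then M + 1 - t e else 0

/-- Nonzero if the edge `e` is busy and leads from `v` to a vertex of smaller rank. -/
def parTerm (N : Net) (t : ℕ → ℕ) (v e : ℕ) : ℕ :=
  if t e = 0 then 0 else (if (N.edge e).a = v then t v - t (N.edge e).b else 0) +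
    if (N.edge e).b = v then t v - t (N.edge e).a else 0

/-- The price of the edge `e` according to the digits `t`. -/
def digitCost (N : Net) (M : ℕ) (t : ℕ → ℕ) (e : ℕ) : ℕ :=
  if t e = 0 then (N.edge e).idle (t (N.edge e).a) (t (N.edge e).b)
  else if t e = M + 1 then (N.edge e).w0
  else (N.edge e).ga + (t e - (M + 1)) * (N.edge e).wf + (M + 1 - t e) * (N.edge e).wb

/-- What the digits have to satisfy at a vertex. -/
def VertexOk (N : Net) (r M : ℕ) (t : ℕ → ℕ) (v : ℕ) : Prop :=
  ∑ e ∈ N.E, N.inTerm M t v e = ∑ e ∈ N.E, N.outTerm M t v e ∧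
    (t v ≠ 0 → v ≠ r → ∑ e ∈ N.E, N.parTerm t v e ≠ 0)

/-- What the digits have to satisfy at an edge. -/
def EdgeOk (N : Net) (M : ℕ) (t : ℕ → ℕ) (e : ℕ) : Prop :=
  t e ≠ 0 → t (N.edge e).a ≠ 0 ∧ t (N.edge e).b ≠ 0 ∧ t e ≤ M + 1 + (N.edge e).cf ∧
    M + 1 ≤ t e + (N.edge e).cb

/-- Balance as an equation between natural numbers: the net inflow is what enters minus what
leaves. -/
theorem sum_inTerm_sub_sum_outTerm (N : Net) (M : ℕ) (t : ℕ → ℕ) (v : ℕ) :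
    ((∑ e ∈ N.E, N.inTerm M t v e : ℕ) : ℤ) - (∑ e ∈ N.E, N.outTerm M t v e : ℕ) =
      ∑ e ∈ N.E, (N.edge e).inflow (digitFlow M t e) v := by
  rw [Nat.cast_sum, Nat.cast_sum, ← Finset.sum_sub_distrib]
  refine Finset.sum_congr rfl fun e _ => ?_
  simp only [inTerm, outTerm, Edge.inflow, digitFlow]
  split_ifs <;> push_cast <;> omega

theorem digitCost_eq (N : Net) (M : ℕ) (t : ℕ → ℕ) (e : ℕ) :
    N.digitCost M t e = N.ecost t (fun e => decide (t e ≠ 0)) (digitFlow M t) e := by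
  unfold digitCost ecost Edge.busy digitFlow
  by_cases h : t e = 0
  · simp [h]
  by_cases h' : t e = M + 1
  · simp [h']
  have h1 : (t e : ℤ) - (M + 1) ≠ 0 := by omega
  have h2 : ((t e : ℤ) - (M + 1)).toNat = t e - (M + 1) := by omega
  have h3 : (-((t e : ℤ) - (M + 1))).toNat = M + 1 - t e := by omega
  simp only [h, h', ne_eq, not_false_eq_true, decide_true, if_true, if_false, h1, h2, h3]
  ring

/-- The solutions in terms of natural numbers, the way the program checks them. -/
theorem encodes_iff : N.Encodes r B M t ↔ t r ≠ 0 ∧ (∀ v ∈ N.V, N.VertexOk r M t v) ∧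
    (∀ e ∈ N.E, N.EdgeOk M t e) ∧ ∑ v ∈ N.V, N.vcost t v + ∑ e ∈ N.E, N.digitCost M t e ≤ B := by
  have hbal : ∀ v, ∑ e ∈ N.E, N.inTerm M t v e = ∑ e ∈ N.E, N.outTerm M t v e ↔
      ∑ e ∈ N.E, (N.edge e).inflow (digitFlow M t e) v = 0 := fun v => by
    rw [← sum_inTerm_sub_sum_outTerm]; omega
  have hpar : ∀ v, ∑ e ∈ N.E, N.parTerm t v e ≠ 0 ↔ ∃ e ∈ N.E, decide (t e ≠ 0) = true ∧
      (((N.edge e).a = v ∧ t (N.edge e).b < t v) ∨ ((N.edge e).b = v ∧ t (N.edge e).a < t v)) := by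
    intro v
    rw [ne_eq, Finset.sum_eq_zero_iff]
    push Not
    refine exists_congr fun e => and_congr_right fun _ => ?_
    rw [decide_eq_true_iff, parTerm]
    split_ifs <;> simp_all <;> omega
  have hcost : ∑ e ∈ N.E, N.digitCost M t e =
      ∑ e ∈ N.E, N.ecost t (fun e => decide (t e ≠ 0)) (digitFlow M t) e :=
    Finset.sum_congr rfl fun e _ => digitCost_eq N M t e
  rw [hcost]
  constructor
  · intro h
    refine ⟨h.root, fun v hv => ⟨(hbal v).2 (h.bal v hv), fun h0 hr => (hpar v).2
      (h.par v hv hr h0)⟩, fun e he h0 => ?_, h.cost⟩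
    obtain ⟨h1, h2, h3, h4⟩ := h.ends e he (by simpa using h0)
    rw [digitFlow, if_neg h0] at h3 h4
    exact ⟨h1, h2, by omega, by omega⟩
  · rintro ⟨h1, h2, h3, h4⟩
    refine ⟨h1, fun e he h0 => ?_, fun e _ h0 => ?_, fun v hv => (hbal v).1 (h2 v hv).1,
      fun v hv hr h0 => (hpar v).1 ((h2 v hv).2 h0 hr), h4⟩
    · have h0 : t e ≠ 0 := by simpa using h0
      obtain ⟨i1, i2, i3, i4⟩ := h3 e he h0
      rw [digitFlow, if_neg h0]
      exact ⟨i1, i2, by omega, by omega⟩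
    · have h0 : t e = 0 := by simpa using h0
      simp [digitFlow, h0]

/-- The vectors of digits below `D` that vanish off the set of positions `P`. -/
def IsDigits (D : ℕ) (P : ℕ → Prop) (t : ℕ → ℕ) : Prop := ∀ p, t p < D ∧ (¬ P p → t p = 0)

/-- It suffices to look for solutions among the vectors of small digits. -/
theorem feas_iff_exists_digits (hr : r ∈ N.V)
    (hN : ∀ e ∈ N.E, (N.edge e).a ∈ N.V ∧ (N.edge e).b ∈ N.V) (hVE : Disjoint N.V N.E) :
    N.Feas r B ↔ ∃ t, IsDigits (N.V.card + 2 * N.E.card + 2) (fun p => p ∈ N.V ∨ p ∈ N.E) t ∧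
      N.Encodes r B N.E.card t := by
  constructor
  · intro h
    obtain ⟨d, u, g, hs, hd, hg⟩ := h.exists_small hr hN
    set t : ℕ → ℕ := fun p => if p ∈ N.V then d p else if p ∈ N.E ∧ u p = true then
      (g p + (N.E.card + 1)).toNat else 0 with ht
    have htV : ∀ v ∈ N.V, t v = d v := fun v hv => by simp [ht, hv]
    have htE : ∀ e ∈ N.E, t e = if u e = true then (g e + (N.E.card + 1)).toNat else 0 :=
      fun e he => by simp [ht, he, Finset.disjoint_right.1 hVE he]
    have hu : ∀ e ∈ N.E, decide (t e ≠ 0) = u e := fun e he => by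
      have := abs_le.1 (hg e he)
      rw [htE e he]
      cases u e <;> simp
      omega
    have hf : ∀ e ∈ N.E, digitFlow N.E.card t e = g e := fun e he => by
      have := abs_le.1 (hg e he)
      by_cases h : u e = true
      · rw [digitFlow, htE e he, if_pos h, if_neg (by omega)]; omega
      · rw [digitFlow, htE e he, if_neg h, if_pos rfl, hs.off e he (by simpa using h)]
    refine ⟨t, fun p => ⟨?_, fun hp => ?_⟩, ?_⟩
    · simp only [ht]
      split_ifs with h1 h2
      · have := hd p; omega
      · have := abs_le.1 (hg p h2.1); omega
      · omega
    · push Not at hp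
      simp [ht, hp.1, hp.2]
    · refine ⟨by rw [htV r hr]; exact hs.root, fun e he h0 => ?_, fun e he h0 => ?_, fun v hv => ?_,
        fun v hv hvr h0 => ?_, ?_⟩
      · rw [htV _ (hN e he).1, htV _ (hN e he).2, hf e he]
        exact hs.ends e he (by rwa [hu e he] at h0)
      · rw [hf e he]
        exact hs.off e he (by rwa [hu e he] at h0)
      · rw [← hs.bal v hv]
        exact Finset.sum_congr rfl fun e he => by rw [hf e he]
      · rw [htV v hv] at h0 ⊢
        obtain ⟨e, he, h1, h2⟩ := hs.par v hv hvr h0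
        refine ⟨e, he, (hu e he).trans h1, ?_⟩
        rwa [htV _ (hN e he).1, htV _ (hN e he).2]
      · refine le_of_eq_of_le ?_ hs.cost
        congr 1
        · exact Finset.sum_congr rfl fun v hv => by simp only [vcost, htV v hv]
        · exact Finset.sum_congr rfl fun e he => by
            simp only [ecost, hu e he, hf e he, htV _ (hN e he).1, htV _ (hN e he).2]
  · rintro ⟨t, -, h⟩
    exact ⟨_, _, _, h⟩

end Net

/-! ### The network of an instance -/

open Classical in
/-- The weight of the arc `(u, v)`; zero if it is not an arc. -/
noncomputable def Instance.w (I : Instance) (u v : Fin I.n) : ℕ :=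
  if I.G.Adj u v then I.weight u v else 0

open Classical in
/-- The capacity of the arc `(u, v)`; zero if it is not an arc. -/
noncomputable def Instance.c (I : Instance) (u v : Fin I.n) : ℕ :=
  if I.G.Adj u v then I.cap u v else 0

/-- The name of the edge between `u` and `v` in the network of an instance, where `u < v`. The
vertices are named by the numbers below `n`. -/
def Instance.code (I : Instance) (p : Fin I.n × Fin I.n) : ℕ := I.n + (I.n * p.1 + p.2)

theorem Instance.code_injective (I : Instance) : Function.Injective I.code := by
  rintro ⟨u, v⟩ ⟨u', v'⟩ h
  simp only [code, Nat.add_left_cancel_iff] at h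
  have hn : 0 < I.n := u.pos
  have h1 : (u : ℕ) = u' := by
    have := congrArg (· / I.n) h
    simp only [Nat.mul_add_div hn, Nat.div_eq_of_lt v.2, Nat.div_eq_of_lt v'.2] at this
    exact this
  rw [h1] at h
  exact Prod.ext (Fin.ext h1) (Fin.ext (by simpa using h))

/-- The pairs `u < v` joined by an arc in some direction. -/
def Instance.IsPair (I : Instance) (p : Fin I.n × Fin I.n) : Prop :=
  p.1 < p.2 ∧ (I.G.Adj p.1 p.2 ∨ I.G.Adj p.2 p.1)

open Classical in
/-- The edge of the network for the pair `u < v`. Using it in both directions once is the same as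
connecting its ends with net flow zero; the price `budget + 1` makes this impossible if one of the
arcs is missing. -/
noncomputable def Instance.edge (I : Instance) (p : Fin I.n × Fin I.n) : Edge where
  a := p.1
  b := p.2
  wf := I.w p.1 p.2
  wb := I.w p.2 p.1
  cf := I.c p.1 p.2
  cb := I.c p.2 p.1
  w0 := if I.c p.1 p.2 ≠ 0 ∧ I.c p.2 p.1 ≠ 0 then I.w p.1 p.2 + I.w p.2 p.1 else I.budget + 1
  ga := 0
  n00 := 0
  n01 := 0
  n10 := 0
  n11 := 0

theorem Instance.idle_edge (I : Instance) (p : Fin I.n × Fin I.n) (x y : ℕ) :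
    (I.edge p).idle x y = 0 := by
  unfold Edge.idle
  split_ifs <;> rfl

open Classical in
/-- `N` is the network of `I`: leaving a waypoint unvisited has the prohibitive price
`budget + 1`. -/
structure IsNetOf (N : Net) (I : Instance) : Prop where
  V : N.V = Finset.range I.n
  E : N.E = (Finset.univ.filter I.IsPair).image I.code
  edge : ∀ p, I.IsPair p → N.edge (I.code p) = I.edge p
  c0 : ∀ v : Fin I.n, N.c0 v = if v ∈ I.W then I.budget + 1 else 0
  c1 : ∀ v : Fin I.n, N.c1 v = 0

theorem sum_list_map_count {n : ℕ} (l : List (Fin n × Fin n)) (f : Fin n → Fin n → ℕ) :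
    (l.map fun e => f e.1 e.2).sum = ∑ u, ∑ v, l.count (u, v) * f u v := by
  rw [← Fintype.sum_prod_type' (f := fun u v => l.count (u, v) * f u v)]
  induction l with
  | nil => simp
  | cons e l ih =>
    rw [List.map_cons, List.sum_cons, ih]
    simp [List.count_cons, add_mul, Finset.sum_add_distrib, add_comm]

/-- A sum over all ordered pairs of vertices, rearranged as a sum over the edges of the network. -/
theorem sum_pairs (I : Instance) [DecidablePred I.IsPair] {M : Type*} [AddCommMonoid M]
    (F : Fin I.n → Fin I.n → M) (hF : ∀ u v, ¬ I.G.Adj u v → ¬ I.G.Adj v u → F u v = 0) :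
    ∑ p ∈ Finset.univ.filter I.IsPair, (F p.1 p.2 + F p.2 p.1) + ∑ u, F u u =
      ∑ u, ∑ v, F u v := by
  have h1 : ∑ u, ∑ v, F u v = ∑ u, ∑ v, (if u < v then F u v else 0) +
      ∑ u, ∑ v, (if v < u then F u v else 0) + ∑ u, ∑ v, (if u = v then F u v else 0) := by
    simp_rw [← Finset.sum_add_distrib]
    refine Finset.sum_congr rfl fun u _ => Finset.sum_congr rfl fun v _ => ?_
    rcases lt_trichotomy u v with h | h | h
    · simp [h, h.ne, h.not_gt]
    · simp [h]
    · simp [h, h.ne', h.not_gt]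
  rw [h1, Finset.sum_comm (f := fun u v => if v < u then F u v else 0)]
  congr 1
  · rw [Finset.sum_filter, Fintype.sum_prod_type]
    simp_rw [← Finset.sum_add_distrib]
    refine Finset.sum_congr rfl fun u _ => Finset.sum_congr rfl fun v _ => ?_
    by_cases h : I.IsPair (u, v)
    · simp [h, h.1]
    · by_cases hlt : u < v
      · have h' : ¬ I.G.Adj u v ∧ ¬ I.G.Adj v u := by
          simpa [Instance.IsPair, hlt] using h
        simp [h, hF u v h'.1 h'.2, hF v u h'.2 h'.1]
      · simp [h, hlt]
  · simp

theorem IsNetOf.sum {N : Net} {I : Instance} (h : IsNetOf N I) [DecidablePred I.IsPair]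
    {M : Type*} [AddCommMonoid M] (F : ℕ → M) :
    ∑ e ∈ N.E, F e = ∑ p ∈ Finset.univ.filter I.IsPair, F (I.code p) := by
  rw [h.E, Finset.sum_image I.code_injective.injOn]
  congr!

theorem IsNetOf.sumV {N : Net} {I : Instance} (h : IsNetOf N I) {M : Type*} [AddCommMonoid M]
    (F : ℕ → M) : ∑ v ∈ N.V, F v = ∑ v : Fin I.n, F v := by
  rw [h.V, Finset.sum_range]

theorem IsNetOf.mem_E {N : Net} {I : Instance} (h : IsNetOf N I) {e : ℕ} :
    e ∈ N.E ↔ ∃ p, I.IsPair p ∧ I.code p = e := by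
  rw [h.E]; simp

theorem reachable_of_mem_walk {V : Type*} (H : SimpleGraph V) :
    ∀ (l : List V) (x : V), (∀ e ∈ arcs (x :: l), H.Reachable e.1 e.2) → ∀ v ∈ x :: l,
      H.Reachable x v
  | [], x, _, v, hv => by
    rw [List.mem_singleton] at hv; subst hv; exact SimpleGraph.Reachable.refl _
  | y :: l, x, he, v, hv => by
    have hxy : H.Reachable x y := he (x, y) (by simp [arcs])
    rcases List.mem_cons.1 hv with rfl | hv
    · exact SimpleGraph.Reachable.refl _
    · refine hxy.trans (reachable_of_mem_walk H l y (fun e h => he e ?_) v hv)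
      simp only [arcs, List.tail_cons, List.zip_cons_cons] at h ⊢
      exact List.mem_cons_of_mem _ h

theorem mem_of_mem_arcs {V : Type*} {l : List V} {e : V × V} (h : e ∈ arcs l) :
    e.1 ∈ l ∧ e.2 ∈ l := by
  have := List.of_mem_zip (a := e.1) (b := e.2) h
  exact ⟨this.1, List.mem_of_mem_tail this.2⟩

/-- A closed walk gives a solution: an edge is busy if the walk uses one of its arcs, its flow is
the net use, and the rank of a visited vertex is one more than its distance to the root in the
graph of the arcs used. -/
theorem IsNetOf.feas {N : Net} {I : Instance} (h : IsNetOf N I) {r : Fin I.n} (hr : r ∈ I.W)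
    (hI : I.IsYes) : N.Feas r I.budget := by
  classical
  obtain ⟨l, ⟨hne, hadj, hcl⟩, hw, hW, hc⟩ := hI
  set f : Fin I.n → Fin I.n → ℕ := fun u v => (arcs l).count (u, v) with hf
  have hfadj : ∀ u v, ¬ I.G.Adj u v → f u v = 0 := fun u v hn =>
    List.count_eq_zero.2 fun hm => hn (hadj _ hm)
  have hfc : ∀ u v, f u v ≤ I.c u v := by
    intro u v
    by_cases ha : I.G.Adj u v
    · simpa [Instance.c, ha] using hc u v ha
    · simp [hfadj u v ha]
  have hmem : ∀ u v, f u v ≠ 0 → u ∈ l ∧ v ∈ l := fun u v h0 => by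
    have : (u, v) ∈ arcs l := List.count_pos_iff.1 (Nat.pos_of_ne_zero h0)
    exact mem_of_mem_arcs this
  have hbal : ∀ v, ∑ w, f v w = ∑ w, f w v := by
    intro v
    cases l with
    | nil => exact absurd rfl hne
    | cons x t =>
      have ht := isTrail_arcs (x := x) (l := t)
      have hx : (x :: t).getLast (by simp) = x := by
        rw [List.head?_cons, List.getLast?_eq_some_getLast (by simp)] at hcl
        exact (Option.some_injective _ hcl).symm
      have := ht.balance v
      rw [hx, countP_fst, countP_snd] at this
      exact Nat.add_right_cancel this
  -- ranks by distance to the root in the graph of the traversed arcs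
  let H : SimpleGraph (Fin I.n) := SimpleGraph.fromRel fun u v => f u v ≠ 0
  have hreach : ∀ v ∈ l, H.Reachable v r := by
    cases l with
    | nil => exact absurd rfl hne
    | cons x t =>
      have hx := reachable_of_mem_walk H t x (fun e he => by
        by_cases hee : e.1 = e.2
        · rw [hee]
        · refine SimpleGraph.Adj.reachable ?_
          rw [SimpleGraph.fromRel_adj]
          exact ⟨hee, Or.inl (List.count_pos_iff.2 he).ne'⟩)
      exact fun v hv => (hx v hv).symm.trans (hx r (hW r hr))
  set d : ℕ → ℕ := fun v => if hv : v < I.n then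
    (if (⟨v, hv⟩ : Fin I.n) ∈ l then H.dist ⟨v, hv⟩ r + 1 else 0) else 0 with hd
  have hdv : ∀ v : Fin I.n, d v = if v ∈ l then H.dist v r + 1 else 0 := fun v => by simp [hd]
  set u : ℕ → Bool := Function.extend I.code (fun p => decide (f p.1 p.2 ≠ 0 ∨ f p.2 p.1 ≠ 0))
    (fun _ => false) with hu
  have huv : ∀ p, u (I.code p) = true ↔ f p.1 p.2 ≠ 0 ∨ f p.2 p.1 ≠ 0 := fun p => by
    simp [hu, I.code_injective.extend_apply]
  set g : ℕ → ℤ := Function.extend I.code (fun p => (f p.1 p.2 : ℤ) - f p.2 p.1) 0 with hg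
  have hgv : ∀ p, g (I.code p) = (f p.1 p.2 : ℤ) - f p.2 p.1 := fun p => by
    rw [hg, I.code_injective.extend_apply]
  refine ⟨d, u, g, ?_, ?_, ?_, ?_, ?_, ?_⟩
  · rw [hdv, if_pos (hW r hr)]; simp
  · intro e he hue
    obtain ⟨p, hp, rfl⟩ := h.mem_E.1 he
    rw [huv] at hue
    have hml : p.1 ∈ l ∧ p.2 ∈ l := by
      rcases hue with h1 | h1
      exacts [hmem _ _ h1, (hmem _ _ h1).symm]
    have e1 := hfc p.1 p.2
    have e2 := hfc p.2 p.1
    rw [h.edge p hp, hgv]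
    simp only [Instance.edge, hdv, hml, if_true]
    omega
  · intro e he hue
    obtain ⟨p, hp, rfl⟩ := h.mem_E.1 he
    have : ¬ (f p.1 p.2 ≠ 0 ∨ f p.2 p.1 ≠ 0) := by rw [← huv, hue]; simp
    rw [hgv]
    omega
  · intro v hv
    rw [h.V, Finset.mem_range] at hv
    rw [h.sum]
    have key := sum_pairs I
      (fun x y => (f x y : ℤ) * ((if (y : ℕ) = v then 1 else 0) - (if (x : ℕ) = v then 1 else 0)))
      (fun x y h1 _ => by simp [hfadj x y h1])
    simp only [sub_self, mul_zero, Finset.sum_const_zero, add_zero] at key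
    rw [Finset.sum_congr rfl (g := fun p : Fin I.n × Fin I.n => (f p.1 p.2 : ℤ) *
      ((if (p.2 : ℕ) = v then 1 else 0) - (if (p.1 : ℕ) = v then 1 else 0)) + (f p.2 p.1 : ℤ) *
      ((if (p.1 : ℕ) = v then 1 else 0) - (if (p.2 : ℕ) = v then 1 else 0))), key]
    · have hb := hbal ⟨v, hv⟩
      have e1 : ∀ x : Fin I.n, ((x : ℕ) = v) ↔ x = ⟨v, hv⟩ := fun x => by simp [Fin.ext_iff]
      simp_rw [mul_sub, Finset.sum_sub_distrib, e1]
      rw [Finset.sum_comm (f := fun x y => (f x y : ℤ) * (if x = ⟨v, hv⟩ then 1 else 0))]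
      simp only [mul_ite, mul_one, mul_zero, Finset.sum_ite_eq', Finset.mem_univ, if_true]
      rw [sub_eq_zero]
      exact_mod_cast hb.symm
    · intro p hp
      rw [h.edge p (Finset.mem_filter.1 hp).2, hgv]
      simp only [Edge.inflow, Instance.edge]
      by_cases h1 : (p.1 : ℕ) = v <;> by_cases h2 : (p.2 : ℕ) = v <;> simp [h1, h2] <;> ring
  · intro v hv hvr hdv0
    rw [h.V, Finset.mem_range] at hv
    lift v to Fin I.n using hv
    have hvr : v ≠ r := fun hh => hvr (by rw [hh])
    rw [hdv] at hdv0 ⊢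
    have hvl : v ∈ l := by by_contra hcon; simp [hcon] at hdv0
    obtain ⟨q, hq⟩ := (hreach v hvl).exists_walk_length_eq_dist
    cases q with
    | nil => exact absurd rfl hvr
    | @cons _ x _ hadj q =>
      rw [SimpleGraph.fromRel_adj] at hadj
      obtain ⟨hvx, hfx⟩ := hadj
      have hxl : x ∈ l := by
        rcases hfx with h1 | h1
        exacts [(hmem _ _ h1).2, (hmem _ _ h1).1]
      have hlt : d x < d v := by
        rw [hdv, hdv, if_pos hxl, if_pos hvl]
        have := SimpleGraph.dist_le q
        rw [SimpleGraph.Walk.length_cons] at hq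
        omega
      have hxv : I.G.Adj v x ∨ I.G.Adj x v := by
        by_contra hcon
        push Not at hcon
        simp [hfadj _ _ hcon.1, hfadj _ _ hcon.2] at hfx
      rw [← hdv]
      rcases lt_or_gt_of_ne hvx with hlt' | hlt'
      · have hp : I.IsPair (v, x) := ⟨hlt', hxv⟩
        refine ⟨I.code (v, x), h.mem_E.2 ⟨_, hp, rfl⟩, (huv _).2 hfx, Or.inl ?_⟩
        rw [h.edge _ hp]
        exact ⟨rfl, hlt⟩
      · have hp : I.IsPair (x, v) := ⟨hlt', hxv.symm⟩
        refine ⟨I.code (x, v), h.mem_E.2 ⟨_, hp, rfl⟩, (huv _).2 hfx.symm, Or.inr ?_⟩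
        rw [h.edge _ hp]
        exact ⟨rfl, hlt⟩
  · have hV0 : ∑ v ∈ N.V, N.vcost d v = 0 := by
      rw [h.sumV]
      refine Finset.sum_eq_zero fun v _ => ?_
      rw [Net.vcost, h.c0, h.c1, hdv]
      by_cases hvW : v ∈ I.W
      · simp [hW v hvW]
      · simp [hvW]
    rw [hV0, zero_add, h.sum]
    refine le_trans ?_ hw
    rw [sum_list_map_count _ I.weight]
    have key := sum_pairs I (fun x y => f x y * I.weight x y)
      (fun x y h1 _ => by simp [hfadj x y h1])
    refine le_trans (Finset.sum_le_sum fun p hp => ?_) (le_of_add_le_left key.le)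
    have hp := (Finset.mem_filter.1 hp).2
    have hwt : ∀ x y, f x y * I.weight x y = f x y * I.w x y := by
      intro x y
      by_cases ha : I.G.Adj x y
      · simp [Instance.w, ha]
      · simp [hfadj x y ha]
    rw [hwt, hwt]
    simp only [Net.ecost, h.edge p hp, hgv, huv]
    by_cases hub : f p.1 p.2 ≠ 0 ∨ f p.2 p.1 ≠ 0
    · rw [if_pos hub]
      simp only [Edge.busy, Instance.edge]
      by_cases h0 : (f p.1 p.2 : ℤ) - f p.2 p.1 = 0
      · have e1 := hfc p.1 p.2
        have e2 := hfc p.2 p.1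
        have e3 : f p.1 p.2 ≠ 0 := by omega
        have e4 : f p.2 p.1 ≠ 0 := by omega
        rw [if_pos h0, if_pos ⟨by omega, by omega⟩]
        exact Nat.add_le_add (Nat.le_mul_of_pos_left _ (Nat.pos_of_ne_zero e3))
          (Nat.le_mul_of_pos_left _ (Nat.pos_of_ne_zero e4))
      · rw [if_neg h0, add_zero, mul_comm (I.w _ _), mul_comm (I.w _ _)]
        gcongr <;> omega
    · rw [if_neg hub]
      simp [Instance.idle_edge]

/-- A solution gives a closed walk by Euler's theorem. Each busy edge with flow zero is used once
in both directions, so that the multiplicities are balanced and connect all visited vertices. -/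
theorem IsNetOf.isYes {N : Net} {I : Instance} (h : IsNetOf N I) {r : Fin I.n}
    (hN : N.Feas r I.budget) : I.IsYes := by
  classical
  obtain ⟨d, u, g, hs⟩ := hN
  -- how often the walk uses the two arcs of an edge
  let fw : ℕ → ℕ := fun e => if e ∈ N.E ∧ u e = true then
    (if g e = 0 then 1 else (g e).toNat) else 0
  let bw : ℕ → ℕ := fun e => if e ∈ N.E ∧ u e = true then
    (if g e = 0 then 1 else (-g e).toNat) else 0
  let f : Fin I.n → Fin I.n → ℕ := fun x y =>
    if x < y then fw (I.code (x, y)) else if y < x then bw (I.code (y, x)) else 0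
  have hf1 : ∀ p, I.IsPair p → f p.1 p.2 = fw (I.code p) := fun p hp => by simp [f, hp.1]
  have hf2 : ∀ p, I.IsPair p → f p.2 p.1 = bw (I.code p) := fun p hp => by
    simp [f, hp.1, hp.1.not_gt]
  have hfu : ∀ x, f x x = 0 := fun x => by simp [f]
  have hfs : ∀ x y, f x y ≠ 0 → (I.IsPair (x, y) ∧ u (I.code (x, y)) = true) ∨
      (I.IsPair (y, x) ∧ u (I.code (y, x)) = true) := by
    intro x y h0
    rcases lt_trichotomy x y with h1 | h1 | h1
    · left
      have h2 : fw (I.code (x, y)) ≠ 0 := by simpa [f, h1] using h0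
      have h3 : I.code (x, y) ∈ N.E ∧ u (I.code (x, y)) = true := by
        by_contra hcon; simp [fw, hcon] at h2
      obtain ⟨p, hp, hpe⟩ := h.mem_E.1 h3.1
      rw [I.code_injective hpe] at hp
      exact ⟨hp, h3.2⟩
    · subst h1; exact absurd (hfu x) h0
    · right
      have h2 : bw (I.code (y, x)) ≠ 0 := by simpa [f, h1, h1.not_gt] using h0
      have h3 : I.code (y, x) ∈ N.E ∧ u (I.code (y, x)) = true := by
        by_contra hcon; simp [bw, hcon] at h2
      obtain ⟨p, hp, hpe⟩ := h.mem_E.1 h3.1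
      rw [I.code_injective hpe] at hp
      exact ⟨hp, h3.2⟩
  have hfz : ∀ x y, ¬ I.G.Adj x y → ¬ I.G.Adj y x → f x y = 0 := by
    intro x y h1 h2
    by_contra h0
    rcases hfs x y h0 with h3 | h3
    · exact h3.1.2.elim h1 h2
    · exact h3.1.2.elim h2 h1
  have hcost := hs.cost
  have hecost : ∀ p, I.IsPair p → N.ecost d u g (I.code p) ≤ I.budget := by
    intro p hp
    have := Finset.single_le_sum (f := N.ecost d u g) (fun _ _ => Nat.zero_le _)
      (h.mem_E.2 ⟨p, hp, rfl⟩)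
    omega
  -- capacities, net flow and price of a pair
  have hpair : ∀ p, I.IsPair p → f p.1 p.2 ≤ I.c p.1 p.2 ∧ f p.2 p.1 ≤ I.c p.2 p.1 ∧
      (f p.1 p.2 : ℤ) - f p.2 p.1 = g (I.code p) ∧
      f p.1 p.2 * I.w p.1 p.2 + f p.2 p.1 * I.w p.2 p.1 = N.ecost d u g (I.code p) ∧
      (u (I.code p) = true → f p.1 p.2 ≠ 0 ∨ f p.2 p.1 ≠ 0) := by
    intro p hp
    have hpE := h.mem_E.2 ⟨p, hp, rfl⟩
    have hb := hecost p hp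
    rw [hf1 p hp, hf2 p hp]
    simp only [fw, bw, hpE, true_and, Net.ecost, h.edge p hp] at hb ⊢
    by_cases hu : u (I.code p) = true
    · obtain ⟨-, -, h1, h2⟩ := hs.ends _ hpE hu
      rw [h.edge p hp] at h1 h2
      simp only [Instance.edge] at h1 h2
      simp only [hu, if_true, Edge.busy, Instance.edge] at hb ⊢
      by_cases h0 : g (I.code p) = 0
      · simp only [h0, if_true] at hb ⊢
        by_cases hcc : I.c p.1 p.2 ≠ 0 ∧ I.c p.2 p.1 ≠ 0
        · rw [if_pos hcc]
          have h3 := hcc.1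
          have h4 := hcc.2
          refine ⟨by omega, by omega, by simp, by simp, by simp⟩
        · rw [if_neg hcc] at hb; omega
      · simp only [h0, if_false]
        refine ⟨by omega, by omega, by omega, by ring, fun _ => by omega⟩
    · have h0 := hs.off _ hpE (by simpa using hu)
      simp [hu, h0, Instance.idle_edge]
  have hfc : ∀ x y, f x y ≤ I.c x y := by
    intro x y
    by_cases h0 : f x y = 0
    · simp [h0]
    · rcases hfs x y h0 with h3 | h3
      · exact (hpair _ h3.1).1
      · exact (hpair _ h3.1).2.1
  have hbal : ∀ v, ∑ w, f v w = ∑ w, f w v := by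
    intro v
    have hb := hs.bal v (by rw [h.V]; simp)
    rw [h.sum] at hb
    have key := sum_pairs I
      (fun x y => (f x y : ℤ) * ((if y = v then 1 else 0) - (if x = v then 1 else 0)))
      (fun x y h1 h2 => by simp [hfz x y h1 h2])
    simp only [sub_self, mul_zero, Finset.sum_const_zero, add_zero] at key
    rw [Finset.sum_congr rfl (g := fun p : Fin I.n × Fin I.n => (f p.1 p.2 : ℤ) *
      ((if p.2 = v then 1 else 0) - (if p.1 = v then 1 else 0)) + (f p.2 p.1 : ℤ) *
      ((if p.1 = v then 1 else 0) - (if p.2 = v then 1 else 0))), key] at hb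
    · simp_rw [mul_sub, Finset.sum_sub_distrib] at hb
      rw [Finset.sum_comm (f := fun x y => (f x y : ℤ) * (if x = v then 1 else 0))] at hb
      simp only [mul_ite, mul_one, mul_zero, Finset.sum_ite_eq', Finset.mem_univ, if_true] at hb
      exact_mod_cast (sub_eq_zero.1 hb).symm
    · intro p hp
      have hp := (Finset.mem_filter.1 hp).2
      rw [h.edge p hp, ← (hpair p hp).2.2.1]
      simp only [Edge.inflow, Instance.edge, Fin.val_inj]
      by_cases h1 : p.1 = v <;> by_cases h2 : p.2 = v <;> simp [h1, h2] <;> ring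
  obtain ⟨L, hL, hLf, hLS⟩ := exists_euler_trail hbal r {v | d v ≠ 0} (fun v => d v) (by
    intro v hv hvr
    obtain ⟨e, he, hu, hp⟩ := hs.par v (by rw [h.V]; simp) (fun hh => hvr (Fin.ext hh)) hv
    obtain ⟨p, hpp, rfl⟩ := h.mem_E.1 he
    have hends := hs.ends _ he hu
    have hpos := (hpair p hpp).2.2.2.2 hu
    rw [h.edge p hpp] at hp hends
    rcases hp with ⟨h1, h2⟩ | ⟨h1, h2⟩
    · have h1 : p.1 = v := Fin.ext h1
      subst h1
      exact ⟨p.2, hends.2.1, h2, hpos.symm.imp Nat.pos_of_ne_zero Nat.pos_of_ne_zero⟩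
    · have h1 : p.2 = v := Fin.ext h1
      subst h1
      exact ⟨p.1, hends.1, h2, hpos.imp Nat.pos_of_ne_zero Nat.pos_of_ne_zero⟩)
  have hLc : ∀ x y, L.count (x, y) ≤ I.c x y := fun x y => (hLf x y).trans (hfc x y)
  have hLadj : ∀ e ∈ L, I.G.Adj e.1 e.2 := by
    rintro ⟨x, y⟩ he
    by_contra hcon
    have h1 := hLc x y
    rw [Instance.c, if_neg hcon] at h1
    exact absurd (List.count_pos_iff.2 he) (Nat.not_lt.2 h1)
  obtain ⟨ha, hlast⟩ := hL.arcs_eq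
  refine ⟨r :: L.map Prod.snd, ⟨by simp, by rw [ha]; exact hLadj, ?_⟩, ?_, ?_, ?_⟩
  · rw [List.head?_cons, List.getLast?_eq_some_getLast (by simp), hlast]
  · rw [ha, List.map_congr_left (g := fun e => I.w e.1 e.2)
      (fun e he => by simp [Instance.w, hLadj e he]), sum_list_map_count _ I.w]
    have key := sum_pairs I (fun x y => f x y * I.w x y)
      (fun x y h1 h2 => by simp [hfz x y h1 h2])
    simp only [hfu, zero_mul, Finset.sum_const_zero, add_zero] at key
    calc ∑ x, ∑ y, L.count (x, y) * I.w x y ≤ ∑ x, ∑ y, f x y * I.w x y :=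
          Finset.sum_le_sum fun x _ => Finset.sum_le_sum fun y _ =>
            Nat.mul_le_mul_right _ (hLf x y)
      _ = ∑ e ∈ N.E, N.ecost d u g e := by
          rw [← key, h.sum]
          exact Finset.sum_congr rfl fun p hp => (hpair p (Finset.mem_filter.1 hp).2).2.2.2.1
      _ ≤ I.budget := by omega
  · intro v hv
    refine hLS v fun h0 => ?_
    have := Finset.single_le_sum (f := N.vcost d) (fun _ _ => Nat.zero_le _)
      (show (v : ℕ) ∈ N.V by rw [h.V]; simp)
    rw [Net.vcost, if_pos h0, h.c0, if_pos hv] at this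
    omega
  · intro x y hxy
    rw [ha]
    have := hLc x y
    rwa [Instance.c, if_pos hxy] at this

/-- A forest on `n` vertices has less than `n` edges. -/
theorem card_edgeFinset_lt_of_isAcyclic {V : Type*} [Fintype V] [Nonempty V] {H : SimpleGraph V}
    [Fintype H.edgeSet] (hH : H.IsAcyclic) : H.edgeFinset.card + 1 ≤ Fintype.card V := by
  classical
  obtain ⟨T, hT, -, hT'⟩ := SimpleGraph.connected_top.exists_isTree_le_of_le_of_isAcyclic
    (le_top : H ≤ ⊤) hH
  rw [← hT'.card_edgeFinset]
  exact Nat.add_le_add_right (Finset.card_le_card (SimpleGraph.edgeFinset_mono hT)) 1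

/-- The number of edges beyond those of a spanning tree is at most the feedback edge number.
Connectedness is not needed for this inequality. -/
theorem card_edges_le_feedbackEdgeNumber {V : Type*} [Fintype V] [Nonempty V] (H : SimpleGraph V)
    [Fintype H.edgeSet] : H.edgeFinset.card + 1 ≤ Fintype.card V + feedbackEdgeNumber H := by
  classical
  obtain ⟨F, hF, hc, ha⟩ := Nat.sInf_mem (s := {m | ∃ F : Finset (Sym2 V),
    (F : Set (Sym2 V)) ⊆ H.edgeSet ∧ F.card = m ∧ (H.deleteEdges (F : Set (Sym2 V))).IsAcyclic})
    ⟨H.edgeFinset.card, H.edgeFinset, by simp, rfl, by simp⟩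
  rw [← feedbackEdgeNumber] at hc
  have h1 := card_edgeFinset_lt_of_isAcyclic ha
  have h2 : (H.deleteEdges (F : Set (Sym2 V))).edgeFinset = H.edgeFinset \ F := by
    ext e; simp
  rw [h2] at h1
  have h3 := Finset.le_card_sdiff F H.edgeFinset
  omega

/-- The network of a strongly connected instance is connected, and its cyclomatic number is at most
the feedback edge number. -/
theorem IsNetOf.inv {N : Net} {I : Instance} (h : IsNetOf N I) (hG : StronglyConnected I.G)
    (r : Fin I.n) : N.Inv r I.fen := by
  classical
  have : Nonempty (Fin I.n) := ⟨r⟩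
  refine ⟨by rw [h.V]; simp, fun e he => ?_, fun X hX hr hne => ?_, ?_⟩
  · obtain ⟨p, hp, rfl⟩ := h.mem_E.1 he
    rw [h.edge p hp, h.V]
    simp [Instance.edge]
  · obtain ⟨v, hv, hvX⟩ : ∃ v ∈ N.V, v ∉ X := by
      by_contra hcon
      push Not at hcon
      exact hne (hX.antisymm hcon)
    rw [h.V, Finset.mem_range] at hv
    lift v to Fin I.n using hv
    obtain ⟨p, q, hpq, hp, hq⟩ : ∃ p q : Fin I.n, I.G.Adj p q ∧ (p : ℕ) ∈ X ∧ (q : ℕ) ∉ X := by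
      have := hG r v
      induction this with
      | refl => exact absurd hr hvX
      | @tail b c _ hbc ih =>
        by_cases hb : (b : ℕ) ∈ X
        · exact ⟨b, c, hbc, hb, hvX⟩
        · exact ih hb
    have hne : p ≠ q := by rintro rfl; exact hq hp
    rcases lt_or_gt_of_ne hne with hlt | hlt
    · have hpair : I.IsPair (p, q) := ⟨hlt, Or.inl hpq⟩
      refine ⟨_, h.mem_E.2 ⟨_, hpair, rfl⟩, Or.inl ?_⟩
      rw [h.edge _ hpair]
      exact ⟨hp, hq⟩
    · have hpair : I.IsPair (q, p) := ⟨hlt, Or.inr hpq⟩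
      refine ⟨_, h.mem_E.2 ⟨_, hpair, rfl⟩, Or.inr ?_⟩
      rw [h.edge _ hpair]
      exact ⟨hp, hq⟩
  · have h1 := card_edges_le_feedbackEdgeNumber I.G.toSimpleGraphInclusive
    rw [h.E, Finset.card_image_of_injective _ I.code_injective, h.V, Finset.card_range]
    rw [Fintype.card_fin] at h1
    refine le_trans (Nat.add_le_add_right ?_ 1) h1
    refine Finset.card_le_card_of_injOn (fun p => s(p.1, p.2)) (fun p hp => ?_) ?_
    · have hp := (Finset.mem_filter.1 hp).2
      rw [SimpleGraph.coe_edgeFinset, SimpleGraph.mem_edgeSet,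
        Digraph.toSimpleGraphInclusive, SimpleGraph.fromRel_adj]
      exact ⟨hp.1.ne, hp.2⟩
    · rintro ⟨a, b⟩ hp ⟨c, d⟩ hq heq
      have hp := (Finset.mem_filter.1 hp).2.1
      have hq := (Finset.mem_filter.1 hq).2.1
      simp only [Sym2.eq_iff] at heq
      rcases heq with ⟨rfl, rfl⟩ | ⟨rfl, rfl⟩
      · rfl
      · exact absurd hp hq.not_gt

/-! ### Counting in a numeral system on a set of positions -/

section Numeral

variable (D : ℕ) (P : ℕ → Prop) [DecidablePred P]

/-- The value of the digits at the positions in `P` below `i`, in base `D`. -/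
def numeral (t : ℕ → ℕ) : ℕ → ℕ
  | 0 => 0
  | i + 1 => numeral t i + if P i then t i * D ^ Nat.count P i else 0

variable {D P} {t t' : ℕ → ℕ}

theorem numeral_lt (ht : ∀ p, t p < D) (i : ℕ) : numeral D P t i < D ^ Nat.count P i := by
  induction i with
  | zero => simp [numeral]
  | succ i ih =>
    rw [numeral, Nat.count_succ]
    split_ifs with h
    · calc _ < D ^ Nat.count P i + t i * D ^ Nat.count P i := by omega
        _ = (t i + 1) * D ^ Nat.count P i := by ring
        _ ≤ D * D ^ Nat.count P i := Nat.mul_le_mul_right _ (ht i)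
        _ = _ := by ring
    · simpa using ih

/-- The value determines the digits. -/
theorem numeral_inj (ht : ∀ p, t p < D) (ht' : ∀ p, t' p < D) {i : ℕ}
    (h : numeral D P t i = numeral D P t' i) : ∀ p < i, P p → t p = t' p := by
  induction i with
  | zero => simp
  | succ i ih =>
    have h1 := numeral_lt (P := P) ht i
    have h2 := numeral_lt (P := P) ht' i
    rw [numeral, numeral] at h
    intro p hp hP
    by_cases hPi : P i
    · rw [if_pos hPi, if_pos hPi] at h
      have hpos : 0 < D ^ Nat.count P i := by omega
      have h3 : t i = t' i := by
        have := congrArg (· / D ^ Nat.count P i) h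
        simpa only [Nat.add_mul_div_right _ _ hpos, Nat.div_eq_of_lt h1, Nat.div_eq_of_lt h2,
          zero_add] using this
      rw [h3] at h
      rcases Nat.lt_succ_iff_lt_or_eq.1 hp with hlt | rfl
      · exact ih (by omega) p hlt hP
      · exact h3
    · rw [if_neg hPi, if_neg hPi] at h
      have : p ≠ i := by rintro rfl; exact hPi hP
      exact ih (by simpa using h) p (by omega) hP

theorem numeral_congr {i : ℕ} (h : ∀ p < i, t p = t' p) :
    numeral D P t i = numeral D P t' i := by
  induction i with
  | zero => rfl
  | succ i ih => rw [numeral, numeral, ih fun p hp => h p (by omega), h i (by omega)]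

theorem numeral_zero (i : ℕ) : numeral D P (fun _ => 0) i = 0 := by
  induction i with
  | zero => rfl
  | succ i ih => simp [numeral, ih]

end Numeral

/-! ### A program logic with step counts -/

/-- The registers that occur as targets of assignments. -/
def Prog.writesReg : Prog → ℕ → Bool
  | .skip, _ => false
  | .setReg x _, y => x == y
  | .setArr _ _ _, _ => false
  | .seq p q, y => p.writesReg y || q.writesReg y
  | .ite _ p q, y => p.writesReg y || q.writesReg y
  | .loop _ p, y => p.writesReg y

/-- The arrays that occur as targets of assignments. -/
def Prog.writesArr : Prog → ℕ → Bool
  | .skip, _ => false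
  | .setReg _ _, _ => false
  | .setArr a _ _, b => a == b
  | .seq p q, b => p.writesArr b || q.writesArr b
  | .ite _ p q, b => p.writesArr b || q.writesArr b
  | .loop _ p, b => p.writesArr b

/-- The stores `s` and `s'` agree on everything that `p` has no assignment to. -/
structure Frame (p : Prog) (s s' : Store) : Prop where
  reg : ∀ x, p.writesReg x = false → s'.reg x = s.reg x
  arr : ∀ a, p.writesArr a = false → s'.arr a = s.arr a

theorem Run.frame {p : Prog} {s s' : Store} {t : ℕ} (h : Run p s t s') : Frame p s s' := by
  induction h with
  | skip s => exact ⟨fun _ _ => rfl, fun _ _ => rfl⟩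
  | setReg x e s =>
    refine ⟨fun y hy => ?_, fun _ _ => rfl⟩
    have : y ≠ x := by rintro rfl; simp [Prog.writesReg] at hy
    simp [Store.setReg, this]
  | setArr a i e s =>
    refine ⟨fun _ _ => rfl, fun b hb => ?_⟩
    have : b ≠ a := by rintro rfl; simp [Prog.writesArr] at hb
    simp [Store.setArr, this]
  | seq _ _ ih₁ ih₂ =>
    constructor <;> intro y hy <;>
      simp only [Prog.writesReg, Prog.writesArr, Bool.or_eq_false_iff] at hy
    · rw [ih₂.reg y hy.2, ih₁.reg y hy.1]
    · rw [ih₂.arr y hy.2, ih₁.arr y hy.1]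
  | iteTrue _ _ ih =>
    constructor <;> intro y hy <;>
      simp only [Prog.writesReg, Prog.writesArr, Bool.or_eq_false_iff] at hy
    · exact ih.reg y hy.1
    · exact ih.arr y hy.1
  | iteFalse _ _ ih =>
    constructor <;> intro y hy <;>
      simp only [Prog.writesReg, Prog.writesArr, Bool.or_eq_false_iff] at hy
    · exact ih.reg y hy.2
    · exact ih.arr y hy.2
  | loopDone _ => exact ⟨fun _ _ => rfl, fun _ _ => rfl⟩
  | loopStep _ _ _ ih₁ ih₂ =>
    constructor <;> intro y hy
    · rw [ih₂.reg y hy, ih₁.reg y hy]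
    · rw [ih₂.arr y hy, ih₁.arr y hy]

/-- Total correctness with a step bound: started on `s`, the program `p` halts after at most `T`
steps with a memory that satisfies `Q`. -/
def Ok (p : Prog) (s : Store) (T : ℕ) (Q : Store → Prop) : Prop :=
  ∃ t s', Run p s t s' ∧ t ≤ T ∧ Q s'

theorem Ok.mono {p : Prog} {s : Store} {T T' : ℕ} {Q Q' : Store → Prop} (h : Ok p s T Q)
    (hT : T ≤ T') (hQ : ∀ s', Frame p s s' → Q s' → Q' s') : Ok p s T' Q' := by
  obtain ⟨t, s', hr, ht, hq⟩ := h
  exact ⟨t, s', hr, ht.trans hT, hQ s' hr.frame hq⟩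

theorem Ok.le {p : Prog} {s : Store} {T T' : ℕ} {Q : Store → Prop} (h : Ok p s T Q)
    (hT : T ≤ T') : Ok p s T' Q :=
  h.mono hT fun _ _ h => h

theorem Ok.skip {s : Store} {Q : Store → Prop} (h : Q s) : Ok .skip s 1 Q :=
  ⟨_, _, .skip s, le_rfl, h⟩

theorem Ok.setReg {s : Store} {Q : Store → Prop} {x : ℕ} {e : Expr}
    (h : Q (s.setReg x (e.eval s))) : Ok (.setReg x e) s (e.cost + 1) Q :=
  ⟨_, _, .setReg x e s, le_rfl, h⟩

theorem Ok.setArr {s : Store} {Q : Store → Prop} {a : ℕ} {i e : Expr}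
    (h : Q (s.setArr a (i.eval s) (e.eval s))) :
    Ok (.setArr a i e) s (i.cost + e.cost + 1) Q :=
  ⟨_, _, .setArr a i e s, le_rfl, h⟩

theorem Ok.seq {p q : Prog} {s : Store} {T₁ T₂ : ℕ} {R Q : Store → Prop}
    (hp : Ok p s T₁ R) (hq : ∀ s', Frame p s s' → R s' → Ok q s' T₂ Q) :
    Ok (.seq p q) s (T₁ + T₂) Q := by
  obtain ⟨t, s', hr, ht, hR⟩ := hp
  obtain ⟨t', s'', hr', ht', hQ⟩ := hq s' hr.frame hR
  exact ⟨_, _, .seq hr hr', by omega, hQ⟩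

theorem Ok.ite {e : Expr} {p q : Prog} {s : Store} {T₁ T₂ : ℕ} {Q : Store → Prop}
    (hp : e.eval s ≠ 0 → Ok p s T₁ Q) (hq : e.eval s = 0 → Ok q s T₂ Q) :
    Ok (.ite e p q) s (e.cost + 1 + (T₁ + T₂)) Q := by
  by_cases h : e.eval s = 0
  · obtain ⟨t, s', hr, ht, hQ⟩ := hq h
    exact ⟨_, _, .iteFalse h hr, by omega, hQ⟩
  · obtain ⟨t, s', hr, ht, hQ⟩ := hp h
    exact ⟨_, _, .iteTrue h hr, by omega, hQ⟩

theorem Ok.setReg_seq {s : Store} {Q : Store → Prop} {x T : ℕ} {e : Expr} {q : Prog}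
    (h : Ok q (s.setReg x (e.eval s)) T Q) : Ok (.seq (.setReg x e) q) s (e.cost + 1 + T) Q :=
  Ok.seq (R := fun s' => s' = s.setReg x (e.eval s)) (.setReg rfl) (by rintro _ - rfl; exact h)

theorem Ok.setArr_seq {s : Store} {Q : Store → Prop} {a T : ℕ} {i e : Expr} {q : Prog}
    (h : Ok q (s.setArr a (i.eval s) (e.eval s)) T Q) :
    Ok (.seq (.setArr a i e) q) s (i.cost + e.cost + 1 + T) Q :=
  Ok.seq (R := fun s' => s' = s.setArr a (i.eval s) (e.eval s)) (.setArr rfl)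
    (by rintro _ - rfl; exact h)

/-- A loop each of whose rounds preserves `Inv` and decreases the natural number `μ`. -/
theorem Ok.loop {e : Expr} {p : Prog} {T : ℕ} (Inv : Store → Prop) (μ : Store → ℕ)
    (step : ∀ s, Inv s → e.eval s ≠ 0 → Ok p s T fun s' => Inv s' ∧ μ s' < μ s)
    {s : Store} (h : Inv s) :
    Ok (.loop e p) s (μ s * (T + e.cost + 1) + (e.cost + 1)) fun s' => Inv s' ∧ e.eval s' = 0 := by
  induction hm : μ s using Nat.strong_induction_on generalizing s with
  | _ m ih =>
    by_cases he : e.eval s = 0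
    · exact ⟨_, _, .loopDone he, Nat.le_add_left _ _, h, he⟩
    · obtain ⟨t, s', hr, ht, hI, hμ⟩ := step s h he
      obtain ⟨t', s'', hr', ht', hQ⟩ := ih (μ s') (hm ▸ hμ) hI rfl
      refine ⟨_, _, .loopStep he hr hr', ?_, hQ⟩
      have : (μ s' + 1) * (T + e.cost + 1) ≤ m * (T + e.cost + 1) :=
        Nat.mul_le_mul_right _ (by omega)
      rw [Nat.add_mul] at this
      omega

/-- `for x = lo, …, hi - 1 do p`, where register `y` holds `hi`. -/
def Prog.forLoop (x : ℕ) (lo : Expr) (y : ℕ) (p : Prog) : Prog :=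
  .seq (.setReg x lo) (.loop (.sub (.reg y) (.reg x))
    (.seq p (.setReg x (.add (.reg x) (.lit 1)))))

theorem Ok.forLoop {x y : ℕ} {lo : Expr} {p : Prog} {T a b : ℕ} {s : Store}
    (Inv : ℕ → Store → Prop) (hxy : y ≠ x) (hx : p.writesReg x = false)
    (hy : p.writesReg y = false) (ha : lo.eval s = a) (hb : s.reg y = b) (hab : a ≤ b)
    (h₀ : Inv a (s.setReg x a))
    (step : ∀ i s', a ≤ i → i < b → Inv i s' → s'.reg x = i → Frame (.forLoop x lo y p) s s' →
      Ok p s' T fun s'' => Inv (i + 1) (s''.setReg x (i + 1))) :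
    Ok (.forLoop x lo y p) s (lo.cost + 5 + (b - a) * (T + 8)) fun s' =>
      Inv b s' ∧ s'.reg x = b := by
  have main := Ok.loop (e := .sub (.reg y) (.reg x))
    (p := .seq p (.setReg x (.add (.reg x) (.lit 1)))) (T := T + 4)
    (fun s' => a ≤ s'.reg x ∧ s'.reg x ≤ b ∧ Inv (s'.reg x) s' ∧
      Frame (.forLoop x lo y p) s s') (fun s' => b - s'.reg x) (s := s.setReg x a) ?_ ?_
  · refine (Ok.seq (R := fun s' => s' = s.setReg x a) (.setReg (by rw [ha]))
      (T₂ := (b - a) * (T + 8) + 4) ?_).le (by omega)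
    rintro s' - rfl
    refine main.mono (by simp [Store.setReg, Expr.cost]) ?_
    rintro s' - ⟨⟨h1, h2, h3, h4⟩, h5⟩
    have hyy : s'.reg y = b := by
      rw [h4.reg y (by simp [Prog.forLoop, Prog.writesReg, hy, hxy.symm]), hb]
    simp only [Expr.eval, hyy] at h5
    have : s'.reg x = b := by omega
    exact ⟨this ▸ h3, this⟩
  · rintro s' ⟨h1, h2, h3, h4⟩ he
    have hyy : s'.reg y = b := by
      rw [h4.reg y (by simp [Prog.forLoop, Prog.writesReg, hy, hxy.symm]), hb]
    simp only [Expr.eval, hyy] at he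
    refine Ok.seq (step (s'.reg x) s' h1 (by omega) h3 rfl h4) (T₂ := 4) ?_
    intro s'' hf hI
    refine Ok.setReg ?_
    have e1 : s''.reg x = s'.reg x := hf.reg x hx
    simp only [Expr.eval, e1]
    have e2 : (s''.setReg x (s'.reg x + 1)).reg x = s'.reg x + 1 := by simp [Store.setReg]
    rw [e2]
    refine ⟨⟨by omega, by omega, hI, ?_, ?_⟩, by omega⟩
    · intro z hz
      have hz' := hz
      simp only [Prog.forLoop, Prog.writesReg, Bool.or_eq_false_iff, beq_eq_false_iff_ne] at hz'
      have : z ≠ x := fun h => hz'.1 h.symm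
      rw [← h4.reg z hz, ← hf.reg z hz'.2.1]
      simp [Store.setReg, this]
    · intro z hz
      have hz' := hz
      simp only [Prog.forLoop, Prog.writesArr, Bool.or_eq_false_iff] at hz'
      rw [← h4.arr z hz, ← hf.arr z hz'.2.1]
      rfl
  · have e2 : (s.setReg x a).reg x = a := by simp [Store.setReg]
    rw [e2]
    refine ⟨le_rfl, hab, h₀, ?_, fun _ _ => rfl⟩
    intro z hz
    simp only [Prog.forLoop, Prog.writesReg, Bool.or_eq_false_iff, beq_eq_false_iff_ne] at hz
    have : z ≠ x := fun h => hz.1 h.symm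
    simp [Store.setReg, this]

/-! ### The memory layout -/

-- `⊹` and `∸` are the sum and the truncated difference of expressions, and `;;` is sequential
-- composition. Names that begin with `r` stand for registers and names that begin with `a` for
-- arrays. The registers `rNum`, `rBud` and the arrays `aWay`, `aAdj`, `aWt`, `aCap` hold the input.
local infixl:65 " ⊹ " => Expr.add
local infixl:65 " ∸ " => Expr.sub
local infixr:40 " ;; " => Prog.seq

local notation "rNum" => (0 : ℕ)
local notation "rBud" => (1 : ℕ)
local notation "rVtx" => (2 : ℕ)
local notation "rTot" => (3 : ℕ)
local notation "rRoot" => (4 : ℕ)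
local notation "rI" => (5 : ℕ)
local notation "rJ" => (6 : ℕ)
local notation "rDeg" => (7 : ℕ)
local notation "rFst" => (8 : ℕ)
local notation "rSnd" => (9 : ℕ)
local notation "rEdge" => (10 : ℕ)
local notation "rTmp" => (11 : ℕ)
local notation "rMid" => (12 : ℕ)
local notation "rBase" => (13 : ℕ)
local notation "rBad" => (14 : ℕ)
local notation "rCost" => (15 : ℕ)
local notation "rIn" => (16 : ℕ)
local notation "rOut" => (17 : ℕ)
local notation "rPar" => (18 : ℕ)
local notation "rK" => (19 : ℕ)
local notation "rLim" => (20 : ℕ)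
local notation "rAns" => (21 : ℕ)
local notation "rRun" => (22 : ℕ)
local notation "rCarry" => (23 : ℕ)

local notation "aWay" => (0 : ℕ)
local notation "aAdj" => (1 : ℕ)
local notation "aWt" => (2 : ℕ)
local notation "aCap" => (3 : ℕ)
local notation "aOff" => (4 : ℕ)
local notation "aLive" => (5 : ℕ)
local notation "aA" => (6 : ℕ)
local notation "aB" => (7 : ℕ)
local notation "aWf" => (8 : ℕ)
local notation "aWb" => (9 : ℕ)
local notation "aCf" => (10 : ℕ)
local notation "aCb" => (11 : ℕ)
local notation "aW0" => (12 : ℕ)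
local notation "aGa" => (13 : ℕ)
local notation "aN00" => (14 : ℕ)
local notation "aN01" => (15 : ℕ)
local notation "aN10" => (16 : ℕ)
local notation "aN11" => (17 : ℕ)
local notation "aC0" => (18 : ℕ)
local notation "aC1" => (19 : ℕ)
local notation "aDig" => (20 : ℕ)

/-- The network in the memory. Register `rNum` holds the number `n` of vertices of the instance;
the names of vertices are below `n`, those of edges are between `n` and the content of `rTot`, and
`aLive` tells which names are in use. -/
def netOf (s : Store) : Net where
  V := (Finset.range (s.reg rNum)).filter fun v => s.arr aLive v ≠ 0
  E := (Finset.Ico (s.reg rNum) (s.reg rTot)).filter fun e => s.arr aLive e ≠ 0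
  edge e := ⟨s.arr aA e, s.arr aB e, s.arr aWf e, s.arr aWb e, s.arr aCf e, s.arr aCb e,
    s.arr aW0 e, s.arr aGa e, s.arr aN00 e, s.arr aN01 e, s.arr aN10 e, s.arr aN11 e⟩
  c0 := s.arr aC0
  c1 := s.arr aC1

/-- The program `p` does not touch the network in the memory. -/
def Prog.KeepsNet (p : Prog) : Prop :=
  p.writesReg rNum = false ∧ p.writesReg rTot = false ∧
    ∀ a ∈ Finset.Icc aLive aC1, p.writesArr a = false

instance (p : Prog) : Decidable p.KeepsNet := by unfold Prog.KeepsNet; infer_instance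

theorem Frame.netOf_eq {p : Prog} {s s' : Store} (h : Frame p s s') (hp : p.KeepsNet) :
    netOf s' = netOf s := by
  obtain ⟨h1, h2, h3⟩ := hp
  have h4 : ∀ a, 5 ≤ a → a ≤ 19 → s'.arr a = s.arr a := fun a ha hb =>
    h.arr a (h3 a (Finset.mem_Icc.2 ⟨ha, hb⟩))
  unfold netOf
  rw [h.reg _ h1, h.reg _ h2]
  simp only [h4 _ (by norm_num : 5 ≤ 5) (by norm_num), h4 6 (by norm_num) (by norm_num),
    h4 7 (by norm_num) (by norm_num), h4 8 (by norm_num) (by norm_num),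
    h4 9 (by norm_num) (by norm_num), h4 10 (by norm_num) (by norm_num),
    h4 11 (by norm_num) (by norm_num), h4 12 (by norm_num) (by norm_num),
    h4 13 (by norm_num) (by norm_num), h4 14 (by norm_num) (by norm_num),
    h4 15 (by norm_num) (by norm_num), h4 16 (by norm_num) (by norm_num),
    h4 17 (by norm_num) (by norm_num), h4 18 (by norm_num) (by norm_num),
    h4 19 (by norm_num) (by norm_num)]

theorem mem_netOf_V {s : Store} {v : ℕ} :
    v ∈ (netOf s).V ↔ v < s.reg rNum ∧ s.arr aLive v ≠ 0 := by
  simp [netOf]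

theorem mem_netOf_E {s : Store} {e : ℕ} :
    e ∈ (netOf s).E ↔ (s.reg rNum ≤ e ∧ e < s.reg rTot) ∧ s.arr aLive e ≠ 0 := by
  simp [netOf]

/-- The smaller of two numbers. -/
def Expr.min (e₁ e₂ : Expr) : Expr := e₁ ∸ (e₁ ∸ e₂)

theorem Expr.eval_min (s : Store) (e₁ e₂ : Expr) :
    (Expr.min e₁ e₂).eval s = Min.min (e₁.eval s) (e₂.eval s) := by
  simp only [Expr.min, Expr.eval]
  omega

/-- Nonzero if the values are different. -/
def Expr.ne (e₁ e₂ : Expr) : Expr := (e₁ ∸ e₂) ⊹ (e₂ ∸ e₁)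

theorem Expr.eval_ne_eq_zero {s : Store} {e₁ e₂ : Expr} :
    (Expr.ne e₁ e₂).eval s = 0 ↔ e₁.eval s = e₂.eval s := by
  simp only [Expr.ne, Expr.eval]
  omega

open DWRP.Expr DWRP.Prog

/-! ### Programs that flip, prune and merge edges -/

/-- Reverse the orientation of the edge whose name is in register `x`. -/
def flipProg (x : ℕ) : Prog :=
  setReg rTmp (get aA (reg x)) ;; setArr aA (reg x) (get aB (reg x)) ;;
  setArr aB (reg x) (reg rTmp) ;;
  setReg rTmp (get aWf (reg x)) ;; setArr aWf (reg x) (get aWb (reg x)) ;;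
  setArr aWb (reg x) (reg rTmp) ;;
  setReg rTmp (get aCf (reg x)) ;; setArr aCf (reg x) (get aCb (reg x)) ;;
  setArr aCb (reg x) (reg rTmp) ;;
  setReg rTmp (get aN01 (reg x)) ;; setArr aN01 (reg x) (get aN10 (reg x)) ;;
  setArr aN10 (reg x) (reg rTmp)

theorem flipProg_ok (s : Store) {x : ℕ} (hx : x ≠ rTmp) :
    Ok (flipProg x) s 43 fun s' => netOf s' = (netOf s).flip (s.reg x) := by
  refine (Ok.setReg_seq <| Ok.setArr_seq <| Ok.setArr_seq <| Ok.setReg_seq <| Ok.setArr_seq <|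
    Ok.setArr_seq <| Ok.setReg_seq <| Ok.setArr_seq <| Ok.setArr_seq <| Ok.setReg_seq <|
    Ok.setArr_seq <| Ok.setArr ?_).le (by simp [Expr.cost])
  simp only [netOf, Net.flip, Store.setReg, Store.setArr, Expr.eval]
  ext1 <;> simp [hx]
  funext e'
  by_cases he : e' = s.reg x
  · subst he; simp [Edge.flip]
  · simp [he]

/-- Eliminate the vertex in `rVtx`, whose only edge is the one in `rFst`, with head `rVtx`. -/
def pruneProg : Prog :=
  setReg rTmp (get aA (reg rFst)) ;;
  setArr aC0 (reg rTmp)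
    (get aC0 (reg rTmp) ⊹ (get aN00 (reg rFst) ⊹ get aC0 (reg rVtx))) ;;
  setArr aC1 (reg rTmp) (get aC1 (reg rTmp) ⊹
    Expr.min (get aN10 (reg rFst) ⊹ get aC0 (reg rVtx))
      (get aW0 (reg rFst) ⊹ get aC1 (reg rVtx))) ;;
  setArr aLive (reg rVtx) (lit 0) ;;
  setArr aLive (reg rFst) (lit 0)

theorem pruneProg_ok {s : Store} (hE : s.reg rFst ∈ (netOf s).E) (hV : s.reg rVtx ∈ (netOf s).V)
    (hb : ((netOf s).edge (s.reg rFst)).b = s.reg rVtx)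
    (ha : ((netOf s).edge (s.reg rFst)).a ≠ s.reg rVtx) :
    Ok pruneProg s 100 fun s' => netOf s' = (netOf s).prune (s.reg rFst) := by
  refine (Ok.setReg_seq <| Ok.setArr_seq <| Ok.setArr_seq <| Ok.setArr_seq <|
    Ok.setArr ?_).le (by simp [Expr.cost, Expr.min])
  simp only [netOf] at hb ha
  rw [mem_netOf_E] at hE
  rw [mem_netOf_V] at hV
  have h1 : s.reg rFst ≠ s.reg rVtx := by omega
  simp only [netOf, Net.prune, Store.setReg, Store.setArr, Expr.eval, Expr.eval_min]
  ext1
  · ext v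
    by_cases hv : v = s.reg rVtx
    · subst hv; simp [hb, h1.symm]
    · by_cases hv' : v = s.reg rFst
      · simp [hv']; omega
      · simp [hv, hv', hb]
  · ext e
    by_cases hv : e = s.reg rFst
    · subst hv; simp
    · by_cases hv' : e = s.reg rVtx
      · simp [hv', h1.symm]; omega
      · simp [hv, hv']
  · simp
  · simp [hb, ha.symm]
  · simp [hb, ha.symm]

/-- Update the idle prices of the edge in `rFst` when it is merged with the edge in `rSnd`. The
assignments are ordered so that each reads the old data. -/
def mergeIdleProg : Prog :=
  setArr aN11 (reg rFst) (Expr.min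
    (Expr.min (get aN10 (reg rFst) ⊹ get aN01 (reg rSnd) ⊹ get aC0 (reg rVtx))
      (get aW0 (reg rFst) ⊹ get aN11 (reg rSnd) ⊹ get aC1 (reg rVtx)))
    (get aN11 (reg rFst) ⊹ get aW0 (reg rSnd) ⊹ get aC1 (reg rVtx))) ;;
  setArr aN10 (reg rFst) (Expr.min
    (get aN10 (reg rFst) ⊹ get aN00 (reg rSnd) ⊹ get aC0 (reg rVtx))
    (get aW0 (reg rFst) ⊹ get aN10 (reg rSnd) ⊹ get aC1 (reg rVtx))) ;;
  setArr aN01 (reg rFst) (Expr.min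
    (get aN00 (reg rFst) ⊹ get aN01 (reg rSnd) ⊹ get aC0 (reg rVtx))
    (get aN01 (reg rFst) ⊹ get aW0 (reg rSnd) ⊹ get aC1 (reg rVtx))) ;;
  setArr aN00 (reg rFst) (get aN00 (reg rFst) ⊹ get aN00 (reg rSnd) ⊹ get aC0 (reg rVtx))

/-- Update the other data of the edge in `rFst` when it is merged with the edge in `rSnd`. -/
def mergeBusyProg : Prog :=
  setArr aW0 (reg rFst) (get aW0 (reg rFst) ⊹ get aW0 (reg rSnd) ⊹ get aC1 (reg rVtx)) ;;
  setArr aGa (reg rFst) (get aGa (reg rFst) ⊹ get aGa (reg rSnd) ⊹ get aC1 (reg rVtx)) ;;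
  setArr aWf (reg rFst) (get aWf (reg rFst) ⊹ get aWf (reg rSnd)) ;;
  setArr aWb (reg rFst) (get aWb (reg rFst) ⊹ get aWb (reg rSnd)) ;;
  setArr aCf (reg rFst) (Expr.min (get aCf (reg rFst)) (get aCf (reg rSnd))) ;;
  setArr aCb (reg rFst) (Expr.min (get aCb (reg rFst)) (get aCb (reg rSnd))) ;;
  setArr aB (reg rFst) (get aB (reg rSnd))

/-- Eliminate the vertex in `rVtx`, which is the head of the edge in `rFst` and the tail of the
edge in `rSnd`. -/
def mergeProg : Prog :=
  mergeIdleProg ;; mergeBusyProg ;; setArr aLive (reg rVtx) (lit 0) ;;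
    setArr aLive (reg rSnd) (lit 0)

theorem mergeIdleProg_ok {s : Store} :
    Ok mergeIdleProg s 200 fun s' => ∀ x y k₀ k₁, x = (netOf s).edge (s.reg rFst) →
      y = (netOf s).edge (s.reg rSnd) → k₀ = s.arr aC0 (s.reg rVtx) → k₁ = s.arr aC1 (s.reg rVtx) →
      s'.arr aN00 = Function.update (s.arr aN00) (s.reg rFst) (x.comp y k₀ k₁).n00 ∧
      s'.arr aN01 = Function.update (s.arr aN01) (s.reg rFst) (x.comp y k₀ k₁).n01 ∧
      s'.arr aN10 = Function.update (s.arr aN10) (s.reg rFst) (x.comp y k₀ k₁).n10 ∧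
      s'.arr aN11 = Function.update (s.arr aN11) (s.reg rFst) (x.comp y k₀ k₁).n11 := by
  refine (Ok.setArr_seq <| Ok.setArr_seq <| Ok.setArr_seq <| Ok.setArr ?_).le
    (by simp [Expr.cost, Expr.min])
  rintro x y k₀ k₁ rfl rfl rfl rfl
  simp [Store.setArr, Expr.eval, Expr.eval_min, netOf, Edge.comp]

theorem mergeBusyProg_ok {s : Store} :
    Ok mergeBusyProg s 200 fun s' => ∀ x y k₀ k₁, x = (netOf s).edge (s.reg rFst) →
      y = (netOf s).edge (s.reg rSnd) → k₁ = s.arr aC1 (s.reg rVtx) →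
      s'.arr aW0 = Function.update (s.arr aW0) (s.reg rFst) (x.comp y k₀ k₁).w0 ∧
      s'.arr aGa = Function.update (s.arr aGa) (s.reg rFst) (x.comp y k₀ k₁).ga ∧
      s'.arr aWf = Function.update (s.arr aWf) (s.reg rFst) (x.comp y k₀ k₁).wf ∧
      s'.arr aWb = Function.update (s.arr aWb) (s.reg rFst) (x.comp y k₀ k₁).wb ∧
      s'.arr aCf = Function.update (s.arr aCf) (s.reg rFst) (x.comp y k₀ k₁).cf ∧
      s'.arr aCb = Function.update (s.arr aCb) (s.reg rFst) (x.comp y k₀ k₁).cb ∧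
      s'.arr aB = Function.update (s.arr aB) (s.reg rFst) (x.comp y k₀ k₁).b := by
  refine (Ok.setArr_seq <| Ok.setArr_seq <| Ok.setArr_seq <| Ok.setArr_seq <| Ok.setArr_seq <|
    Ok.setArr_seq <| Ok.setArr ?_).le (by simp [Expr.cost, Expr.min])
  rintro x y k₀ k₁ rfl rfl rfl
  simp [Store.setArr, Expr.eval, Expr.eval_min, netOf, Edge.comp]

theorem mergeProg_ok {s : Store} (hE : s.reg rSnd ∈ (netOf s).E) (hV : s.reg rVtx ∈ (netOf s).V)
    (hb : ((netOf s).edge (s.reg rFst)).b = s.reg rVtx) :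
    Ok mergeProg s 500 fun s' => netOf s' = (netOf s).merge (s.reg rFst) (s.reg rSnd) := by
  refine (Ok.seq mergeIdleProg_ok fun s₁ f₁ h₁ => Ok.seq mergeBusyProg_ok fun s₂ f₂ h₂ =>
    Ok.setArr_seq (Ok.setArr ?_)).le (by simp [Expr.cost])
  set x := (netOf s).edge (s.reg rFst) with hx
  set y := (netOf s).edge (s.reg rSnd) with hy
  set k₀ := s.arr aC0 (s.reg rVtx) with hk₀
  set k₁ := s.arr aC1 (s.reg rVtx) with hk₁
  obtain ⟨a1, a2, a3, a4⟩ := h₁ x y k₀ k₁ rfl rfl rfl rfl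
  have r1 : ∀ z, s₁.reg z = s.reg z := fun z => f₁.reg z rfl
  have r2 : ∀ z, s₂.reg z = s.reg z := fun z => (f₂.reg z rfl).trans (r1 z)
  obtain ⟨b1, b2, b3, b4, b5, b6, b7⟩ := h₂ _ _ k₀ k₁ rfl rfl (by rw [f₁.arr _ rfl, r1])
  have o1 : ∀ a, mergeIdleProg.writesArr a = false → mergeBusyProg.writesArr a = false →
      s₂.arr a = s.arr a := fun a h h' => (f₂.arr a h').trans (f₁.arr a h)
  have o2 : ∀ a, mergeBusyProg.writesArr a = false → s₂.arr a = s₁.arr a := fun a h => f₂.arr a h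
  simp only [r1, netOf, Edge.comp, f₁.arr _ (show mergeIdleProg.writesArr aW0 = false from rfl),
    f₁.arr _ (show mergeIdleProg.writesArr aGa = false from rfl),
    f₁.arr _ (show mergeIdleProg.writesArr aWf = false from rfl),
    f₁.arr _ (show mergeIdleProg.writesArr aWb = false from rfl),
    f₁.arr _ (show mergeIdleProg.writesArr aCf = false from rfl),
    f₁.arr _ (show mergeIdleProg.writesArr aCb = false from rfl),
    f₁.arr _ (show mergeIdleProg.writesArr aB = false from rfl)] at b1 b2 b3 b4 b5 b6 b7
  have hb' : s.arr aB (s.reg rFst) = s.reg rVtx := hb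
  simp only [netOf] at hx hy
  rw [mem_netOf_E] at hE
  rw [mem_netOf_V] at hV
  have h1 : s.reg rSnd ≠ s.reg rVtx := by omega
  have hlive : s₂.arr aLive = s.arr aLive := o1 _ rfl rfl
  simp only [Store.setArr, Expr.eval, r2]
  ext1
  · ext v
    by_cases hv : v = s.reg rVtx
    · subst hv; simp [netOf, Net.merge, hb', r2, h1.symm]
    · by_cases hv' : v = s.reg rSnd
      · simp [netOf, Net.merge, r2, hv']; omega
      · simp [netOf, Net.merge, r2, hv, hv', hb', hlive]
  · ext e
    by_cases hv : e = s.reg rSnd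
    · subst hv; simp [netOf, Net.merge, r2]
    · by_cases hv' : e = s.reg rVtx
      · simp [netOf, Net.merge, r2, hv', h1.symm]; omega
      · simp [netOf, Net.merge, r2, hv, hv', hlive]
  · funext e
    have hk : (netOf s).c0 ((netOf s).edge (s.reg rFst)).b = k₀ ∧
        (netOf s).c1 ((netOf s).edge (s.reg rFst)).b = k₁ := by
      rw [hk₀, hk₁, ← hb]; exact ⟨rfl, rfl⟩
    simp only [Net.merge, hk.1, hk.2]
    by_cases he : e = s.reg rFst
    · subst he
      rw [Function.update_self]
      simp [netOf, Edge.comp, b1, b2, b3, b4, b5, b6, b7, o1 aA rfl rfl, o2 aN00 rfl, o2 aN01 rfl,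
        o2 aN10 rfl, o2 aN11 rfl, a1, a2, a3, a4, hx, hy]
    · rw [Function.update_of_ne he]
      simp [netOf, b1, b2, b3, b4, b5, b6, b7, o1 aA rfl rfl, o2 aN00 rfl, o2 aN01 rfl,
        o2 aN10 rfl, o2 aN11 rfl, a1, a2, a3, a4, he]
  · simp [netOf, Net.merge, o1 aC0 rfl rfl]
  · simp [netOf, Net.merge, o1 aC1 rfl rfl]

/-- Add the edge in `rEdge` in front of the list that `rDeg`, `rFst` and `rSnd` describe. -/
def pushProg : Prog :=
  setReg rSnd (reg rFst) ;; setReg rFst (reg rEdge) ;; setReg rDeg (reg rDeg ⊹ lit 1)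

/-- List the edges at the vertex in `rVtx`: their number in `rDeg`, the first two in `rFst` and
`rSnd`. -/
def incProg : Prog :=
  setReg rDeg (lit 0) ;; forLoop rEdge (reg rNum) rTot
    (ite (get aLive (reg rEdge))
      (ite (Expr.ne (get aA (reg rEdge)) (reg rVtx)) skip pushProg ;;
        ite (Expr.ne (get aB (reg rEdge)) (reg rVtx)) skip pushProg)
      skip)

/-- The registers `rDeg`, `rFst` and `rSnd` describe the list `l`. -/
def IsInc (s : Store) (l : List ℕ) : Prop :=
  s.reg rDeg = l.length ∧ (∀ h : 0 < l.length, s.reg rFst = l[0]) ∧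
    ∀ h : 1 < l.length, s.reg rSnd = l[1]

theorem pushProg_ok {s : Store} {l : List ℕ} (h : IsInc s l) :
    Ok pushProg s 8 fun s' => IsInc s' (s.reg rEdge :: l) := by
  refine (Ok.setReg_seq <| Ok.setReg_seq <| Ok.setReg ?_).le (by simp [Expr.cost])
  obtain ⟨h1, h2, h3⟩ := h
  simp only [IsInc, Store.setReg, Expr.eval]
  refine ⟨by simp [h1], fun _ => by simp, fun h => ?_⟩
  have : 0 < l.length := by simpa using h
  simp [h2 this]

theorem pushProg_ite_ok {s : Store} {l : List ℕ} (h : IsInc s l) (e : Expr) :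
    Ok (ite (Expr.ne e (reg rVtx)) skip pushProg) s (2 * e.cost + 15) fun s' =>
      IsInc s' (if e.eval s = s.reg rVtx then s.reg rEdge :: l else l) := by
  refine (Ok.ite (T₁ := 1) (T₂ := 8) (fun hne => Ok.skip ?_) (fun heq => ?_)).le
    (by simp [Expr.ne, Expr.cost]; omega)
  · rw [ne_eq, Expr.eval_ne_eq_zero] at hne
    change ¬ e.eval s = s.reg rVtx at hne
    rwa [if_neg hne]
  · rw [Expr.eval_ne_eq_zero] at heq
    change e.eval s = s.reg rVtx at heq
    rw [if_pos heq]
    exact pushProg_ok h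

/-- The names of the edges at the current vertex are found by a scan over all names. -/
theorem incProg_ok (s : Store) (h : s.reg rNum ≤ s.reg rTot) :
    Ok incProg s (20 + (s.reg rTot - s.reg rNum) * 100) fun s' =>
      IsInc s' ((netOf s).inc (s.reg rVtx) (s.reg rTot)) := by
  set N := netOf s with hN
  have hloop := Ok.forLoop (x := rEdge) (y := rTot) (lo := reg rNum)
    (p := ite (get aLive (reg rEdge))
      (ite (Expr.ne (get aA (reg rEdge)) (reg rVtx)) skip pushProg ;;
        ite (Expr.ne (get aB (reg rEdge)) (reg rVtx)) skip pushProg)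
      skip) (T := 60) (s := s.setReg rDeg 0) (a := s.reg rNum) (b := s.reg rTot)
    (fun i s' => IsInc s' (N.inc (s.reg rVtx) i)) (by norm_num) rfl rfl rfl rfl h ?_ ?_
  · refine (Ok.setReg_seq (hloop.mono le_rfl fun _ _ h => h.1)).le ?_
    simp [Expr.cost]
    omega
  · have : N.inc (s.reg rVtx) (s.reg rNum) = [] := by
      rw [List.eq_nil_iff_forall_not_mem]
      intro e he
      rw [Net.mem_inc, hN, mem_netOf_E] at he
      omega
    rw [this]
    simp [IsInc, Store.setReg]
  · intro i s' hi hi' hI hreg hf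
    have hNs : netOf s' = N := by rw [hf.netOf_eq (by decide)]; rfl
    have hv : s'.reg rVtx = s.reg rVtx := hf.reg _ rfl
    have hn : s'.reg rNum = s.reg rNum := hf.reg _ rfl
    have ht : s'.reg rTot = s.reg rTot := hf.reg _ rfl
    have hmem : i ∈ N.E ↔ s'.arr aLive i ≠ 0 := by
      rw [← hNs, mem_netOf_E]; omega
    have hA : (N.edge i).a = s'.arr aA i := by rw [← hNs]; rfl
    have hB : (N.edge i).b = s'.arr aB i := by rw [← hNs]; rfl
    have key : ∀ s'' l, IsInc s'' l → IsInc (s''.setReg rEdge (i + 1)) l := fun s'' l h => by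
      simpa [IsInc, Store.setReg] using h
    refine (Ok.ite (T₁ := 38) (T₂ := 1) (fun hl => ?_) (fun hl => ?_)).le (by simp [Expr.cost])
    · refine (Ok.seq (pushProg_ite_ok hI (get aA (reg rEdge))) fun s₁ f₁ h₁ =>
        (pushProg_ite_ok h₁ (get aB (reg rEdge))).mono le_rfl fun s₂ f₂ h₂ => key _ _ ?_).le
        (by simp [Expr.cost])
      simp only [Expr.eval, hreg] at hl h₁ h₂
      have e1 : s₁.reg rEdge = i := by rw [f₁.reg _ rfl, hreg]
      have e2 : s₁.reg rVtx = s.reg rVtx := by rw [f₁.reg _ rfl, hv]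
      rw [f₁.arr _ rfl, e1, e2, hv] at h₂
      simpa only [Net.inc, hmem.2 hl, true_and, hA, hB] using h₂
    · refine Ok.skip (key _ _ ?_)
      simp only [Expr.eval, hreg] at hl
      have : i ∉ N.E := by rw [hmem]; simpa using hl
      simpa only [Net.inc, this, false_and, if_false] using hI

/-! ### The elimination phase -/

/-- Neither of the two eliminations applies to the vertex `v`. -/
def Net.Stuck (N : Net) (i v : ℕ) : Prop :=
  (N.inc v i).length ≠ 1 ∧ ∀ e₁ e₂, N.inc v i = [e₁, e₂] → e₁ = e₂

/-- `N` with the edge `e` oriented towards `v`. -/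
def Net.orientTo (N : Net) (e v : ℕ) : Net := if (N.edge e).b = v then N else N.flip e

/-- `N` with the edge `e` oriented away from `v`. -/
def Net.orientFrom (N : Net) (e v : ℕ) : Net := if (N.edge e).a = v then N else N.flip e

namespace Net

variable {N : Net} {r k B e v : ℕ}

theorem flip_edge_self (N : Net) (e : ℕ) : (N.flip e).edge e = (N.edge e).flip := by
  simp [Net.flip]

theorem flip_edge_of_ne (N : Net) {e e' : ℕ} (h : e' ≠ e) : (N.flip e).edge e' = N.edge e' := by
  simp [Net.flip, h]

/-- What orienting an edge at `v` does not change. -/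
structure SameShape (N M : Net) (r k B e : ℕ) : Prop where
  inv : M.Inv r k
  feas : M.Feas r B ↔ N.Feas r B
  V : M.V = N.V
  E : M.E = N.E
  other : ∀ e', e' ≠ e → M.edge e' = N.edge e'

theorem Inv.sameShape_orientTo (h : N.Inv r k) (e v : ℕ) :
    SameShape N (N.orientTo e v) r k B e := by
  unfold orientTo
  split_ifs
  · exact ⟨h, Iff.rfl, rfl, rfl, fun _ _ => rfl⟩
  · exact ⟨h.flip e, feas_flip e, rfl, rfl, fun _ he => flip_edge_of_ne N he⟩

theorem Inv.sameShape_orientFrom (h : N.Inv r k) (e v : ℕ) :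
    SameShape N (N.orientFrom e v) r k B e := by
  unfold orientFrom
  split_ifs
  · exact ⟨h, Iff.rfl, rfl, rfl, fun _ _ => rfl⟩
  · exact ⟨h.flip e, feas_flip e, rfl, rfl, fun _ he => flip_edge_of_ne N he⟩

theorem orientTo_ends (h : (if (N.edge e).a = v then 1 else 0) +
    (if (N.edge e).b = v then 1 else 0) = 1) :
    ((N.orientTo e v).edge e).b = v ∧ ((N.orientTo e v).edge e).a ≠ v := by
  by_cases h1 : (N.edge e).a = v <;> by_cases h2 : (N.edge e).b = v <;> simp [h1, h2] at h
  · simp [orientTo, h2, flip_edge_self, Edge.flip, h1]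
  · simp [orientTo, h2, h1]

theorem orientFrom_ends (h : (if (N.edge e).a = v then 1 else 0) +
    (if (N.edge e).b = v then 1 else 0) = 1) :
    ((N.orientFrom e v).edge e).a = v ∧ ((N.orientFrom e v).edge e).b ≠ v := by
  by_cases h1 : (N.edge e).a = v <;> by_cases h2 : (N.edge e).b = v <;> simp [h1, h2] at h
  · simp [orientFrom, h2, h1]
  · simp [orientFrom, h1, flip_edge_self, Edge.flip, h2]

/-- `M` results from `N` by the elimination of `v`. -/
structure Eliminates (N M : Net) (r k B v : ℕ) : Prop where
  inv : M.Inv r k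
  feas : M.Feas r B ↔ N.Feas r B
  V : M.V = N.V.erase v

theorem Inv.eliminate_one (h : N.Inv r k) (hvr : v ≠ r) {i : ℕ}
    (hE : ∀ e ∈ N.E, e < i) (hl : N.inc v i = [e]) :
    e ∈ (N.orientTo e v).E ∧ ((N.orientTo e v).edge e).b = v ∧
      ((N.orientTo e v).edge e).a ≠ v ∧ (N.orientTo e v).V = N.V ∧
      Eliminates N ((N.orientTo e v).prune e) r k B v := by
  have hs := h.sameShape_orientTo (B := B) e v
  have hc := fun e' => N.count_inc v e' i
  rw [hl] at hc
  have he : e ∈ N.E := (mem_inc.1 (hl ▸ List.mem_singleton_self e)).1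
  have hce := hc e
  rw [if_pos ⟨he, hE e he⟩, List.count_singleton_self] at hce
  obtain ⟨h1, h2⟩ := orientTo_ends hce.symm
  have ho : ∀ e' ∈ (N.orientTo e v).E, e' ≠ e → ((N.orientTo e v).edge e').a ≠ v ∧
      ((N.orientTo e v).edge e').b ≠ v := by
    intro e' he' hne
    rw [hs.E] at he'
    have : e' ∉ N.inc v i := by rw [hl]; simpa using hne
    rw [mem_inc] at this
    rw [hs.other e' hne]
    constructor <;> intro hh <;> exact this ⟨he', hE e' he', by simp [hh]⟩
  have heE : e ∈ (N.orientTo e v).E := hs.E ▸ he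
  have hends := hs.inv.ends e heE
  refine ⟨heE, h1, h2, hs.V, hs.inv.prune heE (by rwa [h1]) (by rwa [h1]) (by rwa [h1]), ?_, ?_⟩
  · rw [feas_prune heE hends.1 hends.2 (by rwa [h1]) (by rwa [h1]) (by rwa [h1])]
    exact hs.feas
  · rw [← hs.V]
    change (N.orientTo e v).V.erase ((N.orientTo e v).edge e).b = _
    rw [h1]

theorem Inv.eliminate_two (h : N.Inv r k) (hvr : v ≠ r) {i e₁ e₂ : ℕ}
    (hE : ∀ e ∈ N.E, e < i) (hl : N.inc v i = [e₁, e₂]) (hne : e₁ ≠ e₂) :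
    e₂ ∈ ((N.orientTo e₁ v).orientFrom e₂ v).E ∧
      (((N.orientTo e₁ v).orientFrom e₂ v).edge e₁).b = v ∧
      ((N.orientTo e₁ v).orientFrom e₂ v).V = N.V ∧
      Eliminates N (((N.orientTo e₁ v).orientFrom e₂ v).merge e₁ e₂) r k B v := by
  have hs := h.sameShape_orientTo (B := B) e₁ v
  have hs' := hs.inv.sameShape_orientFrom (B := B) e₂ v
  have hc := fun e' => N.count_inc v e' i
  rw [hl] at hc
  have he₁ : e₁ ∈ N.E := (mem_inc.1 (hl ▸ List.mem_cons_self : e₁ ∈ N.inc v i)).1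
  have he₂ : e₂ ∈ N.E := (mem_inc.1 (hl ▸ List.mem_cons_of_mem _ (List.mem_singleton_self _) :
    e₂ ∈ N.inc v i)).1
  have hc₁ := hc e₁
  have hc₂ := hc e₂
  rw [if_pos ⟨he₁, hE _ he₁⟩, List.count_cons_self, List.count_singleton,
    if_neg (by simpa using hne.symm)] at hc₁
  rw [if_pos ⟨he₂, hE _ he₂⟩, List.count_cons_of_ne hne, List.count_singleton_self] at hc₂
  rw [← hs.other e₂ hne.symm] at hc₂
  obtain ⟨h1, h2⟩ := orientTo_ends hc₁.symm
  obtain ⟨h3, h4⟩ := orientFrom_ends hc₂.symm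
  rw [← hs'.other e₁ hne] at h1 h2
  set M := (N.orientTo e₁ v).orientFrom e₂ v with hM
  have hVV : M.V = N.V := hs'.V.trans hs.V
  have hEE : M.E = N.E := hs'.E.trans hs.E
  have ho : ∀ e' ∈ M.E, e' ≠ e₁ → e' ≠ e₂ → (M.edge e').a ≠ v ∧ (M.edge e').b ≠ v := by
    intro e' he' hne₁ hne₂
    rw [hEE] at he'
    have : e' ∉ N.inc v i := by rw [hl]; simp [hne₁, hne₂]
    rw [mem_inc] at this
    rw [hs'.other e' hne₂, hs.other e' hne₁]
    constructor <;> intro hh <;> exact this ⟨he', hE e' he', by simp [hh]⟩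
  have heE₁ : e₁ ∈ M.E := hEE ▸ he₁
  have heE₂ : e₂ ∈ M.E := hEE ▸ he₂
  refine ⟨heE₂, h1, hVV, hs'.inv.merge heE₁ heE₂ hne (by rw [h1, h3]) (by rwa [h1]) (by rwa [h1])
    (by rwa [h1]) (by rwa [h1]), ?_, ?_⟩
  · rw [feas_merge heE₁ heE₂ hne (hs'.inv.ends e₁ heE₁).2 (by rw [h1, h3]) (by rwa [h1])
      (by rwa [h1]) (by rwa [h1]) (by rwa [h1])]
    exact hs'.feas.trans hs.feas
  · rw [← hVV]
    change M.V.erase (M.edge e₁).b = _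
    rw [h1]

end Net

/-- Orient the edge in `rFst` towards the vertex in `rVtx`. -/
def orientToProg : Prog := ite (Expr.ne (get aB (reg rFst)) (reg rVtx)) (flipProg rFst) skip

/-- Orient the edge in `rSnd` away from the vertex in `rVtx`. -/
def orientFromProg : Prog := ite (Expr.ne (get aA (reg rSnd)) (reg rVtx)) (flipProg rSnd) skip

theorem orientToProg_ok (s : Store) : Ok orientToProg s 60 fun s' =>
    netOf s' = (netOf s).orientTo (s.reg rFst) (s.reg rVtx) := by
  refine (Ok.ite (T₁ := 43) (T₂ := 1) (fun hne => ?_) (fun heq => Ok.skip ?_)).le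
    (by simp [Expr.ne, Expr.cost])
  · rw [ne_eq, Expr.eval_ne_eq_zero] at hne
    have : ((netOf s).edge (s.reg rFst)).b ≠ s.reg rVtx := hne
    rw [Net.orientTo, if_neg this]
    exact flipProg_ok s (by norm_num)
  · rw [Expr.eval_ne_eq_zero] at heq
    have : ((netOf s).edge (s.reg rFst)).b = s.reg rVtx := heq
    rw [Net.orientTo, if_pos this]

theorem orientFromProg_ok (s : Store) : Ok orientFromProg s 60 fun s' =>
    netOf s' = (netOf s).orientFrom (s.reg rSnd) (s.reg rVtx) := by
  refine (Ok.ite (T₁ := 43) (T₂ := 1) (fun hne => ?_) (fun heq => Ok.skip ?_)).le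
    (by simp [Expr.ne, Expr.cost])
  · rw [ne_eq, Expr.eval_ne_eq_zero] at hne
    have : ((netOf s).edge (s.reg rSnd)).a ≠ s.reg rVtx := hne
    rw [Net.orientFrom, if_neg this]
    exact flipProg_ok s (by norm_num)
  · rw [Expr.eval_ne_eq_zero] at heq
    have : ((netOf s).edge (s.reg rSnd)).a = s.reg rVtx := heq
    rw [Net.orientFrom, if_pos this]

/-- Eliminate the vertex in `rVtx` and restart the search, or go to the next vertex if it cannot be
eliminated. -/
def elimStep : Prog :=
  ite (Expr.ne (reg rVtx) (reg rRoot))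
    (ite (get aLive (reg rVtx))
      (incProg ;; ite (Expr.ne (reg rDeg) (lit 1))
        (ite (Expr.ne (reg rDeg) (lit 2))
          (setReg rVtx (reg rVtx ⊹ lit 1))
          (ite (Expr.ne (reg rFst) (reg rSnd))
            (orientToProg ;; orientFromProg ;; mergeProg ;; setReg rVtx (lit 0))
            (setReg rVtx (reg rVtx ⊹ lit 1))))
        (orientToProg ;; pruneProg ;; setReg rVtx (lit 0)))
      (setReg rVtx (reg rVtx ⊹ lit 1)))
    (setReg rVtx (reg rVtx ⊹ lit 1))

/-- Eliminate vertices as long as possible. -/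
def elimProg : Prog :=
  setReg rVtx (lit 0) ;; loop (reg rNum ∸ reg rVtx) elimStep

theorem netOf_setReg_vtx (s : Store) (x : ℕ) : netOf (s.setReg rVtx x) = netOf s := by
  simp [netOf, Store.setReg]

/-- One step either eliminates the current vertex or finds that it is stuck. -/
theorem elimStep_ok {s : Store} {k B : ℕ} (hinv : (netOf s).Inv (s.reg rRoot) k)
    (hnt : s.reg rNum ≤ s.reg rTot) (hv : s.reg rVtx < s.reg rNum) :
    Ok elimStep s (2000 + (s.reg rTot - s.reg rNum) * 100) fun s' =>
      ((netOf s).Eliminates (netOf s') (s.reg rRoot) k B (s.reg rVtx) ∧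
        s.reg rVtx ∈ (netOf s).V ∧ s'.reg rVtx = 0) ∨
      (netOf s' = netOf s ∧ s'.reg rVtx = s.reg rVtx + 1 ∧
        (s.reg rVtx ∈ (netOf s).V → s.reg rVtx ≠ s.reg rRoot →
          (netOf s).Stuck (s.reg rTot) (s.reg rVtx))) := by
  set N := netOf s with hN
  have hE : ∀ e ∈ N.E, e < s.reg rTot := fun e he => (mem_netOf_E.1 he).1.2
  -- the case that the program goes to the next vertex
  have next : ∀ s' : Store, netOf s' = N → s'.reg rVtx = s.reg rVtx →
      (s.reg rVtx ∈ N.V → s.reg rVtx ≠ s.reg rRoot → N.Stuck (s.reg rTot) (s.reg rVtx)) →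
      Ok (setReg rVtx (reg rVtx ⊹ lit 1)) s' 4 fun s' =>
      (N.Eliminates (netOf s') (s.reg rRoot) k B (s.reg rVtx) ∧
        s.reg rVtx ∈ N.V ∧ s'.reg rVtx = 0) ∨
      (netOf s' = N ∧ s'.reg rVtx = s.reg rVtx + 1 ∧
        (s.reg rVtx ∈ N.V → s.reg rVtx ≠ s.reg rRoot → N.Stuck (s.reg rTot) (s.reg rVtx))) := by
    intro s' h1 h2 h3
    refine (Ok.setReg (Or.inr ⟨?_, ?_, h3⟩)).le (by simp [Expr.cost])
    · rw [netOf_setReg_vtx, h1]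
    · simp [Store.setReg, Expr.eval, h2]
  refine (Ok.ite (T₁ := 1900 + (s.reg rTot - s.reg rNum) * 100) (T₂ := 4) (fun hr => ?_)
    fun hr => ?_).le (by simp [Expr.ne, Expr.cost]; omega)
  swap
  · rw [Expr.eval_ne_eq_zero] at hr
    exact next s rfl rfl fun _ h => absurd hr h
  rw [ne_eq, Expr.eval_ne_eq_zero] at hr
  replace hr : s.reg rVtx ≠ s.reg rRoot := hr
  refine (Ok.ite (T₁ := 1850 + (s.reg rTot - s.reg rNum) * 100) (T₂ := 4) (fun hl => ?_)
    fun hl => ?_).le (by simp [Expr.cost]; omega)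
  swap
  · replace hl : s.arr aLive (s.reg rVtx) = 0 := hl
    exact next s rfl rfl fun h => absurd hl (mem_netOf_V.1 h).2
  replace hl : s.arr aLive (s.reg rVtx) ≠ 0 := hl
  have hV : s.reg rVtx ∈ N.V := mem_netOf_V.2 ⟨hv, hl⟩
  refine (Ok.seq (T₂ := 1800) (incProg_ok s hnt) fun s₁ f₁ h₁ => ?_).le (by omega)
  obtain ⟨hdeg, hfst, hsnd⟩ := h₁
  rw [← hN] at hdeg hfst hsnd
  have hN₁ : netOf s₁ = N := f₁.netOf_eq (by decide)
  have hv₁ : s₁.reg rVtx = s.reg rVtx := f₁.reg _ rfl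
  refine (Ok.ite (T₁ := 1200) (T₂ := 500) (fun h1 => ?_) fun h1 => ?_).le
    (by simp [Expr.ne, Expr.cost])
  · rw [ne_eq, Expr.eval_ne_eq_zero] at h1
    replace h1 : s₁.reg rDeg ≠ 1 := h1
    rw [hdeg] at h1
    refine (Ok.ite (T₁ := 4) (T₂ := 1100) (fun h2 => ?_) fun h2 => ?_).le
      (by simp [Expr.ne, Expr.cost])
    · rw [ne_eq, Expr.eval_ne_eq_zero] at h2
      replace h2 : s₁.reg rDeg ≠ 2 := h2
      rw [hdeg] at h2
      exact next s₁ hN₁ hv₁ fun _ _ => ⟨h1, fun e₁ e₂ h => by simp [h] at h2⟩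
    · rw [Expr.eval_ne_eq_zero] at h2
      replace h2 : s₁.reg rDeg = 2 := h2
      rw [hdeg, List.length_eq_two] at h2
      obtain ⟨e₁, e₂, h2⟩ := h2
      have hfst : s₁.reg rFst = e₁ := by simpa [h2] using hfst
      have hsnd : s₁.reg rSnd = e₂ := by simpa [h2] using hsnd
      refine (Ok.ite (T₁ := 1000) (T₂ := 4) (fun h3 => ?_) fun h3 => ?_).le
        (by simp [Expr.ne, Expr.cost])
      swap
      · rw [Expr.eval_ne_eq_zero] at h3
        replace h3 : s₁.reg rFst = s₁.reg rSnd := h3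
        rw [hfst, hsnd] at h3
        refine next s₁ hN₁ hv₁ fun _ _ => ⟨h1, fun e e' h => ?_⟩
        rw [h2] at h
        simp only [List.cons.injEq, and_true] at h
        rw [← h.1, ← h.2, h3]
      rw [ne_eq, Expr.eval_ne_eq_zero] at h3
      replace h3 : s₁.reg rFst ≠ s₁.reg rSnd := h3
      rw [hfst, hsnd] at h3
      obtain ⟨m1, m2, m3, m4⟩ := hinv.eliminate_two (B := B) hr hE h2 h3
      refine (Ok.seq (orientToProg_ok s₁) fun s₂ f₂ h₂ => Ok.seq (orientFromProg_ok s₂)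
        fun s₃ f₃ h₃ => Ok.seq (T₁ := 500) (T₂ := 2) (R := fun s' => netOf s' =
          (netOf s₃).merge (s₃.reg rFst) (s₃.reg rSnd)) ?_ fun s₄ f₄ h₄ =>
          Ok.setReg (Or.inl ⟨?_, hV, ?_⟩)).le (by norm_num)
      all_goals
        have g1 : s₂.reg rFst = e₁ := (f₂.reg _ rfl).trans hfst
        have g2 : s₂.reg rSnd = e₂ := (f₂.reg _ rfl).trans hsnd
        have g3 : s₂.reg rVtx = s.reg rVtx := (f₂.reg _ rfl).trans hv₁
        have g4 : s₃.reg rFst = e₁ := (f₃.reg _ rfl).trans g1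
        have g5 : s₃.reg rSnd = e₂ := (f₃.reg _ rfl).trans g2
        have g6 : s₃.reg rVtx = s.reg rVtx := (f₃.reg _ rfl).trans g3
        rw [h₂, hN₁, hfst, hv₁, g2, g3] at h₃
      · refine mergeProg_ok ?_ ?_ ?_
        · rw [h₃, g5]; exact m1
        · rw [h₃, g6, m3]; exact hV
        · rw [h₃, g4, g6]; exact m2
      · rw [netOf_setReg_vtx, h₄, h₃, g4, g5]; exact m4
      · simp [Store.setReg, Expr.eval]
  · rw [Expr.eval_ne_eq_zero] at h1
    replace h1 : s₁.reg rDeg = 1 := h1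
    rw [hdeg, List.length_eq_one_iff] at h1
    obtain ⟨e, h1⟩ := h1
    have hfst : s₁.reg rFst = e := by simpa [h1] using hfst
    obtain ⟨m1, m2, m3, m4, m5⟩ := hinv.eliminate_one (B := B) hr hE h1
    refine (Ok.seq (orientToProg_ok s₁) fun s₂ f₂ h₂ => Ok.seq (T₁ := 100) (T₂ := 2)
      (R := fun s' => netOf s' = (netOf s₂).prune (s₂.reg rFst)) ?_ fun s₄ f₄ h₄ =>
          Ok.setReg (Or.inl ⟨?_, hV, ?_⟩)).le (by norm_num)
    all_goals
      have g1 : s₂.reg rFst = e := (f₂.reg _ rfl).trans hfst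
      have g3 : s₂.reg rVtx = s.reg rVtx := (f₂.reg _ rfl).trans hv₁
      rw [hN₁, hfst, hv₁] at h₂
    · refine pruneProg_ok ?_ ?_ ?_ ?_
      · rw [h₂, g1]; exact m1
      · rw [h₂, g3, m4]; exact hV
      · rw [h₂, g1, g3]; exact m2
      · rw [h₂, g1, g3]; exact m3
    · rw [netOf_setReg_vtx, h₄, h₂, g1]; exact m5
    · simp [Store.setReg, Expr.eval]

/-- Each step eliminates a vertex, whereupon the search starts again, or moves on to the next
vertex. So the number of live vertices times `n + 1`, plus the number of vertices not yet searched,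
decreases. -/
theorem elimProg_ok {s : Store} {k B : ℕ} (hinv : (netOf s).Inv (s.reg rRoot) k)
    (hnt : s.reg rNum ≤ s.reg rTot) :
    Ok elimProg s (10 + (s.reg rNum + 1) * (s.reg rNum + 1) *
      (2010 + (s.reg rTot - s.reg rNum) * 100)) fun s' =>
      (netOf s').Inv (s.reg rRoot) k ∧ ((netOf s').Feas (s.reg rRoot) B ↔
        (netOf s).Feas (s.reg rRoot) B) ∧
      ∀ v ∈ (netOf s').V, v ≠ s.reg rRoot → (netOf s').Stuck (s.reg rTot) v := by
  have hloop := Ok.loop (e := reg rNum ∸ reg rVtx) (p := elimStep)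
    (T := 2000 + (s.reg rTot - s.reg rNum) * 100)
    (fun s' => Frame elimProg s s' ∧ (netOf s').Inv (s.reg rRoot) k ∧
      ((netOf s').Feas (s.reg rRoot) B ↔ (netOf s).Feas (s.reg rRoot) B) ∧
      ∀ v ∈ (netOf s').V, v < s'.reg rVtx → v ≠ s.reg rRoot → (netOf s').Stuck (s.reg rTot) v)
    (fun s' => (netOf s').V.card * (s.reg rNum + 1) + (s.reg rNum - s'.reg rVtx)) ?_
    (s := s.setReg rVtx 0) ?_
  · refine (Ok.setReg_seq (hloop.mono le_rfl fun s' _ h => ?_)).le ?_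
    · obtain ⟨⟨h1, h2, h3, h4⟩, h5⟩ := h
      refine ⟨h2, h3, fun v hv hvr => h4 v hv ?_ hvr⟩
      have := (mem_netOf_V.1 hv).1
      simp only [Expr.eval] at h5
      omega
    · have h1 : (netOf (s.setReg rVtx 0)).V.card ≤ s.reg rNum := by
        rw [netOf_setReg_vtx]
        refine (Finset.card_filter_le _ _).trans (by simp)
      have h2 : (s.setReg rVtx 0).reg rVtx = 0 := by simp [Store.setReg]
      rw [h2]
      simp only [Expr.cost]
      have h3 : (netOf (s.setReg rVtx 0)).V.card * (s.reg rNum + 1) + (s.reg rNum - 0) + 1 ≤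
          (s.reg rNum + 1) * (s.reg rNum + 1) := by
        have := Nat.mul_le_mul_right (s.reg rNum + 1) h1
        rw [Nat.add_mul (s.reg rNum) 1]
        omega
      calc _ ≤ 10 + ((netOf (s.setReg rVtx 0)).V.card * (s.reg rNum + 1) + (s.reg rNum - 0)) *
              (2010 + (s.reg rTot - s.reg rNum) * 100) := by
            have : 2000 + (s.reg rTot - s.reg rNum) * 100 + (1 + 1 + 1) + 1 ≤
              2010 + (s.reg rTot - s.reg rNum) * 100 := by omega
            have := Nat.mul_le_mul_left ((netOf (s.setReg rVtx 0)).V.card * (s.reg rNum + 1) +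
              (s.reg rNum - 0)) this
            omega
        _ ≤ _ := by
            gcongr
            omega
  · rintro s' ⟨hf, h2, h3, h4⟩ he
    have e1 : s'.reg rNum = s.reg rNum := hf.reg _ rfl
    have e2 : s'.reg rTot = s.reg rTot := hf.reg _ rfl
    have e3 : s'.reg rRoot = s.reg rRoot := hf.reg _ rfl
    simp only [Expr.eval, e1] at he
    have hstep := elimStep_ok (s := s') (k := k) (B := B) (by rwa [e3]) (by rwa [e1, e2])
      (by omega)
    rw [e1, e2, e3] at hstep
    refine hstep.mono le_rfl fun s'' f hs => ?_
    have hf' : Frame elimProg s s'' := by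
      constructor
      · intro x hx
        have : elimStep.writesReg x = false := by
          simp only [elimProg, Prog.writesReg, Bool.or_eq_false_iff] at hx
          exact hx.2
        rw [f.reg x this, hf.reg x hx]
      · intro x hx
        rw [f.arr x (by simpa [elimProg, Prog.writesArr] using hx), hf.arr x hx]
    rcases hs with ⟨⟨i1, i2, i3⟩, i4, i5⟩ | ⟨i1, i2, i3⟩
    · refine ⟨⟨hf', i1, i2.trans h3, fun v _ hv => by omega⟩, ?_⟩
      rw [i3, Finset.card_erase_of_mem i4, i5]
      have := Finset.card_pos.2 ⟨_, i4⟩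
      obtain ⟨c, hc⟩ := Nat.exists_eq_succ_of_ne_zero this.ne'
      rw [hc, Nat.succ_mul]
      simp only [Nat.succ_eq_add_one, Nat.add_sub_cancel]
      omega
    · rw [i1]
      refine ⟨⟨hf', h2, h3, fun v hv hlt hvr => ?_⟩, by omega⟩
      by_cases hvv : v = s'.reg rVtx
      · subst hvv; exact i3 hv hvr
      · exact h4 v hv (by omega) hvr
  · refine ⟨⟨?_, fun _ _ => rfl⟩, ?_⟩
    · intro x hx
      have : x ≠ rVtx := by rintro rfl; simp [elimProg, Prog.writesReg] at hx
      simp [Store.setReg, this]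
    · rw [netOf_setReg_vtx]
      refine ⟨hinv, Iff.rfl, fun v _ hv => ?_⟩
      simp [Store.setReg] at hv

/-! ### The initialization phase -/

/-- Compute the multiples of `n` and the number `n + n * n` of names. -/
def offProg : Prog :=
  setReg rTot (lit 0) ;;
    forLoop rI (lit 0) rNum (setArr aOff (reg rI) (reg rTot) ;;
      setReg rTot (reg rTot ⊹ reg rNum)) ;;
    setReg rTot (reg rTot ⊹ reg rNum)

theorem offProg_ok (s : Store) : Ok offProg s (30 + s.reg rNum * 20) fun s' =>
    s'.reg rTot = s.reg rNum * s.reg rNum + s.reg rNum ∧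
      ∀ u < s.reg rNum, s'.arr aOff u = s.reg rNum * u := by
  have hloop := Ok.forLoop (x := rI) (y := rNum) (lo := lit 0)
    (p := setArr aOff (reg rI) (reg rTot) ;; setReg rTot (reg rTot ⊹ reg rNum))
    (T := 10) (s := s.setReg rTot 0) (a := 0) (b := s.reg rNum)
    (fun i s' => s'.reg rTot = s.reg rNum * i ∧ ∀ u < i, s'.arr aOff u = s.reg rNum * u)
    (by norm_num) rfl rfl rfl rfl (Nat.zero_le _) (by simp [Store.setReg]) ?_
  · refine (Ok.setReg_seq (Ok.seq hloop fun s' f h => Ok.setReg ?_)).le (by simp [Expr.cost]; omega)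
    have e1 : s'.reg rNum = s.reg rNum := f.reg _ rfl
    obtain ⟨⟨h1, h2⟩, -⟩ := h
    refine ⟨by simp [Store.setReg, Expr.eval, e1, h1], fun u hu => ?_⟩
    simpa [Store.setReg] using h2 u hu
  · rintro i s' - hi ⟨h1, h2⟩ hreg hf
    have e1 : s'.reg rNum = s.reg rNum := hf.reg _ rfl
    refine (Ok.setArr_seq <| Ok.setReg ?_).le (by simp [Expr.cost])
    refine ⟨?_, fun u hu => ?_⟩
    · simp [Store.setReg, Store.setArr, Expr.eval, e1, h1]; ring
    · simp only [Store.setReg, Store.setArr, Expr.eval, hreg, Function.update_self]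
      by_cases hui : u = i
      · subst hui; simp [h1]
      · rw [Function.update_of_ne hui]; exact h2 u (by omega)

/-- Set up the vertices, and take some waypoint as the root. -/
def vertProg : Prog :=
  forLoop rI (lit 0) rNum
    (setArr aLive (reg rI) (lit 1) ;; ite (get aWay (reg rI))
      (setArr aC0 (reg rI) (reg rBud ⊹ lit 1) ;; setReg rRoot (reg rI)) skip)

theorem vertProg_ok {s : Store} (hl : ∀ p, s.arr aLive p = 0) (hc : ∀ v, s.arr aC0 v = 0) :
    Ok vertProg s (30 + s.reg rNum * 30) fun s' =>
      (∀ p, s'.arr aLive p = if p < s.reg rNum then 1 else 0) ∧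
      (∀ v < s.reg rNum, s'.arr aC0 v = if s.arr aWay v ≠ 0 then s.reg rBud + 1 else 0) ∧
      ((∃ v < s.reg rNum, s.arr aWay v ≠ 0) →
        s'.reg rRoot < s.reg rNum ∧ s.arr aWay (s'.reg rRoot) ≠ 0) := by
  have hloop := Ok.forLoop (x := rI) (y := rNum) (lo := lit 0)
    (p := setArr aLive (reg rI) (lit 1) ;; ite (get aWay (reg rI))
      (setArr aC0 (reg rI) (reg rBud ⊹ lit 1) ;; setReg rRoot (reg rI)) skip)
    (T := 20) (s := s) (a := 0) (b := s.reg rNum)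
    (fun i s' => (∀ p, s'.arr aLive p = if p < i then 1 else 0) ∧
      (∀ v, s'.arr aC0 v = if v < i ∧ s.arr aWay v ≠ 0 then s.reg rBud + 1 else 0) ∧
      ((∃ v < i, s.arr aWay v ≠ 0) → s'.reg rRoot < i ∧ s.arr aWay (s'.reg rRoot) ≠ 0))
    (by norm_num) rfl rfl rfl rfl (Nat.zero_le _) (by simp [Store.setReg, hl, hc]) ?_
  · refine hloop.mono (by simp [Expr.cost]; omega) ?_
    rintro s' f ⟨⟨h1, h2, h3⟩, -⟩
    refine ⟨h1, fun v hv => ?_, h3⟩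
    rw [h2]
    simp [hv]
  · rintro i s' - hi ⟨h1, h2, h3⟩ hreg hf
    have e1 : s'.reg rBud = s.reg rBud := hf.reg _ rfl
    have e2 : s'.arr aWay = s.arr aWay := hf.arr _ rfl
    have hlive : ∀ p, (Function.update (s'.arr aLive) i 1) p = if p < i + 1 then 1 else 0 := by
      intro p
      by_cases hp : p = i
      · subst hp; simp
      · rw [Function.update_of_ne hp, h1]
        have : p < i ↔ p < i + 1 := by omega
        simp [this]
    refine (Ok.setArr_seq <| Ok.ite (T₁ := 8) (T₂ := 1) (fun hw => Ok.le (Ok.setArr_seq <|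
      Ok.setReg ?_) (by simp [Expr.cost])) fun hw => Ok.skip ?_).le (by simp [Expr.cost])
    all_goals
      simp only [Store.setArr, Expr.eval, hreg, e2, Function.update_of_ne (show aWay ≠ aLive by
        norm_num)] at hw
    · simp only [Store.setReg, Store.setArr, Expr.eval, hreg, e1]
      refine ⟨by simpa using hlive, fun v => ?_, fun _ => by simpa using hw⟩
      by_cases hv : v = i
      · subst hv; simp [hw]
      · have : v < i ↔ v < i + 1 := by omega
        simp [hv, h2, this]
    · simp only [Store.setReg, Store.setArr, Expr.eval, hreg]
      refine ⟨by simpa using hlive, fun v => ?_, ?_⟩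
      · by_cases hv : v = i
        · subst hv; simp [hw, h2]
        · have : v < i ↔ v < i + 1 := by omega
          simp [h2, this]
      · rintro ⟨v, hv, hvw⟩
        have hvi : v ≠ i := by rintro rfl; exact hvw hw
        obtain ⟨h4, h5⟩ := h3 ⟨v, by omega, hvw⟩
        simpa using ⟨by omega, h5⟩

/-- Set up the edge between the vertices in `rI` and `rJ`; it is live if the first is smaller than
the second and they are joined by an arc. -/
def edgeBody : Prog :=
  setReg rTmp (get aOff (reg rI) ⊹ reg rJ) ;;
  setReg rVtx (get aOff (reg rJ) ⊹ reg rI) ;;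
  setReg rEdge (reg rNum ⊹ reg rTmp) ;;
  setArr aA (reg rEdge) (reg rI) ;;
  setArr aB (reg rEdge) (reg rJ) ;;
  setArr aWf (reg rEdge) (get aWt (reg rTmp)) ;;
  setArr aWb (reg rEdge) (get aWt (reg rVtx)) ;;
  setArr aCf (reg rEdge) (get aCap (reg rTmp)) ;;
  setArr aCb (reg rEdge) (get aCap (reg rVtx)) ;;
  setArr aW0 (reg rEdge) (reg rBud ⊹ lit 1) ;;
  ite (get aCap (reg rTmp)) (ite (get aCap (reg rVtx))
    (setArr aW0 (reg rEdge) (get aWt (reg rTmp) ⊹ get aWt (reg rVtx))) skip) skip ;;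
  ite (reg rJ ∸ reg rI) (ite (get aAdj (reg rTmp) ⊹ get aAdj (reg rVtx))
    (setArr aLive (reg rEdge) (lit 1)) skip) skip

/-- Set up all edges. -/
def edgeProg : Prog := forLoop rI (lit 0) rNum (forLoop rJ (lit 0) rNum edgeBody)

/-- The data of the edge between `x` and `y` in `s'` is the one derived from the input arrays in
`s`. -/
structure IsEdgeAt (s s' : Store) (x y : ℕ) : Prop where
  a : s'.arr aA (s.reg rNum + (s.reg rNum * x + y)) = x
  b : s'.arr aB (s.reg rNum + (s.reg rNum * x + y)) = y
  wf : s'.arr aWf (s.reg rNum + (s.reg rNum * x + y)) = s.arr aWt (s.reg rNum * x + y)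
  wb : s'.arr aWb (s.reg rNum + (s.reg rNum * x + y)) = s.arr aWt (s.reg rNum * y + x)
  cf : s'.arr aCf (s.reg rNum + (s.reg rNum * x + y)) = s.arr aCap (s.reg rNum * x + y)
  cb : s'.arr aCb (s.reg rNum + (s.reg rNum * x + y)) = s.arr aCap (s.reg rNum * y + x)
  w0 : s'.arr aW0 (s.reg rNum + (s.reg rNum * x + y)) =
    if s.arr aCap (s.reg rNum * x + y) ≠ 0 ∧ s.arr aCap (s.reg rNum * y + x) ≠ 0 then
      s.arr aWt (s.reg rNum * x + y) + s.arr aWt (s.reg rNum * y + x) else s.reg rBud + 1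

/-- The edges between the pairs in `D` have been set up. -/
structure EdgeInv (s : Store) (D : ℕ → ℕ → Prop) (s' : Store) : Prop where
  edge : ∀ x < s.reg rNum, ∀ y < s.reg rNum, D x y → IsEdgeAt s s' x y
  live : ∀ x < s.reg rNum, ∀ y < s.reg rNum,
    (s'.arr aLive (s.reg rNum + (s.reg rNum * x + y)) ≠ 0 ↔ D x y ∧ x < y ∧
      s.arr aAdj (s.reg rNum * x + y) + s.arr aAdj (s.reg rNum * y + x) ≠ 0)
  low : ∀ p < s.reg rNum, s'.arr aLive p = s.arr aLive p

theorem code_inj {n x y x' y' : ℕ} (hy : y < n) (hy' : y' < n) :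
    n + (n * x + y) = n + (n * x' + y') ↔ x = x' ∧ y = y' := by
  constructor
  · intro h
    rw [Nat.add_left_cancel_iff] at h
    have h1 : x = x' := by
      have := congrArg (· / n) h
      simpa only [Nat.mul_add_div (Nat.zero_lt_of_lt hy), Nat.div_eq_of_lt hy,
        Nat.div_eq_of_lt hy', Nat.add_zero] using this
    subst h1
    exact ⟨rfl, by omega⟩
  · rintro ⟨rfl, rfl⟩; rfl

theorem edgeBody_ok {s s' : Store} {D : ℕ → ℕ → Prop} {i j : ℕ} (hi : i < s.reg rNum)
    (hj : j < s.reg rNum) (hoff : ∀ u < s.reg rNum, s.arr aOff u = s.reg rNum * u)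
    (hf : Frame edgeProg s s') (hri : s'.reg rI = i) (hrj : s'.reg rJ = j)
    (h : EdgeInv s D s') :
    Ok edgeBody s' 100 fun s'' => EdgeInv s (fun x y => D x y ∨ (x = i ∧ y = j)) s'' := by
  have e0 : s'.reg rNum = s.reg rNum := hf.reg _ rfl
  have e1 : s'.reg rBud = s.reg rBud := hf.reg _ rfl
  have e2 : s'.arr aWt = s.arr aWt := hf.arr _ rfl
  have e3 : s'.arr aCap = s.arr aCap := hf.arr _ rfl
  have e4 : s'.arr aOff = s.arr aOff := hf.arr _ rfl
  have e5 : s'.arr aAdj = s.arr aAdj := hf.arr _ rfl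
  set n := s.reg rNum with hn
  refine (Ok.setReg_seq <| Ok.setReg_seq <| Ok.setReg_seq <| Ok.setArr_seq <| Ok.setArr_seq <|
    Ok.setArr_seq <| Ok.setArr_seq <| Ok.setArr_seq <| Ok.setArr_seq <| Ok.setArr_seq <|
    Ok.seq (T₁ := 20) (T₂ := 20) (R := fun s'' =>
      s''.arr aA = Function.update (s'.arr aA) (n + (n * i + j)) i ∧
      s''.arr aB = Function.update (s'.arr aB) (n + (n * i + j)) j ∧
      s''.arr aWf = Function.update (s'.arr aWf) (n + (n * i + j)) (s.arr aWt (n * i + j)) ∧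
      s''.arr aWb = Function.update (s'.arr aWb) (n + (n * i + j)) (s.arr aWt (n * j + i)) ∧
      s''.arr aCf = Function.update (s'.arr aCf) (n + (n * i + j)) (s.arr aCap (n * i + j)) ∧
      s''.arr aCb = Function.update (s'.arr aCb) (n + (n * i + j)) (s.arr aCap (n * j + i)) ∧
      s''.arr aW0 = Function.update (s'.arr aW0) (n + (n * i + j))
        (if s.arr aCap (n * i + j) ≠ 0 ∧ s.arr aCap (n * j + i) ≠ 0 then
        s.arr aWt (n * i + j) + s.arr aWt (n * j + i) else s.reg rBud + 1) ∧
      s''.arr aLive = s'.arr aLive ∧ s''.arr aAdj = s.arr aAdj ∧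
      s''.reg rTmp = n * i + j ∧ s''.reg rVtx = n * j + i ∧ s''.reg rEdge = n + (n * i + j) ∧
      s''.reg rI = i ∧ s''.reg rJ = j) ?_ ?_).le (by simp [Expr.cost])
  · have o1 := hoff i hi
    have o2 := hoff j hj
    simp only [Store.setReg, Store.setArr, Expr.eval]
    simp [hri, hrj, e0, e1, e2, e3, e4, o1, o2]
    refine (Ok.ite (T₁ := 12) (T₂ := 1) (fun h1 => (Ok.ite (T₁ := 7) (T₂ := 1) (fun h2 =>
      (Ok.setArr ?_).le (by simp [Expr.cost])) fun h2 => Ok.skip ?_).le (by simp [Expr.cost]))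
      fun h1 => Ok.skip ?_).le (by simp [Expr.cost])
    all_goals
      simp [Expr.eval, e3] at h1
      try simp [Expr.eval, e3] at h2
    · simp [Store.setArr, Expr.eval, h1, h2, e2, e5, hri, hrj]
    · simp [h1, h2, e5, hri, hrj]
    · simp [h1, e5, hri, hrj]
  · rintro s₁ - ⟨a1, a2, a3, a4, a5, a6, a7, a8, a9, r1, r2, r3, r4, r5⟩
    have main : ∀ s₂ : Store, (∀ a, a ≠ aLive → s₂.arr a = s₁.arr a) →
        ((s₂.arr aLive = Function.update (s'.arr aLive) (n + (n * i + j)) 1 ∧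
          (i < j ∧ s.arr aAdj (n * i + j) + s.arr aAdj (n * j + i) ≠ 0)) ∨
        (s₂.arr aLive = s'.arr aLive ∧
          ¬ (i < j ∧ s.arr aAdj (n * i + j) + s.arr aAdj (n * j + i) ≠ 0))) →
        EdgeInv s (fun x y => D x y ∨ (x = i ∧ y = j)) s₂ := by
      intro s₂ hother hlive
      refine ⟨fun x hx y hy hD => ?_, fun x hx y hy => ?_, fun p hp => ?_⟩
      · by_cases hxy : x = i ∧ y = j
        · obtain ⟨rfl, rfl⟩ := hxy
          constructor <;> rw [hother _ (by norm_num)] <;>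
            simp only [a1, a2, a3, a4, a5, a6, a7, Function.update_self, ← hn]
        · have hne : n + (n * x + y) ≠ n + (n * i + j) := by rwa [ne_eq, code_inj hy hj]
          obtain ⟨b1, b2, b3, b4, b5, b6, b7⟩ := h.edge x hx y hy (hD.resolve_right hxy)
          constructor <;> rw [hother _ (by norm_num)] <;>
            simp only [a1, a2, a3, a4, a5, a6, a7, ← hn, Function.update_of_ne hne] <;> assumption
      · have hl := h.live x hx y hy
        rw [← hn] at hl ⊢
        by_cases hxy : x = i ∧ y = j
        · obtain ⟨rfl, rfl⟩ := hxy
          rcases hlive with ⟨h1, h2⟩ | ⟨h1, h2⟩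
          · rw [h1, Function.update_self]
            simp [h2.1]
            have := h2.2
            omega
          · rw [h1, hl]
            constructor
            · exact fun h => absurd h.2 h2
            · exact fun h => absurd h.2 h2
        · have hne : n + (n * x + y) ≠ n + (n * i + j) := by rwa [ne_eq, code_inj hy hj]
          simp only [hxy, or_false]
          rcases hlive with ⟨h1, h2⟩ | ⟨h1, h2⟩ <;> rw [h1]
          · rw [Function.update_of_ne hne, hl]
          · exact hl
      · have := h.low p hp
        rcases hlive with ⟨h1, h2⟩ | ⟨h1, h2⟩ <;> rw [h1]
        · rw [Function.update_of_ne (by omega), this]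
        · exact this
    refine (Ok.ite (T₁ := 12) (T₂ := 1) (fun h1 => (Ok.ite (T₁ := 3) (T₂ := 1) (fun h2 =>
      (Ok.setArr ?_).le (by simp [Expr.cost])) fun h2 => Ok.skip ?_).le (by simp [Expr.cost]))
      fun h1 => Ok.skip ?_).le (by simp [Expr.cost])
    all_goals
      simp only [Expr.eval, r4, r5] at h1
      try simp only [Expr.eval, r1, r2, a9] at h2
    · refine main _ (fun a ha => by simp [Store.setArr, ha]) (Or.inl ⟨?_, by omega, h2⟩)
      simp [Store.setArr, Expr.eval, r3, a8]
    · exact main _ (fun _ _ => rfl) (Or.inr ⟨a8, fun h => h.2 h2⟩)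
    · exact main _ (fun _ _ => rfl) (Or.inr ⟨a8, fun h => by omega⟩)

theorem EdgeInv.setReg {s s' : Store} {D D' : ℕ → ℕ → Prop} (h : EdgeInv s D s') (x v : ℕ)
    (hD : ∀ x < s.reg rNum, ∀ y < s.reg rNum, (D' x y ↔ D x y)) :
    EdgeInv s D' (s'.setReg x v) := by
  refine ⟨fun x hx y hy hd => ?_, fun x hx y hy => ?_, h.low⟩
  · obtain ⟨b1, b2, b3, b4, b5, b6, b7⟩ := h.edge x hx y hy ((hD x hx y hy).1 hd)
    exact ⟨b1, b2, b3, b4, b5, b6, b7⟩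
  · rw [hD x hx y hy]
    exact h.live x hx y hy

theorem Frame.trans {p q t : Prog} {s₁ s₂ s₃ : Store} (h : Frame p s₁ s₂) (h' : Frame q s₂ s₃)
    (hr : ∀ x, t.writesReg x = false → p.writesReg x = false ∧ q.writesReg x = false)
    (ha : ∀ x, t.writesArr x = false → p.writesArr x = false ∧ q.writesArr x = false) :
    Frame t s₁ s₃ :=
  ⟨fun x hx => (h'.reg x (hr x hx).2).trans (h.reg x (hr x hx).1),
    fun x hx => (h'.arr x (ha x hx).2).trans (h.arr x (ha x hx).1)⟩

theorem edgeProg_ok {s : Store} (hoff : ∀ u < s.reg rNum, s.arr aOff u = s.reg rNum * u)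
    (hl : ∀ p, s.reg rNum ≤ p → s.arr aLive p = 0) :
    Ok edgeProg s (20 + s.reg rNum * (30 + s.reg rNum * 110)) fun s' =>
      EdgeInv s (fun _ _ => True) s' := by
  have hloop := Ok.forLoop (x := rI) (y := rNum) (lo := lit 0)
    (p := forLoop rJ (lit 0) rNum edgeBody)
    (T := 20 + s.reg rNum * 110) (s := s) (a := 0) (b := s.reg rNum)
    (fun i s' => EdgeInv s (fun x _ => x < i) s')
    (by norm_num) rfl rfl rfl rfl (Nat.zero_le _) ?_ ?_
  · refine hloop.mono ?_ ?_
    · simp only [Expr.cost, Nat.sub_zero]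
      have : 20 + s.reg rNum * 110 + 8 ≤ 30 + s.reg rNum * 110 := by omega
      have := Nat.mul_le_mul_left (s.reg rNum) this
      omega
    · rintro s' f ⟨h, -⟩
      exact ⟨fun x hx y hy _ => h.edge x hx y hy hx, fun x hx y hy => by
        simpa [hx] using h.live x hx y hy, h.low⟩
  · refine ⟨fun x hx y hy h => absurd h (by omega), fun x hx y hy => ?_, fun p hp => rfl⟩
    simpa [Store.setReg] using hl _ (by omega)
  · intro i s' _ hi hI hreg hf
    have e0 : s'.reg rNum = s.reg rNum := hf.reg _ rfl
    have hinner := Ok.forLoop (x := rJ) (y := rNum) (lo := lit 0) (p := edgeBody)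
      (T := 100) (s := s') (a := 0) (b := s.reg rNum)
      (fun j s'' => EdgeInv s (fun x y => x < i ∨ (x = i ∧ y < j)) s'')
      (by norm_num) rfl rfl rfl e0 (Nat.zero_le _) ?_ ?_
    · refine hinner.mono (by simp only [Expr.cost, Nat.sub_zero]; omega) ?_
      rintro s'' f ⟨h, -⟩
      refine h.setReg _ _ fun x hx y hy => ?_
      omega
    · refine hI.setReg _ _ fun x hx y hy => ?_
      omega
    · intro j s'' _ hj hJ hregj hf'
      have hff : Frame edgeProg s s'' := hf.trans hf'
        (fun x hx => ⟨hx, by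
          simp only [edgeProg, forLoop, Prog.writesReg, Bool.or_eq_false_iff] at hx ⊢
          exact hx.2.1⟩)
        (fun x hx => ⟨hx, by
          simp only [edgeProg, forLoop, Prog.writesArr, Bool.or_eq_false_iff] at hx ⊢
          exact hx.2.1⟩)
      have hri : s''.reg rI = i := (hf'.reg _ rfl).trans hreg
      refine (edgeBody_ok hi hj hoff hff hri hregj hJ).mono le_rfl fun s₃ _ h₃ => ?_
      refine h₃.setReg _ _ fun x hx y hy => ?_
      omega

/-- Build the network of the instance. -/
def initProg : Prog := offProg ;; vertProg ;; edgeProg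

theorem matrixArray_apply {n : ℕ} (f : Fin n → Fin n → ℕ) (x y : Fin n) :
    matrixArray f (n * x + y) = f x y := by
  have hlt : n * (x : ℕ) + y < n * n := by
    calc n * (x : ℕ) + y < n * x + n := by have := y.2; omega
      _ = n * (x + 1) := by ring
      _ ≤ n * n := Nat.mul_le_mul_left _ x.2
  rw [matrixArray, dif_pos hlt]
  congr 1
  · ext
    simp [Fin.coe_divNat, Nat.mul_add_div x.pos, Nat.div_eq_of_lt y.2]
  · ext
    simp [Fin.coe_modNat, Nat.mod_eq_of_lt y.2]

theorem initProg_ok (I : Instance) (hW : I.W.Nonempty) :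
    Ok initProg I.input (200 + I.n * (200 + I.n * 110)) fun s =>
      IsNetOf (netOf s) I ∧ s.reg rNum = I.n ∧ s.reg rBud = I.budget ∧
        s.reg rTot = I.n * I.n + I.n ∧ ∃ r : Fin I.n, r ∈ I.W ∧ s.reg rRoot = r := by
  classical
  have hn : I.input.reg rNum = I.n := rfl
  have hb : I.input.reg rBud = I.budget := rfl
  have hway : ∀ v : Fin I.n, I.input.arr aWay v = if v ∈ I.W then 1 else 0 := fun v => by
    simp only [Instance.input, vectorArray, v.2, dif_pos]
  have hadj : ∀ x y : Fin I.n, I.input.arr aAdj (I.n * x + y) = if I.G.Adj x y then 1 else 0 :=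
    fun x y => by
      simp only [Instance.input]
      refine (matrixArray_apply _ x y).trans ?_
      congr!
  have hwt : ∀ x y : Fin I.n, I.input.arr aWt (I.n * x + y) = I.w x y :=
    fun x y => by simp only [Instance.input]; exact matrixArray_apply _ x y
  have hcap : ∀ x y : Fin I.n, I.input.arr aCap (I.n * x + y) = I.c x y :=
    fun x y => by simp only [Instance.input]; exact matrixArray_apply _ x y
  have hz : ∀ a, 4 ≤ a → ∀ p, I.input.arr a p = 0 := fun a ha p => by
    simp only [Instance.input]
    split <;> first | omega | rfl
  refine (Ok.seq (offProg_ok I.input) fun s₁ f₁ h₁ => Ok.seq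
    ((vertProg_ok (s := s₁) ?_ ?_).le (T' := 30 + I.n * 30) ?_)
      (T₂ := 20 + I.n * (30 + I.n * 110)) fun s₂ f₂ h₂ =>
      (edgeProg_ok (s := s₂) ?_ ?_).mono ?_
    fun s₃ f₃ h₃ => ?_).le ?_
  · exact fun p => by rw [f₁.arr _ rfl]; exact hz _ (by norm_num) p
  · exact fun p => by rw [f₁.arr _ rfl]; exact hz _ (by norm_num) p
  · rw [f₁.reg _ rfl, hn]
  · intro u hu
    rw [f₂.reg _ rfl, f₁.reg _ rfl] at hu ⊢
    rw [f₂.arr _ rfl]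
    exact h₁.2 u hu
  · intro p hp
    rw [f₂.reg _ rfl] at hp
    rw [h₂.1, if_neg (by omega)]
  · rw [f₂.reg _ rfl, f₁.reg _ rfl, hn]
  · have n₁ : s₁.reg rNum = I.n := f₁.reg _ rfl
    have n₂ : s₂.reg rNum = I.n := (f₂.reg _ rfl).trans n₁
    have n₃ : s₃.reg rNum = I.n := (f₃.reg _ rfl).trans n₂
    have b₁ : s₁.reg rBud = I.budget := f₁.reg _ rfl
    have b₂ : s₂.reg rBud = I.budget := (f₂.reg _ rfl).trans b₁
    have w₁ : s₁.arr aWay = I.input.arr aWay := f₁.arr _ rfl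
    have t₃ : s₃.reg rTot = I.n * I.n + I.n :=
      (f₃.reg _ rfl).trans ((f₂.reg _ rfl).trans h₁.1)
    have a₂ : ∀ a, a ∈ Finset.Icc aWay aCap → s₂.arr a = I.input.arr a := fun a ha => by
      rw [f₂.arr _ (by revert a; decide), f₁.arr _ (by revert a; decide)]
    have c₃ : ∀ v, s₃.arr aC1 v = 0 := fun v => by
      rw [f₃.arr _ rfl, f₂.arr _ rfl, f₁.arr _ rfl]
      exact hz _ (by norm_num) v
    have z₃ : ∀ a, a ∈ Finset.Icc aGa aN11 → ∀ p, s₃.arr a p = 0 := fun a ha p => by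
      rw [f₃.arr _ (by revert a; decide), f₂.arr _ (by revert a; decide),
        f₁.arr _ (by revert a; decide)]
      exact hz _ (by simp at ha; omega) p
    have hlive : ∀ x y : Fin I.n, s₃.arr aLive (I.code (x, y)) ≠ 0 ↔ I.IsPair (x, y) := by
      intro x y
      have := h₃.live x (by rw [n₂]; exact x.2) y (by rw [n₂]; exact y.2)
      rw [n₂, a₂ aAdj (by decide), hadj, hadj] at this
      refine this.trans ?_
      unfold Instance.IsPair
      rw [← Fin.lt_def]
      split_ifs with k1 k2 k2 <;> simp [k1, k2]
    have hcode : ∀ e, I.n ≤ e → e < I.n * I.n + I.n → ∃ p, I.code p = e := by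
      intro e h1 h2
      have hpos : 0 < I.n := Nat.pos_of_ne_zero fun h => by rw [h] at h2; omega
      have h3 : (e - I.n) / I.n < I.n := Nat.div_lt_of_lt_mul (by omega)
      refine ⟨(⟨_, h3⟩, ⟨(e - I.n) % I.n, Nat.mod_lt _ hpos⟩), ?_⟩
      simp only [Instance.code, Nat.div_add_mod]
      omega
    have hlt : ∀ p, I.code p < I.n * I.n + I.n := by
      rintro ⟨x, y⟩
      have : I.n * (x : ℕ) + I.n ≤ I.n * I.n := by
        rw [← Nat.mul_succ]; exact Nat.mul_le_mul_left _ x.2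
      have := y.2
      simp only [Instance.code]
      omega
    refine ⟨⟨?_, ?_, ?_, ?_, ?_⟩, n₃, (f₃.reg _ rfl).trans b₂, t₃, ?_⟩
    · ext v
      rw [mem_netOf_V, n₃, Finset.mem_range, and_iff_left_iff_imp]
      intro hv
      rw [h₃.low v (by rwa [n₂]), h₂.1, n₁, if_pos hv]
      exact one_ne_zero
    · ext e
      rw [mem_netOf_E, n₃, t₃]
      simp only [Finset.mem_image, Finset.mem_filter, Finset.mem_univ, true_and]
      constructor
      · rintro ⟨⟨h1, h2⟩, h3⟩
        obtain ⟨p, rfl⟩ := hcode e h1 h2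
        exact ⟨p, (hlive p.1 p.2).1 h3, rfl⟩
      · rintro ⟨p, hp, rfl⟩
        exact ⟨⟨Nat.le_add_right _ _, hlt p⟩, (hlive p.1 p.2).2 hp⟩
    · rintro ⟨x, y⟩ hp
      obtain ⟨i1, i2, i3, i4, i5, i6, i7⟩ :=
        h₃.edge x (by rw [n₂]; exact x.2) y (by rw [n₂]; exact y.2) trivial
      simp only [n₂, b₂, a₂ aWt (by decide), a₂ aCap (by decide), hwt, hcap] at i1 i2 i3 i4 i5 i6 i7
      simp only [netOf, Instance.edge, Instance.code, i1, i2, i3, i4, i5, i6, i7,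
        z₃ aGa (by decide), z₃ aN00 (by decide), z₃ aN01 (by decide), z₃ aN10 (by decide),
        z₃ aN11 (by decide)]
    · intro v
      have : s₃.arr aC0 = s₂.arr aC0 := f₃.arr _ rfl
      simp only [netOf, this]
      rw [h₂.2.1 v (by rw [n₁]; exact v.2), w₁, hway, b₁]
      by_cases hv : v ∈ I.W <;> simp [hv]
    · exact fun v => c₃ v
    · obtain ⟨v, hv⟩ := hW
      obtain ⟨j1, j2⟩ := h₂.2.2
        ⟨v, by rw [n₁]; exact v.2, by rw [w₁, hway, if_pos hv]; exact one_ne_zero⟩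
      rw [n₁] at j1
      rw [w₁] at j2
      have := hway ⟨_, j1⟩
      refine ⟨⟨_, j1⟩, ?_, f₃.reg _ rfl⟩
      by_contra hc
      rw [if_neg hc] at this
      exact j2 this
  · rw [hn]
    have : I.n * (200 + I.n * 110) = I.n * 20 + I.n * 30 + I.n * 120 + I.n * (30 + I.n * 110) := by
      ring
    omega

/-! ### Counting the vertices and the edges -/

/-- Compute the base `|V| + 2|E| + 2` of the numeral system and the digit `|E| + 1` that stands for
flow zero. -/
def countProg : Prog :=
  setReg rBase (lit 2) ;; setReg rMid (lit 1) ;;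
    forLoop rI (lit 0) rNum (ite (get aLive (reg rI)) (setReg rBase (reg rBase ⊹ lit 1)) skip) ;;
    forLoop rI (reg rNum) rTot (ite (get aLive (reg rI))
      (setReg rBase (reg rBase ⊹ lit 2) ;; setReg rMid (reg rMid ⊹ lit 1)) skip)

theorem sum_netOf_V (s : Store) (f : ℕ → ℕ) :
    ∑ v ∈ Finset.Ico 0 (s.reg rNum), (if v ∈ (netOf s).V then f v else 0) =
      ∑ v ∈ (netOf s).V, f v := by
  rw [Finset.sum_ite_mem, Finset.inter_eq_right.2]
  intro v hv
  exact Finset.mem_Ico.2 ⟨Nat.zero_le _, (mem_netOf_V.1 hv).1⟩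

theorem sum_netOf_E (s : Store) (f : ℕ → ℕ) :
    ∑ e ∈ Finset.Ico (s.reg rNum) (s.reg rTot), (if e ∈ (netOf s).E then f e else 0) =
      ∑ e ∈ (netOf s).E, f e := by
  rw [Finset.sum_ite_mem, Finset.inter_eq_right.2]
  intro v hv
  exact Finset.mem_Ico.2 (mem_netOf_E.1 hv).1

theorem mem_netOf_V_of_lt {s : Store} {v : ℕ} (hv : v < s.reg rNum) :
    v ∈ (netOf s).V ↔ s.arr aLive v ≠ 0 := by
  rw [mem_netOf_V, and_iff_right hv]

theorem mem_netOf_E_of_le_lt {s : Store} {e : ℕ} (h : s.reg rNum ≤ e) (h' : e < s.reg rTot) :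
    e ∈ (netOf s).E ↔ s.arr aLive e ≠ 0 := by
  rw [mem_netOf_E, and_iff_right ⟨h, h'⟩]

theorem countProg_ok {s : Store} (hnt : s.reg rNum ≤ s.reg rTot) :
    Ok countProg s (30 + s.reg rTot * 30) fun s' =>
      s'.reg rBase = (netOf s).V.card + 2 * (netOf s).E.card + 2 ∧
      s'.reg rMid = (netOf s).E.card + 1 := by
  have hV := Ok.forLoop (x := rI) (y := rNum) (lo := lit 0)
    (p := ite (get aLive (reg rI)) (setReg rBase (reg rBase ⊹ lit 1)) skip) (T := 10)
    (s := (s.setReg rBase 2).setReg rMid 1) (a := 0) (b := s.reg rNum)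
    (fun i s' => s'.reg rMid = 1 ∧
      s'.reg rBase = 2 + ∑ v ∈ Finset.Ico 0 i, if v ∈ (netOf s).V then 1 else 0)
    (by norm_num) rfl rfl rfl rfl (Nat.zero_le _) (by simp [Store.setReg]) ?_
  · refine (Ok.setReg_seq <| Ok.setReg_seq <| Ok.seq (T₂ := 10 + (s.reg rTot - s.reg rNum) * 20) hV
      fun s₁ f₁ h₁ => ?_).le ?_
    · have e1 : s₁.reg rNum = s.reg rNum := f₁.reg _ rfl
      have e2 : s₁.reg rTot = s.reg rTot := f₁.reg _ rfl
      have e3 : s₁.arr aLive = s.arr aLive := f₁.arr _ rfl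
      refine (Ok.forLoop (x := rI) (y := rTot) (lo := reg rNum) (T := 12) (s := s₁)
        (a := s.reg rNum) (b := s.reg rTot)
        (fun i s' => s'.reg rMid =
            1 + ∑ e ∈ Finset.Ico (s.reg rNum) i, (if e ∈ (netOf s).E then 1 else 0) ∧
          s'.reg rBase = 2 + (netOf s).V.card +
            2 * ∑ e ∈ Finset.Ico (s.reg rNum) i, if e ∈ (netOf s).E then 1 else 0)
        (by norm_num) rfl rfl e1 e2 hnt ?_ ?_).mono ?_ ?_
      · rw [Finset.card_eq_sum_ones, ← sum_netOf_V]
        simp only [Store.setReg]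
        simpa using h₁.1
      · intro i s' hi hi' hI hreg f
        have e4 : s'.arr aLive = s.arr aLive := (f.arr _ rfl).trans e3
        simp only [Finset.sum_Ico_succ_top hi, mem_netOf_E_of_le_lt hi hi']
        refine (Ok.ite (T₁ := 8) (T₂ := 1) (fun h => (Ok.setReg_seq <| Ok.setReg ?_).le (by
          simp [Expr.cost])) fun h => Ok.skip ?_).le (by simp [Expr.cost])
        all_goals
          simp only [Expr.eval, hreg, e4] at h
          simp [Store.setReg, Expr.eval, h, hI]
        omega
      · simp only [Expr.cost]
        omega
      · rintro s' f ⟨⟨h, h'⟩, -⟩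
        rw [sum_netOf_E, ← Finset.card_eq_sum_ones] at h h'
        omega
    · simp only [Expr.cost]
      omega
  · intro i s' hi hi' hI hreg f
    have e4 : s'.arr aLive = s.arr aLive := f.arr _ rfl
    simp only [Finset.sum_Ico_succ_top hi, mem_netOf_V_of_lt hi']
    refine (Ok.ite (T₁ := 4) (T₂ := 1) (fun h => (Ok.setReg ?_).le (by
      simp [Expr.cost])) fun h => Ok.skip ?_).le (by simp [Expr.cost])
    all_goals
      simp only [Expr.eval, hreg, e4] at h
      simp [Store.setReg, Expr.eval, h, hI]
    omega

/-! ### Checking a vector of digits -/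

/-- Account for the edge in `rJ` if its end stored in the array `a` is the vertex in `rI`. -/
def scanEnd (a b x y : ℕ) : Prog :=
  ite (Expr.ne (get a (reg rJ)) (reg rI)) skip
    (setReg x (reg x ⊹ (get aDig (reg rJ) ∸ reg rMid)) ;;
      setReg y (reg y ⊹ (reg rMid ∸ get aDig (reg rJ))) ;;
      setReg rPar (reg rPar ⊹ (get aDig (reg rI) ∸ get aDig (get b (reg rJ)))))

theorem scanEnd_ok (s : Store) {a b x y : ℕ}
    (hxy : x = rIn ∧ y = rOut ∨ x = rOut ∧ y = rIn) :
    Ok (scanEnd a b x y) s 40 fun s' =>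
      s'.reg x = s.reg x + (if s.arr a (s.reg rJ) = s.reg rI then
        s.arr aDig (s.reg rJ) - s.reg rMid else 0) ∧
      s'.reg y = s.reg y + (if s.arr a (s.reg rJ) = s.reg rI then
        s.reg rMid - s.arr aDig (s.reg rJ) else 0) ∧
      s'.reg rPar = s.reg rPar + (if s.arr a (s.reg rJ) = s.reg rI then
        s.arr aDig (s.reg rI) - s.arr aDig (s.arr b (s.reg rJ)) else 0) := by
  refine (Ok.ite (T₁ := 1) (T₂ := 25) (fun h => Ok.skip ?_) fun h => (Ok.setReg_seq <|
    Ok.setReg_seq <| Ok.setReg ?_).le (by simp [Expr.cost])).le (by simp [Expr.ne, Expr.cost])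
  · rw [ne_eq, Expr.eval_ne_eq_zero] at h
    simp only [Expr.eval] at h
    simp [h]
  · rw [Expr.eval_ne_eq_zero] at h
    simp only [Expr.eval] at h
    rcases hxy with ⟨rfl, rfl⟩ | ⟨rfl, rfl⟩ <;> simp [h, Store.setReg, Expr.eval]

/-- Account for the edge in `rJ` at the vertex in `rI`. -/
def scanBody : Prog :=
  ite (get aLive (reg rJ)) (ite (get aDig (reg rJ))
    (scanEnd aA aB rOut rIn ;; scanEnd aB aA rIn rOut) skip) skip

theorem scanBody_ok {s : Store} {M : ℕ} (hM : s.reg rMid = M + 1) (h1 : s.reg rNum ≤ s.reg rJ)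
    (h2 : s.reg rJ < s.reg rTot) : Ok scanBody s 100 fun s' =>
      s'.reg rIn = s.reg rIn + (if s.reg rJ ∈ (netOf s).E then
        (netOf s).inTerm M (s.arr aDig) (s.reg rI) (s.reg rJ) else 0) ∧
      s'.reg rOut = s.reg rOut + (if s.reg rJ ∈ (netOf s).E then
        (netOf s).outTerm M (s.arr aDig) (s.reg rI) (s.reg rJ) else 0) ∧
      s'.reg rPar = s.reg rPar + (if s.reg rJ ∈ (netOf s).E then
        (netOf s).parTerm (s.arr aDig) (s.reg rI) (s.reg rJ) else 0) := by
  simp only [mem_netOf_E_of_le_lt h1 h2]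
  refine (Ok.ite (T₁ := 85) (T₂ := 1) (fun h => (Ok.ite (T₁ := 80) (T₂ := 1) (fun h' =>
    Ok.seq (T₁ := 40) (T₂ := 40) (scanEnd_ok s (by simp)) fun s₁ f₁ h₁ =>
      (scanEnd_ok s₁ (by simp)).mono le_rfl fun s₂ f₂ h₂ => ?_)
    fun h' => Ok.skip ?_).le (by simp [Expr.cost])) fun h => Ok.skip ?_).le (by simp [Expr.cost])
  all_goals
    simp only [Expr.eval] at h
    try simp only [Expr.eval] at h'
  · obtain ⟨i1, i2, i3⟩ := h₁
    obtain ⟨j1, j2, j3⟩ := h₂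
    have e1 : s₁.reg rJ = s.reg rJ := f₁.reg _ rfl
    have e2 : s₁.reg rI = s.reg rI := f₁.reg _ rfl
    have e3 : s₁.reg rMid = s.reg rMid := f₁.reg _ rfl
    have e4 : s₁.arr aDig = s.arr aDig := f₁.arr _ rfl
    have e5 : s₁.arr aA = s.arr aA := f₁.arr _ rfl
    have e6 : s₁.arr aB = s.arr aB := f₁.arr _ rfl
    rw [e1, e2, e3, e4, e6] at j1 j2
    rw [e1, e2, e4, e5, e6] at j3
    rw [j1, j2, j3, i1, i2, i3, if_pos h, if_pos h, if_pos h, Net.inTerm, Net.outTerm, Net.parTerm,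
      if_neg h', if_neg h', if_neg h', hM]
    simp only [netOf]
    exact ⟨add_assoc _ _ _, add_assoc _ _ _, add_assoc _ _ _⟩
  · simp [h, h', Net.inTerm, Net.outTerm, Net.parTerm]
  · simp [h]

/-- Check the vertex in `rI`, and add its price. -/
def vertexBody : Prog :=
  ite (get aLive (reg rI))
    (setReg rIn (lit 0) ;; setReg rOut (lit 0) ;; setReg rPar (lit 0) ;;
      forLoop rJ (reg rNum) rTot scanBody ;;
      setReg rBad (reg rBad ⊹ Expr.ne (reg rIn) (reg rOut)) ;;
      ite (get aDig (reg rI))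
        (setReg rCost (reg rCost ⊹ get aC1 (reg rI)) ;;
          ite (Expr.ne (reg rI) (reg rRoot)) (ite (reg rPar) skip (setReg rBad (lit 1))) skip)
        (setReg rCost (reg rCost ⊹ get aC0 (reg rI))))
    skip

theorem scanLoop_ok {s : Store} {M : ℕ} (hM : s.reg rMid = M + 1) (hnt : s.reg rNum ≤ s.reg rTot)
    (hi : s.reg rIn = 0) (ho : s.reg rOut = 0) (hp : s.reg rPar = 0) :
    Ok (forLoop rJ (reg rNum) rTot scanBody) s (6 + (s.reg rTot - s.reg rNum) * 108) fun s' =>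
      s'.reg rIn = ∑ e ∈ (netOf s).E, (netOf s).inTerm M (s.arr aDig) (s.reg rI) e ∧
      s'.reg rOut = ∑ e ∈ (netOf s).E, (netOf s).outTerm M (s.arr aDig) (s.reg rI) e ∧
      s'.reg rPar = ∑ e ∈ (netOf s).E, (netOf s).parTerm (s.arr aDig) (s.reg rI) e := by
  simp only [← sum_netOf_E]
  refine (Ok.forLoop (x := rJ) (y := rTot) (lo := reg rNum) (p := scanBody) (T := 100) (s := s)
    (a := s.reg rNum) (b := s.reg rTot) (fun i s' =>
      s'.reg rIn = ∑ e ∈ Finset.Ico (s.reg rNum) i, (if e ∈ (netOf s).E then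
        (netOf s).inTerm M (s.arr aDig) (s.reg rI) e else 0) ∧
      s'.reg rOut = ∑ e ∈ Finset.Ico (s.reg rNum) i, (if e ∈ (netOf s).E then
        (netOf s).outTerm M (s.arr aDig) (s.reg rI) e else 0) ∧
      s'.reg rPar = ∑ e ∈ Finset.Ico (s.reg rNum) i, (if e ∈ (netOf s).E then
        (netOf s).parTerm (s.arr aDig) (s.reg rI) e else 0))
    (by norm_num) rfl rfl rfl rfl hnt ?_ ?_).mono ?_ fun s' _ h => h.1
  · simp [Store.setReg, hi, ho, hp]
  · intro i s' h1 h2 hI hreg f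
    have e1 : s'.reg rNum = s.reg rNum := f.reg _ rfl
    have e2 : s'.reg rTot = s.reg rTot := f.reg _ rfl
    have e3 : s'.reg rMid = s.reg rMid := f.reg _ rfl
    have e4 : s'.reg rI = s.reg rI := f.reg _ rfl
    have e5 : s'.arr aDig = s.arr aDig := f.arr _ rfl
    have e6 : netOf s' = netOf s := f.netOf_eq (by decide)
    refine (scanBody_ok (s := s') (e3.trans hM) (by omega) (by omega)).mono le_rfl fun s'' _ h => ?_
    rw [e4, e5, e6, hreg, hI.1, hI.2.1, hI.2.2] at h
    simp only [Finset.sum_Ico_succ_top h1]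
    exact h
  · simp only [Expr.cost]
    omega

theorem vertexBody_ok {s : Store} {M : ℕ} (hM : s.reg rMid = M + 1)
    (hnt : s.reg rNum ≤ s.reg rTot) (hi : s.reg rI < s.reg rNum) :
    Ok vertexBody s (100 + (s.reg rTot - s.reg rNum) * 108) fun s' =>
      (s'.reg rBad = 0 ↔ s.reg rBad = 0 ∧ (s.reg rI ∈ (netOf s).V →
        (netOf s).VertexOk (s.reg rRoot) M (s.arr aDig) (s.reg rI))) ∧
      s'.reg rCost = s.reg rCost + (if s.reg rI ∈ (netOf s).V then
        (netOf s).vcost (s.arr aDig) (s.reg rI) else 0) := by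
  simp only [mem_netOf_V_of_lt hi]
  refine (Ok.ite (T₁ := 80 + (s.reg rTot - s.reg rNum) * 108) (T₂ := 1) (fun hl => ?_)
    fun hl => Ok.skip ?_).le (by simp only [Expr.cost]; omega)
  all_goals simp only [Expr.eval] at hl
  · refine (Ok.setReg_seq <| Ok.setReg_seq <| Ok.setReg_seq <| Ok.seq (T₂ := 50)
      (scanLoop_ok (M := M) (by exact hM) (by exact hnt) (by rfl) (by rfl) (by rfl))
      fun s₁ f₁ h₁ => ?_).le ?_
    · have e1 : s₁.reg rI = s.reg rI := f₁.reg _ rfl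
      have e2 : s₁.reg rBad = s.reg rBad := f₁.reg _ rfl
      have e3 : s₁.reg rCost = s.reg rCost := f₁.reg _ rfl
      have e4 : s₁.reg rRoot = s.reg rRoot := f₁.reg _ rfl
      have e5 : s₁.arr aDig = s.arr aDig := f₁.arr _ rfl
      have e6 : s₁.arr aC0 = s.arr aC0 := f₁.arr _ rfl
      have e7 : s₁.arr aC1 = s.arr aC1 := f₁.arr _ rfl
      obtain ⟨i1, i2, i3⟩ := h₁
      have hbal : (Expr.ne (reg rIn) (reg rOut)).eval s₁ = 0 ↔
          ∑ e ∈ (netOf s).E, (netOf s).inTerm M (s.arr aDig) (s.reg rI) e =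
          ∑ e ∈ (netOf s).E, (netOf s).outTerm M (s.arr aDig) (s.reg rI) e := by
        rw [Expr.eval_ne_eq_zero]
        simp only [Expr.eval, i1, i2]
        rfl
      change s₁.reg rPar = ∑ e ∈ (netOf s).E, (netOf s).parTerm (s.arr aDig) (s.reg rI) e at i3
      simp only [Net.VertexOk, Net.vcost, hl, not_false_eq_true, forall_const, ne_eq, ← i3]
      have e8 : (netOf s).c0 = s.arr aC0 := rfl
      have e9 : (netOf s).c1 = s.arr aC1 := rfl
      refine (Ok.setReg_seq (Ok.ite (T₁ := 25) (T₂ := 5) (fun hd => (Ok.setReg_seq (T := 17) <|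
        Ok.le (Ok.ite (T₁ := 5) (T₂ := 1) (fun hr =>
          (Ok.ite (T₁ := 1) (T₂ := 2) (fun hp => Ok.skip ?_)
          fun hp => Ok.setReg ?_).le (by simp [Expr.cost])) fun hr => Ok.skip ?_)
          (by simp [Expr.ne, Expr.cost])).le
          (by simp [Expr.cost])) fun hd =>
        (Ok.setReg ?_).le (by simp [Expr.cost]))).le (by simp [Expr.ne, Expr.cost])
      all_goals
        simp [Expr.eval, Store.setReg, e1, e5] at hd
        try simp only [ne_eq, Expr.eval_ne_eq_zero] at hr
        try simp [Expr.eval, Store.setReg, e1, e4] at hr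
        try simp [Expr.eval, Store.setReg] at hp
      · simp [Store.setReg, Expr.eval, hbal, hd, hr, hp, e1, e2, e3, e7, e9]
      · simp [Store.setReg, Expr.eval, hd, hr, hp, e1, e3, e7, e9]
      · rw [hr] at hd
        simp [Store.setReg, Expr.eval, hbal, hd, hr, e1, e2, e3, e7, e9]
      · simp [Store.setReg, Expr.eval, hbal, hd, e1, e2, e3, e6, e8]
    · simp only [Expr.cost, Store.setReg]
      simp
      omega
  · simp [hl]

/-- Add to the cost the value of `e` times the entry of the array `a` for the edge in `rI`. -/
def mulProg (a : ℕ) (e : Expr) : Prog :=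
  setReg rLim e ;; forLoop rK (lit 0) rLim (setReg rCost (reg rCost ⊹ get a (reg rI)))

theorem mulProg_ok (s : Store) (a : ℕ) (e : Expr) :
    Ok (mulProg a e) s (e.cost + 10 + e.eval s * 13) fun s' =>
      s'.reg rCost = s.reg rCost + e.eval s * s.arr a (s.reg rI) := by
  have hloop := Ok.forLoop (x := rK) (y := rLim) (lo := lit 0)
    (p := setReg rCost (reg rCost ⊹ get a (reg rI))) (T := 5) (s := s.setReg rLim (e.eval s))
    (a := 0) (b := e.eval s) (fun i s' => s'.reg rCost = s.reg rCost + i * s.arr a (s.reg rI))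
    (by norm_num) rfl rfl rfl rfl (Nat.zero_le _) (by simp [Store.setReg]) ?_
  · refine (Ok.setReg_seq (hloop.mono le_rfl fun s' _ h => h.1)).le ?_
    simp only [Expr.cost]
    omega
  · intro i s' _ hi hI hreg f
    have e1 : s'.reg rI = s.reg rI := f.reg _ rfl
    have e2 : s'.arr a = s.arr a := f.arr _ rfl
    refine (Ok.setReg ?_).le (by simp [Expr.cost])
    simp [Store.setReg, Expr.eval, hI, e1, e2]
    ring

/-- Add the price of the edge in `rI`. -/
def priceProg : Prog :=
  ite (get aDig (reg rI))
    (ite (Expr.ne (get aDig (reg rI)) (reg rMid))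
      (setReg rCost (reg rCost ⊹ get aGa (reg rI)) ;; mulProg aWf (get aDig (reg rI) ∸ reg rMid) ;;
        mulProg aWb (reg rMid ∸ get aDig (reg rI)))
      (setReg rCost (reg rCost ⊹ get aW0 (reg rI))))
    (ite (get aDig (get aA (reg rI)))
      (ite (get aDig (get aB (reg rI))) (setReg rCost (reg rCost ⊹ get aN11 (reg rI)))
        (setReg rCost (reg rCost ⊹ get aN10 (reg rI))))
      (ite (get aDig (get aB (reg rI))) (setReg rCost (reg rCost ⊹ get aN01 (reg rI)))
        (setReg rCost (reg rCost ⊹ get aN00 (reg rI)))))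

theorem priceProg_ok {s : Store} {M D : ℕ} (hM : s.reg rMid = M + 1) (hMD : M + 1 ≤ D)
    (hD : s.arr aDig (s.reg rI) ≤ D) :
    Ok priceProg s (120 + D * 26) fun s' => s'.reg rCost = s.reg rCost +
      (netOf s).digitCost M (s.arr aDig) (s.reg rI) := by
  refine (Ok.ite (T₁ := 70 + D * 26) (T₂ := 40) (fun h1 => (Ok.ite (T₁ := 50 + D * 26) (T₂ := 5)
    (fun h2 => ?_) fun h2 => (Ok.setReg ?_).le (by simp [Expr.cost])).le
      (by simp [Expr.ne, Expr.cost]; omega))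
    fun h1 => (Ok.ite (T₁ := 14) (T₂ := 14)
      (fun h2 => (Ok.ite (T₁ := 5) (T₂ := 5) (fun h3 => (Ok.setReg ?_).le (by simp [Expr.cost]))
        fun h3 => (Ok.setReg ?_).le (by simp [Expr.cost])).le (by simp [Expr.cost]))
      fun h2 => (Ok.ite (T₁ := 5) (T₂ := 5) (fun h3 => (Ok.setReg ?_).le (by simp [Expr.cost]))
        fun h3 => (Ok.setReg ?_).le (by simp [Expr.cost])).le (by simp [Expr.cost])).le
      (by simp [Expr.cost])).le (by simp [Expr.cost]; omega)
  · rw [ne_eq, Expr.eval_ne_eq_zero] at h2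
    simp only [Expr.eval, hM] at h1 h2
    refine (Ok.setReg_seq <| Ok.seq (T₂ := 20 + D * 13) (mulProg_ok _ _ _) fun s₁ f₁ h₁ =>
      (mulProg_ok s₁ _ _).mono ?_ fun s₂ f₂ h₂ => ?_).le ?_
    · have e1 : s₁.reg rMid = s.reg rMid := f₁.reg _ rfl
      simp only [Expr.eval, Expr.cost, e1, hM]
      omega
    · have e1 : s₁.reg rMid = s.reg rMid := f₁.reg _ rfl
      have e2 : s₁.reg rI = s.reg rI := f₁.reg _ rfl
      have e3 : s₁.arr aDig = s.arr aDig := f₁.arr _ rfl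
      have e4 : s₁.arr aWb = s.arr aWb := f₁.arr _ rfl
      rw [h₂, h₁, Net.digitCost, if_neg h1, if_neg h2]
      simp [Expr.eval, e1, e2, e3, e4, hM, Store.setReg, netOf]
      ring
    · simp [Expr.eval, Expr.cost, Store.setReg]
      omega
  · rw [Expr.eval_ne_eq_zero] at h2
    simp only [Expr.eval, hM] at h1 h2
    simp [Store.setReg, Expr.eval, Net.digitCost, h2, netOf]
  all_goals
    simp only [Expr.eval] at h1 h2 h3
    simp [Store.setReg, Expr.eval, Net.digitCost, h1, netOf, Edge.idle, h2, h3]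

/-- Check the edge in `rI`. -/
def demandProg : Prog :=
  ite (get aDig (reg rI))
    (ite (get aDig (get aA (reg rI))) skip (setReg rBad (lit 1)) ;;
      ite (get aDig (get aB (reg rI))) skip (setReg rBad (lit 1)) ;;
      setReg rBad (reg rBad ⊹ ((get aDig (reg rI) ∸ (reg rMid ⊹ get aCf (reg rI))) ⊹
        (reg rMid ∸ (get aDig (reg rI) ⊹ get aCb (reg rI))))))
    skip

theorem flag_ok (s : Store) (e : Expr) : Ok (ite e skip (setReg rBad (lit 1))) s (e.cost + 4)
    fun s' => (s'.reg rBad = 0 ↔ s.reg rBad = 0 ∧ e.eval s ≠ 0) := by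
  refine (Ok.ite (T₁ := 1) (T₂ := 2) (fun h => Ok.skip ?_) fun h => Ok.setReg ?_).le (by omega)
  · simp [h]
  · simp [h, Store.setReg, Expr.eval]

theorem demandProg_ok {s : Store} {M : ℕ} (hM : s.reg rMid = M + 1) :
    Ok demandProg s 50 fun s' => (s'.reg rBad = 0 ↔ s.reg rBad = 0 ∧
      (netOf s).EdgeOk M (s.arr aDig) (s.reg rI)) := by
  refine (Ok.ite (T₁ := 40) (T₂ := 1) (fun h => (Ok.seq (flag_ok s _) fun s₁ f₁ h₁ =>
    Ok.seq (T₂ := 18) (flag_ok s₁ _) fun s₂ f₂ h₂ => (Ok.setReg ?_).le (by simp [Expr.cost])).le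
    (by simp [Expr.cost])) fun h => Ok.skip ?_).le (by simp [Expr.cost])
  all_goals simp only [Expr.eval] at h
  · have e1 : s₁.reg rI = s.reg rI := f₁.reg _ rfl
    have e2 : s₁.reg rMid = s.reg rMid := f₁.reg _ rfl
    have e3 : s₁.arr = s.arr := funext fun a => f₁.arr a rfl
    have e4 : s₂.reg rI = s.reg rI := (f₂.reg _ rfl).trans e1
    have e5 : s₂.reg rMid = s.reg rMid := (f₂.reg _ rfl).trans e2
    have e6 : s₂.arr = s.arr := (funext fun a => f₂.arr a rfl).trans e3
    simp only [Expr.eval, e1, e3] at h₁ h₂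
    rw [h₁] at h₂
    simp only [Store.setReg, Expr.eval, Function.update_self, e4, e5, e6, hM, Nat.add_eq_zero_iff,
      h₂, Nat.sub_eq_zero_iff_le, Net.EdgeOk, netOf, ne_eq, h, not_false_eq_true, forall_const,
      and_assoc]
  · simp [Net.EdgeOk, h]

/-- Decide whether the vector of digits encodes a solution; the answer is that `rBad` is zero. -/
def checkProg : Prog :=
  setReg rBad (lit 0) ;; setReg rCost (lit 0) ;;
    ite (get aDig (reg rRoot)) skip (setReg rBad (lit 1)) ;;
    forLoop rI (lit 0) rNum vertexBody ;;
    forLoop rI (reg rNum) rTot (ite (get aLive (reg rI)) (priceProg ;; demandProg) skip) ;;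
    setReg rBad (reg rBad ⊹ (reg rCost ∸ reg rBud))

theorem vertexLoop_ok {s : Store} {M : ℕ} (hM : s.reg rMid = M + 1)
    (hnt : s.reg rNum ≤ s.reg rTot) : Ok (forLoop rI (lit 0) rNum vertexBody) s
      (6 + s.reg rNum * (108 + (s.reg rTot - s.reg rNum) * 108)) fun s' =>
      (s'.reg rBad = 0 ↔ s.reg rBad = 0 ∧ ∀ v ∈ (netOf s).V,
        (netOf s).VertexOk (s.reg rRoot) M (s.arr aDig) v) ∧
      s'.reg rCost = s.reg rCost + ∑ v ∈ (netOf s).V, (netOf s).vcost (s.arr aDig) v := by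
  rw [← sum_netOf_V]
  refine (Ok.forLoop (x := rI) (y := rNum) (lo := lit 0) (p := vertexBody)
    (T := 100 + (s.reg rTot - s.reg rNum) * 108) (s := s) (a := 0) (b := s.reg rNum) (fun i s' =>
      (s'.reg rBad = 0 ↔ s.reg rBad = 0 ∧ ∀ v < i, v ∈ (netOf s).V →
        (netOf s).VertexOk (s.reg rRoot) M (s.arr aDig) v) ∧
      s'.reg rCost = s.reg rCost + ∑ v ∈ Finset.Ico 0 i, if v ∈ (netOf s).V then
        (netOf s).vcost (s.arr aDig) v else 0)
    (by norm_num) rfl rfl rfl rfl (Nat.zero_le _) ?_ ?_).mono ?_ ?_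
  · simp [Store.setReg]
  · intro i s' h1 h2 hI hreg f
    have e1 : s'.reg rNum = s.reg rNum := f.reg _ rfl
    have e2 : s'.reg rTot = s.reg rTot := f.reg _ rfl
    have e3 : s'.reg rMid = s.reg rMid := f.reg _ rfl
    have e4 : s'.reg rRoot = s.reg rRoot := f.reg _ rfl
    have e5 : s'.arr aDig = s.arr aDig := f.arr _ rfl
    have e6 : netOf s' = netOf s := f.netOf_eq (by decide)
    refine (vertexBody_ok (s := s') (e3.trans hM) (by omega) (by omega)).mono (by rw [e1, e2])
      fun s'' _ h => ?_
    rw [e4, e5, e6, hreg, hI.1, hI.2] at h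
    simp only [Finset.sum_Ico_succ_top h1]
    refine ⟨h.1.trans ?_, h.2.trans (add_assoc _ _ _)⟩
    simp only [Nat.lt_succ_iff_lt_or_eq, or_imp, forall_and, forall_eq, and_assoc]
  · exact Nat.add_le_add le_rfl (Nat.mul_le_mul_left _ (by omega))
  · rintro s' - ⟨⟨h1, h2⟩, -⟩
    refine ⟨h1.trans (and_congr_right fun _ => forall_congr' fun v => ⟨fun h hv =>
      h (mem_netOf_V.1 hv).1 hv, fun h _ hv => h hv⟩), h2⟩

theorem edgeLoop_ok {s : Store} {M D : ℕ} (hM : s.reg rMid = M + 1) (hMD : M + 1 ≤ D)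
    (hD : ∀ p, s.arr aDig p ≤ D) (hnt : s.reg rNum ≤ s.reg rTot) :
    Ok (forLoop rI (reg rNum) rTot (ite (get aLive (reg rI)) (priceProg ;; demandProg) skip)) s
      (6 + (s.reg rTot - s.reg rNum) * (200 + D * 26)) fun s' =>
      (s'.reg rBad = 0 ↔ s.reg rBad = 0 ∧ ∀ e ∈ (netOf s).E,
        (netOf s).EdgeOk M (s.arr aDig) e) ∧
      s'.reg rCost = s.reg rCost + ∑ e ∈ (netOf s).E, (netOf s).digitCost M (s.arr aDig) e := by
  rw [← sum_netOf_E]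
  refine (Ok.forLoop (x := rI) (y := rTot) (lo := reg rNum)
    (p := ite (get aLive (reg rI)) (priceProg ;; demandProg) skip)
    (T := 190 + D * 26) (s := s) (a := s.reg rNum) (b := s.reg rTot) (fun i s' =>
      (s'.reg rBad = 0 ↔ s.reg rBad = 0 ∧ ∀ e < i, e ∈ (netOf s).E →
        (netOf s).EdgeOk M (s.arr aDig) e) ∧
      s'.reg rCost = s.reg rCost + ∑ e ∈ Finset.Ico (s.reg rNum) i, if e ∈ (netOf s).E then
        (netOf s).digitCost M (s.arr aDig) e else 0)
    (by norm_num) rfl rfl rfl rfl hnt ?_ ?_).mono ?_ ?_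
  · simp only [Finset.Ico_self, Finset.sum_empty]
    refine ⟨⟨fun h => ⟨h, fun e he h => ?_⟩, fun h => h.1⟩, rfl⟩
    have := (mem_netOf_E.1 h).1
    omega
  · intro i s' h1 h2 hI hreg f
    have e1 : s'.reg rMid = s.reg rMid := f.reg _ rfl
    have e2 : s'.arr aDig = s.arr aDig := f.arr _ rfl
    have e3 : netOf s' = netOf s := f.netOf_eq (by decide)
    have e4 : s'.arr aLive = s.arr aLive := f.arr _ rfl
    simp only [Finset.sum_Ico_succ_top h1, Nat.lt_succ_iff_lt_or_eq, or_imp, forall_and, forall_eq,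
      mem_netOf_E_of_le_lt h1 h2]
    refine (Ok.ite (T₁ := 180 + D * 26) (T₂ := 1) (fun h => (Ok.seq (priceProg_ok (e1.trans hM) hMD
      (by rw [e2]; exact hD _)) fun s₁ f₁ h₁ => (demandProg_ok (s := s₁) (M := M) ?_).mono le_rfl
      fun s₂ f₂ h₂ => ?_).le (by omega)) fun h => Ok.skip ?_).le (by simp [Expr.cost]; omega)
    all_goals simp only [Expr.eval, hreg, e4] at h
    · exact (f₁.reg _ rfl).trans (e1.trans hM)
    · have g1 : s₁.reg rI = i := (f₁.reg _ rfl).trans hreg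
      have g2 : s₁.arr aDig = s.arr aDig := (f₁.arr _ rfl).trans e2
      have g3 : netOf s₁ = netOf s := (f₁.netOf_eq (by decide)).trans e3
      have g4 : s₁.reg rBad = s'.reg rBad := f₁.reg _ rfl
      have g5 : s₂.reg rCost = s₁.reg rCost := f₂.reg _ rfl
      rw [g1, g2, g3, g4, hI.1, and_assoc] at h₂
      rw [hI.2, e2, e3, hreg] at h₁
      simp [Store.setReg, g5, h₁, h₂, h, add_assoc]
    · simp [Store.setReg, h, hI]
  · exact Nat.add_le_add le_rfl (Nat.mul_le_mul_left _ (by omega))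
  · rintro s' - ⟨⟨h1, h2⟩, -⟩
    refine ⟨h1.trans (and_congr_right fun _ => forall_congr' fun v => ⟨fun h hv =>
      h (mem_netOf_E.1 hv).1.2 hv, fun h _ hv => h hv⟩), h2⟩

theorem checkProg_ok {s : Store} {M D : ℕ} (hM : s.reg rMid = M + 1) (hMD : M + 1 ≤ D)
    (hD : ∀ p, s.arr aDig p ≤ D) (hnt : s.reg rNum ≤ s.reg rTot) :
    Ok checkProg s (50 + s.reg rTot * (330 + s.reg rTot * 108 + D * 26)) fun s' =>
      (s'.reg rBad = 0 ↔ (netOf s).Encodes (s.reg rRoot) (s.reg rBud) M (s.arr aDig)) := by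
  refine (Ok.setReg_seq <| Ok.setReg_seq <| Ok.seq (flag_ok _ _) fun s₁ f₁ h₁ =>
    Ok.seq ((vertexLoop_ok (s := s₁) (M := M) (by exact (f₁.reg _ rfl).trans hM) ?_).le
      (T' := 6 + s.reg rNum * (108 + (s.reg rTot - s.reg rNum) * 108)) ?_) fun s₂ f₂ h₂ =>
    Ok.seq ((edgeLoop_ok (s := s₂) (M := M) (D := D)
      (by exact (f₂.reg _ rfl).trans ((f₁.reg _ rfl).trans hM))
      hMD ?_ ?_).le (T' := 6 + (s.reg rTot - s.reg rNum) * (200 + D * 26)) ?_) fun s₃ f₃ h₃ =>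
    Ok.setReg ?_).le ?_
  all_goals try have n₁ : s₁.reg rNum = s.reg rNum := f₁.reg _ rfl
  all_goals try have t₁ : s₁.reg rTot = s.reg rTot := f₁.reg _ rfl
  all_goals try have n₂ : s₂.reg rNum = s.reg rNum := (f₂.reg _ rfl).trans n₁
  all_goals try have t₂ : s₂.reg rTot = s.reg rTot := (f₂.reg _ rfl).trans t₁
  all_goals try have d₁ : s₁.arr aDig = s.arr aDig := f₁.arr _ rfl
  all_goals try have d₂ : s₂.arr aDig = s.arr aDig := (f₂.arr _ rfl).trans d₁
  · omega
  · rw [n₁, t₁]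
  · rwa [d₂]
  · omega
  · rw [n₂, t₂]
  · have k₁ : netOf s₁ = netOf s := f₁.netOf_eq (by decide)
    have k₂ : netOf s₂ = netOf s := (f₂.netOf_eq (by decide)).trans k₁
    have r₁ : s₁.reg rRoot = s.reg rRoot := f₁.reg _ rfl
    have c₁ : s₁.reg rCost = 0 := f₁.reg _ rfl
    have b₃ : s₃.reg rBud = s.reg rBud := (f₃.reg _ rfl).trans ((f₂.reg _ rfl).trans (f₁.reg _ rfl))
    rw [d₁, k₁, r₁, h₁, c₁] at h₂
    rw [d₂, k₂, h₂.1, h₂.2] at h₃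
    rw [Net.encodes_iff]
    simp [Store.setReg, Expr.eval, h₃, b₃, Nat.sub_eq_zero_iff_le, and_assoc]
  · simp only [Expr.cost]
    have h1 : s.reg rNum * (108 + (s.reg rTot - s.reg rNum) * 108) ≤
        s.reg rTot * (108 + s.reg rTot * 108) := by gcongr; omega
    have h2 : (s.reg rTot - s.reg rNum) * (200 + D * 26) ≤ s.reg rTot * (200 + D * 26) := by
      gcongr; omega
    have h3 : s.reg rTot * (330 + s.reg rTot * 108 + D * 26) =
      s.reg rTot * (108 + s.reg rTot * 108) + s.reg rTot * (200 + D * 26) +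
        s.reg rTot * 22 := by ring
    omega

/-! ### Enumerating the vectors of digits -/

/-- Add one to the number represented by the digits at the live positions. In the end `rCarry` is
one if and only if there was an overflow. -/
def incrProg : Prog :=
  setReg rCarry (lit 1) ;;
    forLoop rI (lit 0) rTot (ite (get aLive (reg rI)) (ite (reg rCarry)
      (ite ((reg rBase ∸ lit 1) ∸ get aDig (reg rI))
        (setArr aDig (reg rI) (get aDig (reg rI) ⊹ lit 1) ;; setReg rCarry (lit 0))
        (setArr aDig (reg rI) (lit 0))) skip) skip)

theorem isDigits_update {D : ℕ} {P : ℕ → Prop} {t : ℕ → ℕ} (h : Net.IsDigits D P t) {i x : ℕ}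
    (hi : P i) (hx : x < D) : Net.IsDigits D P (Function.update t i x) := by
  intro p
  by_cases hp : p = i
  · subst hp
    simpa using ⟨hx, fun h => absurd hi h⟩
  · rw [Function.update_of_ne hp]
    exact h p

theorem numeral_update_succ {D : ℕ} {P : ℕ → Prop} [DecidablePred P] (t : ℕ → ℕ) {i : ℕ} (x : ℕ)
    (hi : P i) : numeral D P (Function.update t i x) (i + 1) =
      numeral D P t i + x * D ^ Nat.count P i := by
  rw [numeral, if_pos hi, Function.update_self,
    numeral_congr fun p hp => Function.update_of_ne hp.ne _ _]

/-- The positions of the digits in the memory `s` are the names in use. -/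
def IsPos (s : Store) (p : ℕ) : Prop := p ∈ (netOf s).V ∨ p ∈ (netOf s).E

theorem isPos_iff {s : Store} (hnt : s.reg rNum ≤ s.reg rTot) {p : ℕ} :
    IsPos s p ↔ p < s.reg rTot ∧ s.arr aLive p ≠ 0 := by
  rw [IsPos, mem_netOf_V, mem_netOf_E, ← or_and_right]
  exact and_congr_left fun _ => by omega

/-- Adding one changes the value by one, up to an overflow that is left in `rCarry`. -/
theorem incrProg_ok {s : Store} {D : ℕ} (hnt : s.reg rNum ≤ s.reg rTot) (hD : s.reg rBase = D)
    (hd : Net.IsDigits D (IsPos s) (s.arr aDig)) :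
    Ok incrProg s (10 + s.reg rTot * 40) fun s' => Net.IsDigits D (IsPos s) (s'.arr aDig) ∧
      s'.reg rCarry ≤ 1 ∧ numeral D (fun p => s.arr aLive p ≠ 0) (s'.arr aDig) (s.reg rTot) +
        s'.reg rCarry * D ^ Nat.count (fun p => s.arr aLive p ≠ 0) (s.reg rTot) =
        numeral D (fun p => s.arr aLive p ≠ 0) (s.arr aDig) (s.reg rTot) + 1 := by
  set P : ℕ → Prop := fun p => s.arr aLive p ≠ 0 with hP
  have hloop := Ok.forLoop (x := rI) (y := rTot) (lo := lit 0)
    (p := ite (get aLive (reg rI)) (ite (reg rCarry)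
      (ite ((reg rBase ∸ lit 1) ∸ get aDig (reg rI))
        (setArr aDig (reg rI) (get aDig (reg rI) ⊹ lit 1) ;; setReg rCarry (lit 0))
        (setArr aDig (reg rI) (lit 0))) skip) skip) (T := 30) (s := s.setReg rCarry 1) (a := 0)
    (b := s.reg rTot) (fun i s' => Net.IsDigits D (IsPos s) (s'.arr aDig) ∧ s'.reg rCarry ≤ 1 ∧
      (∀ p, i ≤ p → s'.arr aDig p = s.arr aDig p) ∧
      numeral D P (s'.arr aDig) i + s'.reg rCarry * D ^ Nat.count P i =
        numeral D P (s.arr aDig) i + 1)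
    (by norm_num) rfl rfl rfl rfl (Nat.zero_le _) ?_ ?_
  · refine (Ok.setReg_seq (hloop.mono le_rfl fun s' _ h => ⟨h.1.1, h.1.2.1, h.1.2.2.2⟩)).le ?_
    simp only [Expr.cost]
    omega
  · simpa [Store.setReg, numeral] using hd
  · rintro i s' - hi ⟨h1, h2, h3, h4⟩ hreg f
    have e1 : s'.reg rBase = D := (f.reg _ rfl).trans hD
    have e2 : s'.arr aLive = s.arr aLive := f.arr _ rfl
    refine (Ok.ite (T₁ := 26) (T₂ := 1) (fun k1 => (Ok.ite (T₁ := 22) (T₂ := 1) (fun k2 =>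
      (Ok.ite (T₁ := 9) (T₂ := 4) (fun k3 =>
        (Ok.setArr_seq <| Ok.setReg ?_).le (by simp [Expr.cost]))
        fun k3 => (Ok.setArr ?_).le (by simp [Expr.cost])).le (by simp [Expr.cost]))
      fun k2 => Ok.skip ?_).le (by simp [Expr.cost])) fun k1 => Ok.skip ?_).le (by simp [Expr.cost])
    all_goals
      simp only [Expr.eval, hreg, e2] at k1
      have hPi : P i ↔ s.arr aLive i ≠ 0 := Iff.rfl
      have hsucc : numeral D P (s.arr aDig) (i + 1) = numeral D P (s.arr aDig) i +
        if P i then s.arr aDig i * D ^ Nat.count P i else 0 := rfl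
      rw [hsucc, Nat.count_succ]
    · have hpi : P i := k1
      simp only [Expr.eval, hreg, e1, h3 i le_rfl] at k2 k3
      have hc : s'.reg rCarry = 1 := by omega
      rw [hc] at h4
      simp only [Store.setReg, Store.setArr, Expr.eval, hreg, Function.update_self, h3 i le_rfl]
      refine ⟨isDigits_update h1 ((isPos_iff hnt).2 ⟨hi, k1⟩) (by omega), by simp,
        fun p hp => ?_, ?_⟩
      · rw [Function.update_of_ne (by omega), h3 p (by omega)]
      · rw [numeral_update_succ _ _ hpi, if_pos hpi]
        simp [hpi, add_mul]
        omega
    · have hpi : P i := k1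
      simp only [Expr.eval, hreg, e1, h3 i le_rfl] at k2 k3
      have hc : s'.reg rCarry = 1 := by omega
      rw [hc] at h4
      have hlt := (hd i).1
      have hD' : s.arr aDig i + 1 = D := by omega
      simp only [Store.setReg, Store.setArr, Expr.eval, hreg, Function.update_self]
      refine ⟨isDigits_update h1 ((isPos_iff hnt).2 ⟨hi, k1⟩) (by omega), by simpa using h2,
        fun p hp => ?_, ?_⟩
      · rw [Function.update_of_ne (by omega), h3 p (by omega)]
      · rw [numeral_update_succ _ _ hpi, if_pos hpi, if_pos hpi]
        simp [hc, pow_succ]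
        have : D ^ Nat.count P i * D = s.arr aDig i * D ^ Nat.count P i + D ^ Nat.count P i := by
          rw [← hD']; ring
        omega
    · have hpi : P i := k1
      simp only [Expr.eval] at k2
      have hnum : numeral D P (s'.arr aDig) (i + 1) = numeral D P (s'.arr aDig) i +
        if P i then s'.arr aDig i * D ^ Nat.count P i else 0 := rfl
      have hc : (s'.setReg rI (i + 1)).reg rCarry = s'.reg rCarry := rfl
      rw [k2] at h4
      refine ⟨h1, h2, fun p hp => h3 p (by omega), ?_⟩
      change numeral D P (s'.arr aDig) (i + 1) + _ = _
      rw [hnum, hc, k2, h3 i le_rfl]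
      omega
    · have hpi : ¬ P i := fun h => h k1
      have hnum : numeral D P (s'.arr aDig) (i + 1) = numeral D P (s'.arr aDig) i +
        if P i then s'.arr aDig i * D ^ Nat.count P i else 0 := rfl
      refine ⟨h1, h2, fun p hp => h3 p (by omega), ?_⟩
      change numeral D P (s'.arr aDig) (i + 1) + s'.reg rCarry * _ = _
      rw [hnum, if_neg hpi, if_neg hpi, if_neg hpi]
      exact h4

/-- Check the vector of digits, and go on to the next one if it does not encode a solution. -/
def enumStep : Prog :=
  checkProg ;; ite (reg rBad)
    (incrProg ;; setReg rRun (lit 1 ∸ reg rCarry)) (setReg rAns (lit 1) ;; setReg rRun (lit 0))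

/-- Go through the vectors of digits until one encodes a solution. -/
def enumProg : Prog := setReg rAns (lit 0) ;; setReg rRun (lit 1) ;; loop (reg rRun) enumStep

theorem enumStep_ok {s : Store} {M D : ℕ} (hM : s.reg rMid = M + 1) (hMD : M + 1 ≤ D)
    (hD : s.reg rBase = D) (hnt : s.reg rNum ≤ s.reg rTot)
    (hd : Net.IsDigits D (IsPos s) (s.arr aDig)) (ha : s.reg rAns = 0) :
    Ok enumStep s (80 + s.reg rTot * (370 + s.reg rTot * 108 + D * 26)) fun s' =>
      ((s'.reg rRun = 0 ∧ s'.reg rAns = 1) ∧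
        (netOf s).Encodes (s.reg rRoot) (s.reg rBud) M (s.arr aDig)) ∨
      (s'.reg rAns = 0 ∧ ¬ (netOf s).Encodes (s.reg rRoot) (s.reg rBud) M (s.arr aDig)) ∧
        Net.IsDigits D (IsPos s) (s'.arr aDig) ∧
        ((s'.reg rRun ≠ 0 ∧ numeral D (fun p => s.arr aLive p ≠ 0) (s'.arr aDig) (s.reg rTot) =
          numeral D (fun p => s.arr aLive p ≠ 0) (s.arr aDig) (s.reg rTot) + 1) ∨
        (s'.reg rRun = 0 ∧ D ^ Nat.count (fun p => s.arr aLive p ≠ 0) (s.reg rTot) ≤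
          numeral D (fun p => s.arr aLive p ≠ 0) (s.arr aDig) (s.reg rTot) + 1)) := by
  refine (Ok.seq (checkProg_ok (s := s) (M := M) (D := D) hM hMD (fun p => (hd p).1.le) (by omega))
    (T₂ := 22 + s.reg rTot * 40) fun s₁ f₁ h₁ => (Ok.ite (T₁ := 14 + s.reg rTot * 40) (T₂ := 4)
    (fun k => ?_) fun k => (Ok.setReg_seq <| Ok.setReg ?_).le (by simp [Expr.cost])).le ?_).le ?_
  · have t₁ : s₁.reg rTot = s.reg rTot := f₁.reg _ rfl
    have n₁ : s₁.reg rNum = s.reg rNum := f₁.reg _ rfl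
    have a₁ : s₁.reg rAns = s.reg rAns := f₁.reg _ rfl
    have d₁ : s₁.arr aDig = s.arr aDig := f₁.arr _ rfl
    have l₁ : s₁.arr aLive = s.arr aLive := f₁.arr _ rfl
    have p₁ : IsPos s₁ = IsPos s := by
      unfold IsPos
      rw [f₁.netOf_eq (by decide)]
    have hincr := incrProg_ok (s := s₁) (D := D) (by omega) ((f₁.reg _ rfl).trans hD)
      (by rwa [p₁, d₁])
    rw [t₁, d₁, p₁] at hincr
    simp only [l₁] at hincr
    refine (Ok.seq hincr fun s₂ f₂ h₂ => Ok.setReg (Or.inr ⟨⟨?_, ?_⟩, h₂.1, ?_⟩)).le ?_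
    · simp only [Expr.cost]
      omega
    · have : s₂.reg rAns = s₁.reg rAns := f₂.reg _ rfl
      simp [Store.setReg, this, a₁, ha]
    · rw [← h₁]
      exact k
    · obtain ⟨-, h3, h4⟩ := h₂
      have e : ((s₂.setReg rRun ((lit 1 ∸ reg rCarry).eval s₂)).reg rRun) = 1 - s₂.reg rCarry := rfl
      rw [e]
      rcases Nat.le_one_iff_eq_zero_or_eq_one.1 h3 with h | h <;> rw [h] at h4 ⊢
      · exact Or.inl ⟨one_ne_zero, by rw [zero_mul, add_zero] at h4; exact h4⟩
      · exact Or.inr ⟨rfl, by omega⟩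
  · exact Or.inl ⟨⟨rfl, rfl⟩, h₁.1 k⟩
  · simp only [Expr.cost]
    omega
  · have : s.reg rTot * (370 + s.reg rTot * 108 + D * 26) =
      s.reg rTot * (330 + s.reg rTot * 108 + D * 26) + s.reg rTot * 40 := by ring
    omega

/-- As long as the loop runs, no vector of digits with a value below that of the current one encodes
a solution; the distance of this value to its upper bound decreases. -/
theorem enumProg_ok {s : Store} {M D : ℕ} (hM : s.reg rMid = M + 1) (hMD : M + 1 ≤ D)
    (hD : s.reg rBase = D) (hnt : s.reg rNum ≤ s.reg rTot) (h0 : ∀ p, s.arr aDig p = 0) :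
    Ok enumProg s (10 + D ^ Nat.count (fun p => s.arr aLive p ≠ 0) (s.reg rTot) *
      (100 + s.reg rTot * (370 + s.reg rTot * 108 + D * 26))) fun s' =>
      ((∃ t, Net.IsDigits D (IsPos s) t ∧ (netOf s).Encodes (s.reg rRoot) (s.reg rBud) M t) →
        s'.reg rAns = 1) ∧
      ((¬ ∃ t, Net.IsDigits D (IsPos s) t ∧ (netOf s).Encodes (s.reg rRoot) (s.reg rBud) M t) →
        s'.reg rAns = 0) := by
  set P : ℕ → Prop := fun p => s.arr aLive p ≠ 0 with hP
  set Sol : (ℕ → ℕ) → Prop := fun t => (netOf s).Encodes (s.reg rRoot) (s.reg rBud) M t with hSol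
  have hinj : ∀ t t', Net.IsDigits D (IsPos s) t → Net.IsDigits D (IsPos s) t' →
      numeral D P t (s.reg rTot) = numeral D P t' (s.reg rTot) → t = t' := by
    intro t t' ht ht' h
    funext p
    by_cases hp : IsPos s p
    · obtain ⟨h1, h2⟩ := (isPos_iff hnt).1 hp
      exact numeral_inj (fun p => (ht p).1) (fun p => (ht' p).1) h p h1 h2
    · rw [(ht p).2 hp, (ht' p).2 hp]
  have hloop := Ok.loop (e := reg rRun) (p := enumStep)
    (T := 80 + s.reg rTot * (370 + s.reg rTot * 108 + D * 26))
    (fun s' => Frame enumProg s s' ∧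
      (s'.reg rRun ≠ 0 → s'.reg rAns = 0 ∧ Net.IsDigits D (IsPos s) (s'.arr aDig) ∧
        ∀ t, Net.IsDigits D (IsPos s) t →
          numeral D P t (s.reg rTot) < numeral D P (s'.arr aDig) (s.reg rTot) → ¬ Sol t) ∧
      (s'.reg rRun = 0 → ((∃ t, Net.IsDigits D (IsPos s) t ∧ Sol t) → s'.reg rAns = 1) ∧
        ((¬ ∃ t, Net.IsDigits D (IsPos s) t ∧ Sol t) → s'.reg rAns = 0)))
    (fun s' => if s'.reg rRun = 0 then 0 else
      D ^ Nat.count P (s.reg rTot) - numeral D P (s'.arr aDig) (s.reg rTot))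
    ?_ (s := (s.setReg rAns 0).setReg rRun 1) ?_
  · refine (Ok.setReg_seq <| Ok.setReg_seq <| hloop.mono le_rfl fun s' _ h => h.1.2.2 h.2).le ?_
    have : ((s.setReg rAns 0).setReg rRun 1).reg rRun = 1 := rfl
    simp only [this, Expr.cost, one_ne_zero, if_false]
    have h1 : (D ^ Nat.count P (s.reg rTot) -
        numeral D P (((s.setReg rAns 0).setReg rRun 1).arr aDig) (s.reg rTot)) *
        (80 + s.reg rTot * (370 + s.reg rTot * 108 + D * 26) + 1 + 1) ≤
        D ^ Nat.count P (s.reg rTot) *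
        (100 + s.reg rTot * (370 + s.reg rTot * 108 + D * 26)) :=
      Nat.mul_le_mul (Nat.sub_le _ _) (by omega)
    change _ ≤ 10 + D ^ Nat.count P (s.reg rTot) *
        (100 + s.reg rTot * (370 + s.reg rTot * 108 + D * 26))
    omega
  · rintro s' ⟨hf, hrun, -⟩ he
    simp only [Expr.eval] at he
    obtain ⟨ha, hd, hno⟩ := hrun he
    have e1 : s'.reg rMid = M + 1 := (hf.reg _ rfl).trans hM
    have e2 : s'.reg rTot = s.reg rTot := hf.reg _ rfl
    have e3 : s'.reg rNum = s.reg rNum := hf.reg _ rfl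
    have e4 : s'.reg rRoot = s.reg rRoot := hf.reg _ rfl
    have e5 : s'.reg rBud = s.reg rBud := hf.reg _ rfl
    have e6 : s'.reg rBase = D := (hf.reg _ rfl).trans hD
    have e7 : s'.arr aLive = s.arr aLive := hf.arr _ rfl
    have e8 : netOf s' = netOf s := hf.netOf_eq (by decide)
    have e9 : IsPos s' = IsPos s := by unfold IsPos; rw [e8]
    have hstep := enumStep_ok e1 hMD e6 (by omega) (by rwa [e9]) ha
    rw [e2, e4, e5, e8, e9] at hstep
    simp only [e7] at hstep
    have hlt := numeral_lt (P := P) (fun p => (hd p).1) (s.reg rTot)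
    refine hstep.mono le_rfl fun s'' f h => ?_
    have hf' : Frame enumProg s s'' := by
      refine hf.trans f (fun x hx => ⟨hx, ?_⟩) fun x hx => ⟨hx, hx⟩
      simp only [enumProg, Prog.writesReg, Bool.or_eq_false_iff] at hx
      exact hx.2.2
    rcases h with ⟨⟨h1, h2⟩, h3⟩ | ⟨⟨h1, h2⟩, h3, ⟨h4, h5⟩ | ⟨h4, h5⟩⟩
    · rw [if_pos h1, if_neg he]
      exact ⟨⟨hf', fun h => absurd h1 h, fun _ => ⟨fun _ => h2, fun h => absurd ⟨_, hd, h3⟩ h⟩⟩,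
        by omega⟩
    · rw [if_neg h4, if_neg he]
      change numeral D P _ _ = numeral D P _ _ + 1 at h5
      refine ⟨⟨hf', fun _ => ⟨h1, h3, fun t ht hlt' => ?_⟩, fun h => absurd h h4⟩, by omega⟩
      rw [h5, Nat.lt_succ_iff_lt_or_eq] at hlt'
      rcases hlt' with hlt' | heq
      · exact hno t ht hlt'
      · rw [hinj t _ ht hd heq]; exact h2
    · change D ^ Nat.count P _ ≤ numeral D P _ _ + 1 at h5
      rw [if_pos h4, if_neg he]
      have hall : ¬ ∃ t, Net.IsDigits D (IsPos s) t ∧ Sol t := by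
        rintro ⟨t, ht, hs⟩
        have hlt' := numeral_lt (P := P) (fun p => (ht p).1) (s.reg rTot)
        rcases (show numeral D P t (s.reg rTot) < numeral D P (s'.arr aDig) (s.reg rTot) ∨
          numeral D P t (s.reg rTot) = numeral D P (s'.arr aDig) (s.reg rTot) by omega) with hc | hc
        · exact hno t ht hc hs
        · rw [hinj t _ ht hd hc] at hs; exact h2 hs
      exact ⟨⟨hf', fun h => absurd h4 h, fun _ => ⟨fun h => absurd h hall, fun _ => h1⟩⟩, by omega⟩
  · have hd : (s.arr aDig) = fun _ => 0 := funext h0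
    have hz : numeral D P (((s.setReg rAns 0).setReg rRun 1).arr aDig) (s.reg rTot) = 0 := by
      change numeral D P (s.arr aDig) _ = 0
      rw [hd, numeral_zero]
    refine ⟨⟨fun x hx => ?_, fun _ _ => rfl⟩, fun _ => ⟨rfl, fun p => ⟨?_, fun _ => h0 p⟩, ?_⟩,
      fun h => absurd h (by simp [Store.setReg])⟩
    · simp only [enumProg, Prog.writesReg, Bool.or_eq_false_iff, beq_eq_false_iff_ne] at hx
      simp [Store.setReg, Ne.symm hx.1, Ne.symm hx.2.1]
    · change s.arr aDig p < D
      rw [h0]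
      omega
    · intro t _ hlt
      rw [hz] at hlt
      omega

/-! ### The algorithm -/

/-- The algorithm: build the network of the instance, eliminate the vertices of degree one and two,
and try all vectors of small digits. -/
def mainProg : Prog := initProg ;; elimProg ;; countProg ;; enumProg ;; setReg rNum (reg rAns)

theorem count_live {s : Store} (hnt : s.reg rNum ≤ s.reg rTot) :
    Nat.count (fun p => s.arr aLive p ≠ 0) (s.reg rTot) = (netOf s).V.card + (netOf s).E.card := by
  rw [Nat.count_eq_card_filter_range, ← Finset.card_union_of_disjoint]
  · congr 1
    ext p
    rw [Finset.mem_union, Finset.mem_filter, Finset.mem_range]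
    exact (isPos_iff hnt).symm
  · rw [Finset.disjoint_left]
    intro p hp hp'
    have := (mem_netOf_V.1 hp).1
    have := (mem_netOf_E.1 hp').1
    omega

theorem mainProg_ok (I : Instance) (hW : I.W.Nonempty) (hG : StronglyConnected I.G) :
    ∃ D c : ℕ, D ≤ 8 * I.fen + 3 ∧ D ≤ I.n + 2 * (I.n * I.n) + 2 ∧ c ≤ 5 * I.fen + 1 ∧
      Ok mainProg I.input (300 + I.n * (200 + I.n * 110) +
        (I.n + 1) * (I.n + 1) * (2010 + I.n * I.n * 100) + (I.n * I.n + I.n) * 30 +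
        D ^ c * (100 + (I.n * I.n + I.n) * (370 + (I.n * I.n + I.n) * 108 + D * 26)))
        fun s => (I.IsYes → s.reg 0 = 1) ∧ (¬ I.IsYes → s.reg 0 = 0) := by
  obtain ⟨t, s, hrun, ht, hI, hn, hb, htot, r, hr, hroot⟩ := initProg_ok I hW
  have f := hrun.frame
  have hinv : (netOf s).Inv (s.reg rRoot) I.fen := by rw [hroot]; exact hI.inv hG r
  have hfeas : (netOf s).Feas (s.reg rRoot) I.budget ↔ I.IsYes := by
    rw [hroot]
    exact ⟨hI.isYes, hI.feas hr⟩
  have hd : ∀ p, s.arr aDig p = 0 := fun p => by rw [f.arr _ rfl]; rfl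
  obtain ⟨t', s', hrun', ht', hinv', hfeas', hstuck⟩ :=
    elimProg_ok (B := I.budget) hinv (by rw [hn, htot]; omega)
  have f' := hrun'.frame
  have hn' : s'.reg rNum = I.n := (f'.reg _ rfl).trans hn
  have htot' : s'.reg rTot = I.n * I.n + I.n := (f'.reg _ rfl).trans htot
  have hb' : s'.reg rBud = I.budget := (f'.reg _ rfl).trans hb
  have hroot' : s'.reg rRoot = s.reg rRoot := f'.reg _ rfl
  have hd' : ∀ p, s'.arr aDig p = 0 := fun p => by rw [f'.arr _ rfl]; exact hd p
  have hcard := hinv'.card_le (i := s.reg rTot) (fun e he => by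
    rw [htot, ← htot']; exact (mem_netOf_E.1 he).1.2) hstuck
  have hV : (netOf s').V.card ≤ I.n := by
    refine (Finset.card_filter_le _ _).trans ?_
    rw [hn', Finset.card_range]
  have hE : (netOf s').E.card ≤ I.n * I.n := by
    refine (Finset.card_filter_le _ _).trans ?_
    rw [hn', htot', Nat.card_Ico]
    omega
  obtain ⟨t₂, s₂, hrun₂, ht₂, hD, hM⟩ := countProg_ok (s := s') (by omega)
  have f₂ := hrun₂.frame
  have hN₂ : netOf s₂ = netOf s' := f₂.netOf_eq (by decide)
  have hn₂ : s₂.reg rNum = I.n := (f₂.reg _ rfl).trans hn'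
  have htot₂ : s₂.reg rTot = I.n * I.n + I.n := (f₂.reg _ rfl).trans htot'
  have hb₂ : s₂.reg rBud = I.budget := (f₂.reg _ rfl).trans hb'
  have hroot₂ : s₂.reg rRoot = s.reg rRoot := (f₂.reg _ rfl).trans hroot'
  have hd₂ : ∀ p, s₂.arr aDig p = 0 := fun p => by rw [f₂.arr _ rfl]; exact hd' p
  have hnt₂ : s₂.reg rNum ≤ s₂.reg rTot := by omega
  have henum := enumProg_ok (s := s₂) hM (by omega) hD hnt₂ hd₂
  have hiff : (∃ t, Net.IsDigits ((netOf s').V.card + 2 * (netOf s').E.card + 2) (IsPos s₂) t ∧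
      (netOf s₂).Encodes (s₂.reg rRoot) (s₂.reg rBud) (netOf s').E.card t) ↔ I.IsYes := by
    rw [← hfeas, ← hfeas', Net.feas_iff_exists_digits hinv'.root hinv'.ends]
    · unfold IsPos
      rw [hN₂, hroot₂, hb₂]
    · rw [Finset.disjoint_left]
      intro p hp hp'
      have := (mem_netOf_V.1 hp).1
      have := (mem_netOf_E.1 hp').1
      omega
  rw [hiff, count_live hnt₂, htot₂, hN₂] at henum
  obtain ⟨t₃, s₃, hrun₃, ht₃, hyes, hno⟩ := henum
  refine ⟨(netOf s').V.card + 2 * (netOf s').E.card + 2, (netOf s').V.card + (netOf s').E.card,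
    by omega, by omega, by omega, _, _,
    .seq hrun (.seq hrun' (.seq hrun₂ (.seq hrun₃ (.setReg _ _ _)))),
    ?_, fun h => ?_, fun h => ?_⟩
  · rw [hn, htot] at ht'
    rw [htot'] at ht₂
    rw [Nat.add_sub_cancel] at ht'
    simp only [Expr.cost]
    omega
  · simpa [Store.setReg, Expr.eval] using hyes h
  · simpa [Store.setReg, Expr.eval] using hno h

/-- The number of vectors of digits is `k ^ O(k)`. -/
theorem pow_le_of_le {k D c : ℕ} (hD : D ≤ 8 * k + 3) (hc : c ≤ 5 * k + 1) :
    D ^ c ≤ 11 ^ 6 * k ^ (30 * k) := by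
  have h1 : D ^ c ≤ (8 * k + 3) ^ (5 * k + 1) :=
    (Nat.pow_le_pow_left hD c).trans (Nat.pow_le_pow_right (by omega) hc)
  refine h1.trans ?_
  match k with
  | 0 => norm_num
  | 1 => norm_num
  | k + 2 =>
    -- `11 k ≤ k ^ 5` for `k ≥ 2`
    have h2 : 8 * (k + 2) + 3 ≤ (k + 2) ^ 5 := by
      have h3 : 2 ^ 4 ≤ (k + 2) ^ 4 := Nat.pow_le_pow_left (by omega) 4
      have h4 : 2 ^ 4 * (k + 2) ≤ (k + 2) ^ 4 * (k + 2) := Nat.mul_le_mul_right _ h3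
      rw [pow_succ]
      omega
    calc (8 * (k + 2) + 3) ^ (5 * (k + 2) + 1) ≤ ((k + 2) ^ 5) ^ (6 * (k + 2)) :=
          (Nat.pow_le_pow_left h2 _).trans (Nat.pow_le_pow_right (by positivity) (by omega))
      _ = (k + 2) ^ (30 * (k + 2)) := by rw [← pow_mul]; congr 1; ring
      _ ≤ _ := Nat.le_mul_of_pos_left _ (by norm_num)

/-- The step count of the algorithm is of the required form; the product of a power of `n` and a
power of `k` is at most the sum of their squares. -/
theorem time_le {n k D X : ℕ} (hn : 2 ≤ n) (hD : D ≤ n + 2 * (n * n) + 2)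
    (hX : X ≤ 11 ^ 6 * k ^ (30 * k)) :
    300 + n * (200 + n * 110) + (n + 1) * (n + 1) * (2010 + n * n * 100) + (n * n + n) * 30 +
      X * (100 + (n * n + n) * (370 + (n * n + n) * 108 + D * 26)) ≤
      k ^ (100 * k) + n ^ 100 := by
  set q := n * n with hq
  set K := k ^ (30 * k) with hK
  have hK1 : 1 ≤ K := by
    rcases Nat.eq_zero_or_pos k with rfl | h
    · simp [hK]
    · exact Nat.pos_of_ne_zero (pow_ne_zero _ h.ne')
  have hq4 : 2 * 2 ≤ q := Nat.mul_le_mul hn hn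
  have hnq : 2 * n ≤ q := Nat.mul_le_mul_right n hn
  have hqq : 4 * q ≤ q * q := Nat.mul_le_mul_right q hq4
  have h1 : n * (200 + n * 110) ≤ 400 * (q * q) := by
    have : n * (200 + n * 110) = 200 * n + 110 * q := by rw [hq]; ring
    omega
  have h2 : (n + 1) * (n + 1) * (2010 + q * 100) ≤ 3 * q * (603 * q) :=
    Nat.mul_le_mul (by have : (n + 1) * (n + 1) = q + 2 * n + 1 := by rw [hq]; ring
                       omega) (by omega)
  have h3 : (q + n) * (370 + (q + n) * 108 + D * 26) ≤ 2 * q * (500 * q) :=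
    Nat.mul_le_mul (by omega) (by omega)
  have h4 : 3 * q * (603 * q) = 1809 * (q * q) := by ring
  have h5 : 2 * q * (500 * q) = 1000 * (q * q) := by ring
  have h6 : X * (100 + (q + n) * (370 + (q + n) * 108 + D * 26)) ≤
      11 ^ 6 * K * (1100 * (q * q)) := Nat.mul_le_mul hX (by omega)
  have h7 : 3000 * (q * q) ≤ K * (3000 * (q * q)) := Nat.le_mul_of_pos_left _ hK1
  have h8 : 300 + n * (200 + n * 110) + (n + 1) * (n + 1) * (2010 + q * 100) + (q + n) * 30 +
      X * (100 + (q + n) * (370 + (q + n) * 108 + D * 26)) ≤ K * (2 ^ 32 * (q * q)) := by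
    have : K * (2 ^ 32 * (q * q)) = 2 ^ 32 * (K * (q * q)) := by ring
    have : K * (3000 * (q * q)) = 3000 * (K * (q * q)) := by ring
    have : 11 ^ 6 * K * (1100 * (q * q)) = 1948717100 * (K * (q * q)) := by ring
    omega
  refine h8.trans ?_
  have h9 : K * (2 ^ 32 * (q * q)) ≤ K * K + (2 ^ 32 * (q * q)) * (2 ^ 32 * (q * q)) := by
    rcases le_total K (2 ^ 32 * (q * q)) with h | h
    · exact (Nat.mul_le_mul_right _ h).trans (Nat.le_add_left _ _)
    · exact (Nat.mul_le_mul_left _ h).trans (Nat.le_add_right _ _)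
  refine h9.trans (Nat.add_le_add ?_ ?_)
  · rw [hK, ← pow_add]
    rcases Nat.eq_zero_or_pos k with rfl | h
    · simp
    · exact Nat.pow_le_pow_right h (by omega)
  · calc (2 ^ 32 * (q * q)) * (2 ^ 32 * (q * q)) = 2 ^ 64 * n ^ 8 := by rw [hq]; ring
      _ ≤ n ^ 64 * n ^ 8 := Nat.mul_le_mul_right _ (Nat.pow_le_pow_left hn 64)
      _ = n ^ 72 := by rw [← pow_add]
      _ ≤ n ^ 100 := Nat.pow_le_pow_right (by omega) (by norm_num)

end DWRP

theorem theorem2 :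
    ∃ (p : DWRP.Prog) (c : ℕ), ∀ I : DWRP.Instance,
      2 ≤ I.W.card → DWRP.StronglyConnected I.G →
        DWRP.DecidesWithin p I (I.fen ^ (c * I.fen) + I.n ^ c) := by
  refine ⟨DWRP.mainProg, 100, fun I hW hG => ?_⟩
  obtain ⟨D, c, hD, hDn, hc, t, s, hrun, ht, hyes, hno⟩ :=
    DWRP.mainProg_ok I (Finset.card_pos.1 (by omega)) hG
  refine ⟨t, s, hrun, ht.trans ?_, hyes, hno⟩
  have hn : 2 ≤ I.n := hW.trans (by simpa using Finset.card_le_univ I.W)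
  exact DWRP.time_le hn hDn (DWRP.pow_le_of_le hD hc)
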